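/- Let $X$ be a random vector in $\mathbb{R}^n$ with $\mathbb{E}|X|^2<\infty$, mean $\mu$ and non-singular covariance matrix $\Sigma$, and let $X(1),\dots,X(N)$ be i.i.d. samples of $X$, with $N>n$. Put $$\bar X=\frac1N\sum_{k=1}^N X(k),\qquad \bar\Sigma=\frac1N\sum_{k=1}^N X(k)X(k)^{\mathrm T}-\bar X\bar X^{\mathrm T},\qquad \tilde X^{(2)}(k)=\Sigma^{1/2}\bar\Sigma^{-1/2}\,[X(k)-\bar X]+\mu ,$$ where $^{1/2}$ is the positive semi-definite square root. If $X$ has a density $p$, we say that $X$ has the *second order asymptotic universal moment matching property* if for every smooth function $f:\mathbb{R}^n\to\mathbb{R}$ with compact support $\mathrm{supp}(f)\subseteq\mathrm{supp}(p)^{o}$ (the interior of the support of $p$) there are constants $A_N$ (which may depend on $f$) with $\lim_{N\to\infty}A_N=1$ and $$\mathrm{Var}\Big[\frac1N\sum_{k=1}^N f(\tilde X^{(2)}(k))\Big]\le A_N\,\mathrm{Var}\Big[\frac1N\sum_{k=1}^N f(X(k))\Big]=\frac{A_N}{N}\,\mathrm{Var}[f(X)]\qquad(N>n).$$ (i) Suppose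 that $X$ is normal. Then $X$ has a density, and it has the second order asymptotic universal moment matching property (with respect to any version of its density). Moreover, for every smooth $f:\mathbb{R}^n\to\mathbb{R}$ with compact support there are constants $A_N=1+\mathrm{O}(N^{-1/2})$ (which may depend on $f$) such that for all $N>n$ $$\mathrm{Var}\Big[\frac1N\sum_{k=1}^N f(\tilde X^{(2)}(k))\Big]=\frac{A_N}{N}\Big(\mathrm{Var}[f(X)]-\mathbb{E}[\partial f(X)]\,\Sigma\,\mathbb{E}[\partial f(X)]^{\mathrm T}-\tfrac12\,\mathrm{tr}\big[(\Sigma\,\mathbb{E}[\partial^2 f(X)])^2\big]\Big),$$ where $\partial f$ is the gradient (a row vector) and $\partial^2 f$ the Hessian matrix of $f$. (ii) Conversely, suppose that $X$ has a density $p$ that is differentiable on $\mathbb{R}^n$. If $X$ has the second order asymptotic universal moment matching property, then $X$ is normal. -/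

import Mathlib

open MeasureTheory ProbabilityTheory Filter Topology Asymptotics
open scoped ContDiff Matrix MatrixOrder

noncomputable section

namespace MomentMatching

variable {n N : ℕ}

/-- The mean `m = 𝔼 X` of a random vector with law `μ`. -/
def mean (μ : Measure (EuclideanSpace ℝ (Fin n))) : EuclideanSpace ℝ (Fin n) :=
  ∫ x, x ∂μ

/-- The covariance matrix `Σᵢⱼ = Cov(Xᵢ, Xⱼ)` of a random vector with law `μ`. -/
def covMatrix (μ : Measure (EuclideanSpace ℝ (Fin n))) : Matrix (Fin n) (Fin n) ℝ :=
  Matrix.of fun i j => cov[fun x => x i, fun x => x j; μ]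

/-- `p` is a (nonnegative, Borel) Lebesgue density of `μ`. -/
structure IsDensity (μ : Measure (EuclideanSpace ℝ (Fin n)))
    (p : EuclideanSpace ℝ (Fin n) → ℝ) : Prop where
  measurable : Measurable p
  nonneg : ∀ x, 0 ≤ p x
  eq_withDensity : μ = volume.withDensity fun x => ENNReal.ofReal (p x)

/-- The joint law of `N` i.i.d. samples `X(1), …, X(N)` of the distribution `μ`. -/
def sampleLaw (μ : Measure (EuclideanSpace ℝ (Fin n))) (N : ℕ) :
    Measure (Fin N → EuclideanSpace ℝ (Fin n)) :=
  Measure.pi fun _ => μ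

/-- The sample mean `X̄ = N⁻¹ ∑ₖ X(k)`. -/
def sampleMean (x : Fin N → EuclideanSpace ℝ (Fin n)) : EuclideanSpace ℝ (Fin n) :=
  (N : ℝ)⁻¹ • ∑ k, x k

/-- The sample covariance matrix `Σ̄ = N⁻¹ ∑ₖ X(k) X(k)ᵀ - X̄ X̄ᵀ`. -/
def sampleCov (x : Fin N → EuclideanSpace ℝ (Fin n)) : Matrix (Fin n) (Fin n) ℝ :=
  (N : ℝ)⁻¹ • ∑ k, Matrix.vecMulVec (x k).ofLp (x k).ofLp
    - Matrix.vecMulVec (sampleMean x).ofLp (sampleMean x).ofLp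

/-- The second order moment matched samples
`X̃(k) = Σ^{1/2} Σ̄^{-1/2} (X(k) - X̄) + m`, where the square roots are the positive
semidefinite ones. -/
def matched (μ : Measure (EuclideanSpace ℝ (Fin n)))
    (x : Fin N → EuclideanSpace ℝ (Fin n)) (k : Fin N) : EuclideanSpace ℝ (Fin n) :=
  Matrix.toEuclideanLin (CFC.sqrt (covMatrix μ) * (CFC.sqrt (sampleCov x))⁻¹)
    (x k - sampleMean x) + mean μ

/-- The plain Monte Carlo estimator `N⁻¹ ∑ₖ f(X(k))`. -/
def plainEstimator (f : EuclideanSpace ℝ (Fin n) → ℝ)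
    (x : Fin N → EuclideanSpace ℝ (Fin n)) : ℝ :=
  (N : ℝ)⁻¹ * ∑ k, f (x k)

/-- The second order moment matching estimator `N⁻¹ ∑ₖ f(X̃(k))`. -/
def matchedEstimator (μ : Measure (EuclideanSpace ℝ (Fin n)))
    (f : EuclideanSpace ℝ (Fin n) → ℝ) (x : Fin N → EuclideanSpace ℝ (Fin n)) : ℝ :=
  (N : ℝ)⁻¹ * ∑ k, f (matched μ x k)

/-- The second order asymptotic universal moment matching property of a distribution `μ` with
density `p`. The sequence `A` may depend on the integrand `f`; the sample size `N` exceeds the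
dimension `n`, since the sample covariance matrix of `N ≤ n` points is singular. -/
def SecondOrderUniversal (μ : Measure (EuclideanSpace ℝ (Fin n)))
    (p : EuclideanSpace ℝ (Fin n) → ℝ) : Prop :=
  ∀ f : EuclideanSpace ℝ (Fin n) → ℝ, ContDiff ℝ ∞ f → HasCompactSupport f →
    tsupport f ⊆ interior (tsupport p) →
    ∃ A : ℕ → ℝ, Tendsto A atTop (𝓝 1) ∧
      ∀ N : ℕ, n < N →
        Var[matchedEstimator μ f; sampleLaw μ N] ≤ A N * Var[plainEstimator f; sampleLaw μ N]

/-- The partial derivative `∂ᵢ f`. -/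
def partialDeriv (i : Fin n) (f : EuclideanSpace ℝ (Fin n) → ℝ)
    (x : EuclideanSpace ℝ (Fin n)) : ℝ :=
  fderiv ℝ f x (EuclideanSpace.single i 1)

/-- The expected gradient `𝔼[∂f(X)]`. -/
def expGrad (μ : Measure (EuclideanSpace ℝ (Fin n)))
    (f : EuclideanSpace ℝ (Fin n) → ℝ) : Fin n → ℝ :=
  fun i => ∫ x, partialDeriv i f x ∂μ

/-- The expected Hessian `𝔼[∂²f(X)]`. -/
def expHess (μ : Measure (EuclideanSpace ℝ (Fin n)))
    (f : EuclideanSpace ℝ (Fin n) → ℝ) : Matrix (Fin n) (Fin n) ℝ :=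
  Matrix.of fun i j => ∫ x, partialDeriv i (partialDeriv j f) x ∂μ

end MomentMatching

end

/-!
The matched estimator is the empirical mean of `f` composed with an affine transformation of the
sample points, which depends on the sample only through the empirical means of the statistic
`ψ = (x - m, (x - m)(x - m)ᵀ)` of first and second moments. Near the true moments this dependence is
smooth, since `Q ↦ Q²` is a local diffeomorphism at a positive definite matrix
(`exists_local_sqrt`). So, to first order, the estimator is the empirical mean of `f + ℓ (ψ - 𝔼 ψ)`,
where the influence functional `ℓ` has expected derivatives of `f` as values
(`exists_linearization`, `exists_influence`). For the variance there are
two versions of this.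

* If eighth moments exist, the remainder has second moment `O(N⁻²)`, and `N` times the variance of
  the estimator is `Var[f + ℓ ψ] + O(N^{-1/2})` (`IsLinearizable.exists_abs_variance_sub_le`).
* If only second moments exist, the estimator is correlated with sums `∑ₖ h(X(k))` of bounded centred
  functions. Replacing a single sample point shows that the covariance converges to
  `𝔼[(f + ℓ (ψ - 𝔼 ψ)) h]`, and the Cauchy–Schwarz inequality yields a lower bound for the variance
  (`IsLinearizable.sq_integral_mul_le`).

For a normal distribution the Stein identity (`stein_identity`) shows that `ℓ (ψ - 𝔼 ψ)` is minus the
`L²` projection of `f - 𝔼 f` to the centred polynomials of degree at most two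
(`influence_eq_neg_quadraticPart`). So matching decreases the limit variance by the variance of
the projection, which leaves the stated bracket (`variance_sub_quadraticPart`). If the bracket
vanishes, then `f` is a polynomial with compact support, hence constant.

Conversely, let `f` be a test function orthogonal to the polynomials of degree at most two. Then
`q = ℓ (ψ - 𝔼 ψ)` is uncorrelated with `f`, so the lower bound for the variance is compatible with
universal moment matching only if `q` is constant on every ball on which the density is positive. Then
the linear coefficients of `ℓ` vanish, and these are the expected gradient of `f`, up to sign
(`integral_fderiv_eq_zero_of_secondOrderUniversal`). By duality the
gradient of the density is, weakly, the density times a polynomial vector field of degree at most two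
(`exists_weak_gradient`), and the density is the exponential of a polynomial of degree at most three,
positive everywhere (`exists_density_eq_exp`). An integrable function of this form has no cubic part
and a negative definite quadratic part (`cubic_eq_zero_and_quadratic_pos`), so it is a Gaussian
density.
-/

noncomputable section

namespace MomentMatching

/-! ### Moments of empirical means -/

section EmpiricalMean

variable {𝒳 W : Type*} [NormedAddCommGroup W] [NormedSpace ℝ W]

/-- The empirical mean `N⁻¹ ∑ₖ φ(X(k))` of a statistic `φ` over the sample `x`. -/
def empMean {N : ℕ} (φ : 𝒳 → W) (x : Fin N → 𝒳) : W :=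
  (N : ℝ)⁻¹ • ∑ k, φ (x k)

theorem empMean_const {N : ℕ} (hN : 0 < N) (c : W) (x : Fin N → 𝒳) :
    empMean (fun _ => c) x = c := by
  have : (N : ℝ) ≠ 0 := by positivity
  simp [empMean, ← Nat.cast_smul_eq_nsmul ℝ, smul_smul, this]

theorem empMean_sub_const {N : ℕ} (hN : 0 < N) (φ : 𝒳 → W) (c : W) (x : Fin N → 𝒳) :
    empMean φ x - c = empMean (fun y => φ y - c) x := by
  conv_lhs => rw [← empMean_const hN c x]
  simp [empMean, Finset.sum_sub_distrib, smul_sub]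

theorem clm_empMean {N : ℕ} {W' : Type*} [NormedAddCommGroup W'] [NormedSpace ℝ W']
    (L : W →L[ℝ] W') (φ : 𝒳 → W) (x : Fin N → 𝒳) :
    L (empMean φ x) = empMean (fun y => L (φ y)) x := by
  simp [empMean]

theorem abs_empMean_le {N : ℕ} {φ w : 𝒳 → ℝ} (h : ∀ y, |φ y| ≤ w y) (x : Fin N → 𝒳) :
    |empMean φ x| ≤ empMean w x := by
  simp only [empMean, smul_eq_mul, abs_mul, abs_inv, Nat.abs_cast]
  gcongr
  exact (Finset.abs_sum_le_sum_abs _ _).trans (Finset.sum_le_sum fun k _ => h _)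

theorem measurable_empMean {N : ℕ} [MeasurableSpace 𝒳] [MeasurableSpace W] [BorelSpace W]
    [SecondCountableTopology W] {φ : 𝒳 → W} (hφ : Measurable φ) :
    Measurable (fun x : Fin N → 𝒳 => empMean φ x) := by
  unfold empMean
  fun_prop

end EmpiricalMean

/-- Centred independent variables with fourth moments at most `κ` have partial sums with fourth
moment at most `3 κ` times the square of the number of summands: in the induction step only the
even mixed moments survive. -/
theorem integral_sum_pow_four_le {Ω ι : Type*} [MeasurableSpace Ω] {P : Measure Ω}
    [IsProbabilityMeasure P] {Z : ι → Ω → ℝ} (hind : iIndepFun Z P)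
    (hm : ∀ i, Measurable (Z i)) (h4 : ∀ i, MemLp (Z i) 4 P) (h0 : ∀ i, ∫ z, Z i z ∂P = 0)
    {κ : ℝ} (hκ : ∀ i, ∫ z, Z i z ^ 4 ∂P ≤ κ) (hκ0 : 0 ≤ κ) (s : Finset ι) :
    ∫ z, (∑ i ∈ s, Z i z) ^ 4 ∂P ≤ 3 * (s.card : ℝ) ^ 2 * κ := by
  classical
  induction s using Finset.induction_on with
  | empty => simp
  | insert i s his ih =>
    set S : Ω → ℝ := fun z => ∑ j ∈ s, Z j z with hS
    have hS4 : MemLp S 4 P := memLp_finsetSum _ fun j _ => h4 j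
    have hSm : Measurable S := by fun_prop
    have hSZ : S ⟂ᵢ[P] Z i := by
      have := hind.indepFun_finsetSum_of_notMem hm his
      convert this using 1
      ext z; simp [hS]
    have i4 : ∀ {F : Ω → ℝ}, MemLp F 4 P → Integrable (fun z => F z ^ 4) P := fun hF => by
      have := hF.integrable_norm_pow (by norm_num)
      simpa [Even.pow_abs (by decide : Even 4)] using this
    have i3 : ∀ {F : Ω → ℝ}, MemLp F 4 P → Integrable (fun z => F z ^ 3) P := fun {F} hF => by
      have h3 : MemLp F 3 P := hF.mono_exponent (by norm_num)
      have := h3.integrable_norm_pow (by norm_num)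
      refine this.mono' (by have := hF.1; fun_prop) (ae_of_all _ fun z => by simp)
    have i2 : ∀ {F : Ω → ℝ}, MemLp F 4 P → Integrable (fun z => F z ^ 2) P := fun {F} hF =>
      (hF.mono_exponent (by norm_num) : MemLp F 2 P).integrable_sq
    have i1 : ∀ {F : Ω → ℝ}, MemLp F 4 P → Integrable F P := fun {F} hF =>
      hF.integrable (by norm_num)
    have ind : ∀ a b : ℕ, (fun z => S z ^ a) ⟂ᵢ[P] (fun z => Z i z ^ b) := fun a b =>
      hSZ.comp (measurable_id.pow_const a) (measurable_id.pow_const b)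
    have hS0 : ∫ z, S z ∂P = 0 := by
      simp only [hS]
      rw [integral_finsetSum _ fun j _ => i1 (h4 j)]
      simp [h0]
    have m31 := (ind 3 1).integral_fun_mul_eq_mul_integral (by fun_prop) (by
      have := hm i; fun_prop)
    have m22 := (ind 2 2).integral_fun_mul_eq_mul_integral (by fun_prop) (by
      have := hm i; fun_prop)
    have m13 := (ind 1 3).integral_fun_mul_eq_mul_integral (by fun_prop) (by
      have := hm i; fun_prop)
    have j31 : Integrable (fun z => S z ^ 3 * Z i z ^ 1) P :=
      (ind 3 1).integrable_mul (i3 hS4) (by simpa using i1 (h4 i))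
    have j22 : Integrable (fun z => S z ^ 2 * Z i z ^ 2) P :=
      (ind 2 2).integrable_mul (i2 hS4) (i2 (h4 i))
    have j13 : Integrable (fun z => S z ^ 1 * Z i z ^ 3) P :=
      (ind 1 3).integrable_mul (by simpa using i1 hS4) (i3 (h4 i))
    simp only [pow_one, h0, hS0, mul_zero, zero_mul] at m31 m22 m13 j31 j13
    have hexp : ∫ z, (∑ j ∈ insert i s, Z j z) ^ 4 ∂P
        = ∫ z, S z ^ 4 ∂P + 6 * ((∫ z, S z ^ 2 ∂P) * ∫ z, Z i z ^ 2 ∂P)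
          + ∫ z, Z i z ^ 4 ∂P := by
      have : ∀ z, (∑ j ∈ insert i s, Z j z) ^ 4 = S z ^ 4 + (4 * (S z ^ 3 * Z i z)
          + (6 * (S z ^ 2 * Z i z ^ 2) + (4 * (S z * Z i z ^ 3) + Z i z ^ 4))) := by
        intro z
        rw [Finset.sum_insert his]; simp only [hS]; ring
      simp only [this]
      rw [integral_add (i4 hS4), integral_add (j31.const_mul 4), integral_add (j22.const_mul 6),
        integral_add (j13.const_mul 4) (i4 (h4 i)), integral_const_mul, integral_const_mul,
        integral_const_mul]
      · simp only [m31, m22, m13]; ring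
      · exact (j13.const_mul 4).add (i4 (h4 i))
      · exact (j22.const_mul 6).add ((j13.const_mul 4).add (i4 (h4 i)))
      · exact (j31.const_mul 4).add ((j22.const_mul 6).add ((j13.const_mul 4).add (i4 (h4 i))))
    have hZ2 : ∀ j, (∫ z, Z j z ^ 2 ∂P) ^ 2 ≤ κ := fun j => by
      have := variance_nonneg (fun z => Z j z ^ 2) P
      rw [variance_eq_sub] at this
      · have e : ∫ z, ((fun z => Z j z ^ 2) ^ 2) z ∂P = ∫ z, Z j z ^ 4 ∂P := by
          congr 1; ext z; simp only [Pi.pow_apply]; ring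
        rw [e] at this
        linarith [hκ j]
      · rw [memLp_two_iff_integrable_sq (by have := hm j; fun_prop)]
        refine (i4 (h4 j)).congr (ae_of_all _ fun z => by ring)
    have hZ2' : ∀ j, ∫ z, Z j z ^ 2 ∂P ≤ √κ := fun j => Real.le_sqrt_of_sq_le (hZ2 j)
    have hS2 : ∫ z, S z ^ 2 ∂P ≤ s.card * √κ := by
      have hv := IndepFun.variance_sum (μ := P) (X := Z) (s := s)
        (fun j _ => (h4 j).mono_exponent (by norm_num))
        (fun j _ k _ hjk => hind.indepFun hjk)
      rw [variance_of_integral_eq_zero (by fun_prop)] at hv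
      · have e : ∫ z, (∑ i ∈ s, Z i) z ^ 2 ∂P = ∫ z, S z ^ 2 ∂P := by simp [hS]
        rw [← e, hv, ← nsmul_eq_mul]
        refine Finset.sum_le_card_nsmul _ _ _ fun j _ => ?_
        rw [variance_of_integral_eq_zero (by have := hm j; fun_prop) (h0 j)]
        exact hZ2' j
      · simpa [hS] using hS0
    have hsq : √κ * √κ = κ := Real.mul_self_sqrt hκ0
    have hprod : (∫ z, S z ^ 2 ∂P) * ∫ z, Z i z ^ 2 ∂P ≤ s.card * κ := by
      calc _ ≤ (s.card * √κ) * √κ :=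
            mul_le_mul hS2 (hZ2' i) (integral_nonneg fun z => by positivity) (by positivity)
        _ = s.card * κ := by rw [mul_assoc, hsq]
    rw [hexp, Finset.card_insert_of_notMem his]
    push_cast
    have := hκ i
    nlinarith

/-- In finite dimension the fourth power of the norm is controlled by finitely many fourth powers
of linear functionals. -/
theorem exists_norm_pow_four_le (W : Type*) [NormedAddCommGroup W] [NormedSpace ℝ W]
    [FiniteDimensional ℝ W] :
    ∃ (d : ℕ) (ℓ : Fin d → W →L[ℝ] ℝ) (C : ℝ), 0 ≤ C ∧
      ∀ w, ‖w‖ ^ 4 ≤ C * ∑ i, (ℓ i w) ^ 4 := by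
  let b := Module.finBasis ℝ W
  refine ⟨_, fun i => LinearMap.toContinuousLinearMap (b.coord i),
    (∑ i, ‖b i‖) ^ 4, by positivity, fun w => ?_⟩
  set a : ℝ := ∑ i, (b.coord i w) ^ 4
  have ha : ∀ i, |b.coord i w| ^ 4 ≤ a := fun i => by
    have := Finset.single_le_sum (f := fun i => (b.coord i w) ^ 4) (fun i _ => by positivity)
      (Finset.mem_univ i)
    simpa [a, Even.pow_abs (by decide : Even 4)] using this
  obtain h | h := isEmpty_or_nonempty (Fin (Module.finrank ℝ W))
  · have : w = 0 := by rw [← b.sum_repr w]; simp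
    simp [this]
  obtain ⟨i, hi⟩ := Finite.exists_max fun i => |b.coord i w|
  have h1 : ‖w‖ ≤ |b.coord i w| * ∑ j, ‖b j‖ := by
    conv_lhs => rw [← b.sum_repr w]
    refine (norm_sum_le _ _).trans ?_
    rw [Finset.mul_sum]
    refine Finset.sum_le_sum fun j _ => ?_
    rw [norm_smul]
    gcongr
    exact hi j
  calc ‖w‖ ^ 4 ≤ (|b.coord i w| * ∑ j, ‖b j‖) ^ 4 := by gcongr
    _ = (∑ j, ‖b j‖) ^ 4 * |b.coord i w| ^ 4 := by ring
    _ ≤ (∑ j, ‖b j‖) ^ 4 * a := by gcongr; exact ha i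

section Moments

variable {𝒳 W : Type*} [MeasurableSpace 𝒳] {μ : Measure 𝒳} [IsProbabilityMeasure μ]
  [NormedAddCommGroup W]

theorem iIndepFun_comp_eval {β : Type*} [MeasurableSpace β] (N : ℕ) {φ : 𝒳 → β}
    (hφ : Measurable φ) :
    iIndepFun (fun (k : Fin N) (x : Fin N → 𝒳) => φ (x k)) (Measure.pi fun _ => μ) :=
  iIndepFun_pi (X := fun _ => φ) fun _ => hφ.aemeasurable

theorem integral_comp_eval {N : ℕ} [NormedSpace ℝ W] (k : Fin N) {φ : 𝒳 → W}
    (hφ : AEStronglyMeasurable φ μ) :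
    ∫ x : Fin N → 𝒳, φ (x k) ∂(Measure.pi fun _ => μ) = ∫ y, φ y ∂μ := by
  have := measurePreserving_eval (fun _ : Fin N => μ) k
  conv_rhs => rw [← this.map_eq]
  rw [integral_map this.measurable.aemeasurable (by rwa [this.map_eq])]

theorem integrable_comp_eval {N : ℕ} (k : Fin N) {φ : 𝒳 → W} (hφ : Integrable φ μ) :
    Integrable (fun x : Fin N → 𝒳 => φ (x k)) (Measure.pi fun _ => μ) :=
  (measurePreserving_eval (fun _ : Fin N => μ) k).integrable_comp_of_integrable hφ

theorem memLp_comp_eval {N : ℕ} (k : Fin N) {φ : 𝒳 → W} {p : ENNReal} (hφ : MemLp φ p μ) :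
    MemLp (fun x : Fin N → 𝒳 => φ (x k)) p (Measure.pi fun _ => μ) :=
  hφ.comp_measurePreserving (measurePreserving_eval (fun _ : Fin N => μ) k)

variable [NormedSpace ℝ W]

theorem memLp_empMean {N : ℕ} {φ : 𝒳 → W} {p : ENNReal} (hφ : MemLp φ p μ) :
    MemLp (fun x : Fin N → 𝒳 => empMean φ x) p (Measure.pi fun _ => μ) := by
  have h : MemLp (fun x : Fin N → 𝒳 => ∑ k, φ (x k)) p (Measure.pi fun _ => μ) :=
    memLp_finsetSum Finset.univ (f := fun (k : Fin N) (x : Fin N → 𝒳) => φ (x k))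
      fun k _ => memLp_comp_eval k hφ
  exact h.const_smul (N : ℝ)⁻¹

variable [FiniteDimensional ℝ W] [MeasurableSpace W] [BorelSpace W]

/-- The fourth moment of the deviation of an empirical mean is of order `N⁻²`. -/
theorem integral_norm_empMean_sub_pow_four_le {φ : 𝒳 → W} (hm : Measurable φ)
    (hφ : MemLp φ 4 μ) :
    ∃ C, 0 ≤ C ∧ ∀ N : ℕ, 0 < N →
      ∫ x : Fin N → 𝒳, ‖empMean φ x - ∫ y, φ y ∂μ‖ ^ 4 ∂(Measure.pi fun _ => μ)
        ≤ C / (N : ℝ) ^ 2 := by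
  obtain ⟨d, ℓ, C, hC, hℓ⟩ := exists_norm_pow_four_le W
  set c := ∫ y, φ y ∂μ
  set κ : Fin d → ℝ := fun i => ∫ y, (ℓ i (φ y - c)) ^ 4 ∂μ
  have hφc : MemLp (fun y => φ y - c) 4 μ := hφ.sub (memLp_const c)
  have hφi : Integrable φ μ := hφ.integrable (by norm_num)
  have hℓ4 : ∀ i, MemLp (fun y => ℓ i (φ y - c)) 4 μ := fun i => (ℓ i).comp_memLp' hφc
  have hκ0 : ∀ i, 0 ≤ κ i := fun i => integral_nonneg fun y => by positivity
  refine ⟨C * ∑ i, 3 * κ i, by positivity, fun N hN => ?_⟩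
  have hN' : (N : ℝ) ≠ 0 := by positivity
  have hi4 : ∀ i, Integrable (fun x : Fin N → 𝒳 => (ℓ i (empMean φ x - c)) ^ 4)
      (Measure.pi fun _ => μ) := fun i => by
    have h : MemLp (fun x : Fin N → 𝒳 => ℓ i (empMean φ x - c)) 4 (Measure.pi fun _ => μ) :=
      (ℓ i).comp_memLp' ((memLp_empMean hφ).sub (memLp_const c))
    simpa [-map_sub, Even.pow_abs (by decide : Even 4)] using h.integrable_norm_pow (by norm_num)
  have key : ∀ i, ∫ x : Fin N → 𝒳, (ℓ i (empMean φ x - c)) ^ 4 ∂(Measure.pi fun _ => μ)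
      ≤ 3 * κ i / (N : ℝ) ^ 2 := fun i => by
    have hmi : Measurable fun y => ℓ i (φ y - c) :=
      (ℓ i).continuous.measurable.comp (hm.sub_const c)
    have h1 := integral_sum_pow_four_le (P := Measure.pi fun _ : Fin N => μ)
      (Z := fun k x => ℓ i (φ (x k) - c)) (iIndepFun_comp_eval N hmi)
      (fun k => hmi.comp (measurable_pi_apply k)) (fun k => memLp_comp_eval k (hℓ4 i))
      (fun k => by
        rw [integral_comp_eval k (φ := fun y => ℓ i (φ y - c)) hmi.aestronglyMeasurable,
          (ℓ i).integral_comp_comm (φ := fun y => φ y - c) (hφi.sub (integrable_const c)),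
          integral_sub hφi (integrable_const c)]
        simp [c])
      (κ := κ i) (fun k => by
        rw [integral_comp_eval k (φ := fun y => (ℓ i (φ y - c)) ^ 4)
          (hmi.pow_const 4).aestronglyMeasurable]) (hκ0 i) Finset.univ
    have e : ∀ x : Fin N → 𝒳, (ℓ i (empMean φ x - c)) ^ 4
        = ((N : ℝ) ^ 4)⁻¹ * (∑ k, ℓ i (φ (x k) - c)) ^ 4 := fun x => by
      rw [empMean_sub_const hN, clm_empMean]
      simp only [empMean, smul_eq_mul, mul_pow, inv_pow]
    simp only [e]
    rw [integral_const_mul]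
    simp only [Finset.card_univ, Fintype.card_fin] at h1
    calc ((N : ℝ) ^ 4)⁻¹ * _ ≤ ((N : ℝ) ^ 4)⁻¹ * (3 * (N : ℝ) ^ 2 * κ i) := by gcongr
      _ = 3 * κ i / (N : ℝ) ^ 2 := by field_simp
  calc _ ≤ ∫ x : Fin N → 𝒳, C * ∑ i, (ℓ i (empMean φ x - c)) ^ 4 ∂(Measure.pi fun _ => μ) := by
        refine integral_mono_of_nonneg (ae_of_all _ fun x => by positivity)
          ((integrable_finsetSum _ fun i _ => hi4 i).const_mul C) (ae_of_all _ fun x => hℓ _)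
    _ = C * ∑ i, ∫ x : Fin N → 𝒳, (ℓ i (empMean φ x - c)) ^ 4 ∂(Measure.pi fun _ => μ) := by
        rw [integral_const_mul, integral_finsetSum _ fun i _ => hi4 i]
    _ ≤ C * ∑ i, 3 * κ i / (N : ℝ) ^ 2 := by gcongr with i; exact key i
    _ = _ := by rw [← Finset.sum_div, mul_div_assoc]

/-- The weak law of large numbers in `L¹`, for samples on the finite products `𝒳ᴺ`. -/
theorem tendsto_integral_norm_empMean_sub {φ : 𝒳 → W} (hm : Measurable φ)
    (hφ : Integrable φ μ) :
    Tendsto (fun N : ℕ => ∫ x : Fin N → 𝒳, ‖empMean φ x - ∫ y, φ y ∂μ‖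
      ∂(Measure.pi fun _ => μ)) atTop (𝓝 0) := by
  set c := ∫ y, φ y ∂μ
  let P : Measure (ℕ → 𝒳) := Measure.infinitePi fun _ => μ
  have hpres : ∀ i, MeasurePreserving (fun z : ℕ → 𝒳 => z i) P μ := fun i =>
    measurePreserving_eval_infinitePi (fun _ : ℕ => μ) i
  have hind : iIndepFun (fun (i : ℕ) (z : ℕ → 𝒳) => z i) P :=
    iIndepFun_infinitePi (P := fun _ : ℕ => μ) (X := fun _ y => y) fun _ => measurable_id
  have hindφ : iIndepFun (fun (i : ℕ) (z : ℕ → 𝒳) => φ (z i)) P :=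
    iIndepFun_infinitePi (P := fun _ : ℕ => μ) (X := fun _ => φ) fun _ => hm
  have hφ0 : Integrable (fun z : ℕ → 𝒳 => φ (z 0)) P :=
    (hpres 0).integrable_comp_of_integrable hφ
  have hlaw := strong_law_Lp (μ := P) (p := 1) le_rfl (by simp)
    (fun i z => φ (z i)) (memLp_one_iff_integrable.2 hφ0)
    (fun i j hij => hindφ.indepFun hij)
    (fun i => ⟨(hm.comp (measurable_pi_apply i)).aemeasurable,
      (hm.comp (measurable_pi_apply 0)).aemeasurable, by
        have e : ∀ j, P.map (fun z => φ (z j)) = μ.map φ := fun j => by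
          rw [← (hpres j).map_eq, Measure.map_map hm (measurable_pi_apply j)]
          rfl
        rw [e, e]⟩)
  have hc : ∫ z, φ (z 0) ∂P = c := by
    rw [show c = ∫ y, φ y ∂(P.map fun z => z 0) by rw [(hpres 0).map_eq],
      integral_map (measurable_pi_apply 0).aemeasurable hm.aestronglyMeasurable]
  have hmap : ∀ N : ℕ, P.map (fun z (k : Fin N) => z k) = Measure.pi fun _ => μ := fun N => by
    have h1 : iIndepFun (fun (k : Fin N) (z : ℕ → 𝒳) => z k) P :=
      hind.precomp (g := fun k : Fin N => (k : ℕ)) Fin.val_injective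
    rw [(iIndepFun_iff_map_fun_eq_pi_map (f := fun (k : Fin N) (z : ℕ → 𝒳) => z k)
      fun k => (measurable_pi_apply (k : ℕ)).aemeasurable).1 h1]
    congr 1
    ext1 k
    exact (hpres k).map_eq
  have hlaw' := (ENNReal.tendsto_toReal ENNReal.zero_ne_top).comp hlaw
  refine hlaw'.congr fun N => ?_
  have hmeas : Measurable fun x : Fin N → 𝒳 => ‖empMean φ x - c‖ :=
    ((measurable_empMean hm).sub_const c).norm
  have hrestr : Measurable fun (z : ℕ → 𝒳) (k : Fin N) => z k :=
    measurable_pi_lambda _ fun k => measurable_pi_apply _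
  rw [← hmap N, integral_map hrestr.aemeasurable hmeas.aestronglyMeasurable]
  simp only [Function.comp_apply, hc]
  rw [eLpNorm_one_eq_lintegral_enorm, integral_norm_eq_lintegral_enorm]
  · simp only [empMean, Finset.sum_range]
  · exact (((measurable_empMean hm).sub_const c).comp hrestr).aestronglyMeasurable

end Moments

/-! ### Linearization of smooth functionals of empirical means -/

section Linearization

variable {𝒳 V : Type*} [NormedAddCommGroup V] [NormedSpace ℝ V]

theorem empMean_sub {W : Type*} [NormedAddCommGroup W] [NormedSpace ℝ W] {N : ℕ}
    (φ χ : 𝒳 → W) (x : Fin N → 𝒳) :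
    empMean (fun y => φ y - χ y) x = empMean φ x - empMean χ x := by
  simp [empMean, Finset.sum_sub_distrib, smul_sub]

theorem empMean_add {W : Type*} [NormedAddCommGroup W] [NormedSpace ℝ W] {N : ℕ}
    (φ χ : 𝒳 → W) (x : Fin N → 𝒳) :
    empMean (fun y => φ y + χ y) x = empMean φ x + empMean χ x := by
  simp [empMean, Finset.sum_add_distrib, smul_add]

theorem empMean_const_mul {N : ℕ} (c : ℝ) (φ : 𝒳 → ℝ) (x : Fin N → 𝒳) :
    empMean (fun y => c * φ y) x = c * empMean φ x := by
  simp only [empMean, smul_eq_mul, ← Finset.mul_sum]; ring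

theorem empMean_clm_apply {N : ℕ} (Λ : 𝒳 → V →L[ℝ] ℝ) (x : Fin N → 𝒳) (v : V) :
    (empMean Λ x) v = empMean (fun y => Λ y v) x := by
  simp [empMean]

theorem norm_empMean_le {W : Type*} [NormedAddCommGroup W] [NormedSpace ℝ W] {N : ℕ}
    {φ : 𝒳 → W} {w : 𝒳 → ℝ} (h : ∀ y, ‖φ y‖ ≤ w y) (x : Fin N → 𝒳) :
    ‖empMean φ x‖ ≤ empMean w x := by
  simp only [empMean, norm_smul, norm_inv, Real.norm_natCast, smul_eq_mul]
  gcongr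
  exact (norm_sum_le _ _).trans (Finset.sum_le_sum fun k _ => h _)

/-- Replacing one sample point moves an empirical mean by a quantity of order `N⁻¹`. -/
theorem natCast_smul_empMean_update {W : Type*} [NormedAddCommGroup W] [NormedSpace ℝ W] {N : ℕ}
    (hN : 0 < N) (φ : 𝒳 → W) (x : Fin N → 𝒳) (k : Fin N) (x' : 𝒳) :
    (N : ℝ) • (empMean φ x - empMean φ (Function.update x k x')) = φ (x k) - φ x' := by
  have hN' : (N : ℝ) ≠ 0 := by positivity
  have h1 : ∑ j, φ (x j) - ∑ j, φ (Function.update x k x' j) = φ (x k) - φ x' := by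
    rw [← Finset.sum_sub_distrib, Finset.sum_eq_single k]
    · simp
    · intro j _ hj; simp [hj]
    · simp
  rw [empMean, empMean, ← smul_sub, smul_smul, mul_inv_cancel₀ hN', one_smul, h1]

/-- `G s x` is a family of functions of `x`, parametrized by `s` in a neighbourhood of `s₀`, that
has the derivative `Λ x` in `s` at `s₀`, with a Lipschitz derivative near `s₀`. All constants are
controlled by the weight `2 + κ (ψ x)`, which is an affine function of the statistic `ψ x`, so that
its empirical mean is bounded as long as the empirical mean of `ψ` stays near `s₀`. -/
structure IsLinearizable (ψ : 𝒳 → V) (s₀ : V) (G : V → 𝒳 → ℝ) (Λ : 𝒳 → V →L[ℝ] ℝ)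
    (κ : V →L[ℝ] ℝ) (δ C K : ℝ) : Prop where
  δ_pos : 0 < δ
  C_nonneg : 0 ≤ C
  weight_nonneg : ∀ x, 0 ≤ κ (ψ x)
  expansion : ∀ s t, ‖s - s₀‖ ≤ δ → ‖t - s₀‖ ≤ δ → ∀ x,
    |G s x - G t x - Λ x (s - t)| ≤ C * (‖s - s₀‖ + ‖t - s₀‖) * ‖s - t‖ * (2 + κ (ψ x))
  norm_deriv_le : ∀ x, ‖Λ x‖ ≤ C * (2 + κ (ψ x))
  bound : ∀ s x, |G s x| ≤ K

variable {ψ : 𝒳 → V} {s₀ : V} {G : V → 𝒳 → ℝ} {Λ : 𝒳 → V →L[ℝ] ℝ}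
  {κ : V →L[ℝ] ℝ} {δ C K : ℝ}

namespace IsLinearizable

theorem K_nonneg [Nonempty 𝒳] (h : IsLinearizable ψ s₀ G Λ κ δ C K) : 0 ≤ K :=
  (abs_nonneg _).trans (h.bound s₀ (Classical.arbitrary 𝒳))

theorem empMean_weight {N : ℕ} (hN : 0 < N) (x : Fin N → 𝒳) :
    empMean (fun y => 2 + κ (ψ y)) x = 2 + κ (empMean ψ x) := by
  rw [empMean_add, empMean_const hN, clm_empMean]

theorem empMean_weight_le {N : ℕ} (hN : 0 < N) (x : Fin N → 𝒳)
    (hx : ‖empMean ψ x - s₀‖ ≤ δ) :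
    empMean (fun y => 2 + κ (ψ y)) x ≤ 2 + ‖κ‖ * (‖s₀‖ + δ) := by
  rw [empMean_weight hN]
  have h1 : κ (empMean ψ x) ≤ ‖κ‖ * ‖empMean ψ x‖ :=
    (le_abs_self _).trans (κ.le_opNorm _)
  have h2 : ‖empMean ψ x‖ ≤ ‖s₀‖ + δ := by
    calc ‖empMean ψ x‖ = ‖s₀ + (empMean ψ x - s₀)‖ := by congr 1; abel
      _ ≤ _ := (norm_add_le _ _).trans (by linarith)
  have := mul_le_mul_of_nonneg_left h2 (norm_nonneg κ)
  linarith

/-- The expansion of `G` in the parameter, averaged over the sample. The weights add up to a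
constant because the empirical mean of `ψ` is near `s₀`. -/
theorem empMean_expansion (h : IsLinearizable ψ s₀ G Λ κ δ C K) {N : ℕ} (hN : 0 < N)
    (x : Fin N → 𝒳) (hx : ‖empMean ψ x - s₀‖ ≤ δ) {s t : V} (hs : ‖s - s₀‖ ≤ δ)
    (ht : ‖t - s₀‖ ≤ δ) :
    |empMean (G s) x - empMean (G t) x - empMean Λ x (s - t)|
      ≤ C * (‖s - s₀‖ + ‖t - s₀‖) * ‖s - t‖ * (2 + ‖κ‖ * (‖s₀‖ + δ)) := by
  have h1 := abs_empMean_le (h.expansion s t hs ht) x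
  rw [empMean_sub, empMean_sub, empMean_const_mul, ← empMean_clm_apply] at h1
  refine h1.trans ?_
  have := h.C_nonneg
  gcongr
  exact empMean_weight_le hN x hx

/-- A bounded functional of the sample that agrees with `empMean (G s)`, `s = empMean ψ`, as long
as `s` is near `s₀`, differs from its linearization by a quantity quadratic in deviations of
empirical means. Far from `s₀` this holds since both sides grow at most linearly. -/
theorem abs_sub_empMean_le [Nonempty 𝒳] (h : IsLinearizable ψ s₀ G Λ κ δ C K)
    (Λ₀ : V →L[ℝ] ℝ) :
    ∃ C₁, 0 ≤ C₁ ∧ ∀ (N : ℕ) (_ : 0 < N) (x : Fin N → 𝒳) (T : ℝ), |T| ≤ K →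
      (‖empMean ψ x - s₀‖ ≤ δ → T = empMean (G (empMean ψ x)) x) →
      |T - empMean (fun y => G s₀ y + Λ₀ (ψ y - s₀)) x|
        ≤ C₁ * (‖empMean ψ x - s₀‖ ^ 2 + ‖empMean Λ x - Λ₀‖ ^ 2) := by
  have hδ := h.δ_pos
  have hC := h.C_nonneg
  have hK := h.K_nonneg
  set Wb := 2 + ‖κ‖ * (‖s₀‖ + δ)
  have hWb : 0 ≤ Wb := by positivity
  refine ⟨C * Wb + 1 + 2 * K / δ ^ 2 + ‖Λ₀‖ / δ, by positivity, fun N hN x T hTK hT => ?_⟩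
  set s := empMean ψ x
  have hg : empMean (fun y => G s₀ y + Λ₀ (ψ y - s₀)) x = empMean (G s₀) x + Λ₀ (s - s₀) := by
    rw [empMean_add, ← clm_empMean, empMean_sub_const hN]
  rw [hg]
  set a := ‖s - s₀‖
  set b := ‖empMean Λ x - Λ₀‖
  have ha : 0 ≤ a := norm_nonneg _
  have hb : 0 ≤ b := norm_nonneg _
  by_cases hs : a ≤ δ
  · have h1 := h.empMean_expansion hN x hs hs (t := s₀) (by simpa using hδ.le)
    rw [← hT hs] at h1
    simp only [sub_self, norm_zero, add_zero] at h1
    have h2 : |(empMean Λ x - Λ₀) (s - s₀)| ≤ b * a := (empMean Λ x - Λ₀).le_opNorm _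
    have e : T - (empMean (G s₀) x + Λ₀ (s - s₀))
        = (T - empMean (G s₀) x - empMean Λ x (s - s₀)) + (empMean Λ x - Λ₀) (s - s₀) := by
      simp only [sub_apply]; ring
    rw [e]
    have h3 := abs_add_le (T - empMean (G s₀) x - empMean Λ x (s - s₀))
      ((empMean Λ x - Λ₀) (s - s₀))
    have h4 : b * a ≤ a ^ 2 + b ^ 2 := by nlinarith [sq_nonneg (a - b)]
    have h5 : C * a * a * Wb ≤ C * Wb * (a ^ 2 + b ^ 2) := by
      have : 0 ≤ C * Wb * b ^ 2 := by positivity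
      nlinarith
    have h6 : 0 ≤ (2 * K / δ ^ 2 + ‖Λ₀‖ / δ) * (a ^ 2 + b ^ 2) := by positivity
    calc _ ≤ C * a * a * Wb + b * a := by linarith
      _ ≤ _ := by linarith
  · push Not at hs
    have h1 : |empMean (G s₀) x| ≤ K := by
      have := abs_empMean_le (fun y => h.bound s₀ y) x
      rwa [empMean_const hN] at this
    have h2 : |Λ₀ (s - s₀)| ≤ ‖Λ₀‖ * a := Λ₀.le_opNorm _
    have h3 : 2 * K ≤ 2 * K / δ ^ 2 * a ^ 2 := by
      rw [div_mul_eq_mul_div, le_div_iff₀ (by positivity)]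
      gcongr
    have h4 : ‖Λ₀‖ * a ≤ ‖Λ₀‖ / δ * a ^ 2 := by
      rw [div_mul_eq_mul_div, le_div_iff₀ hδ]
      nlinarith [norm_nonneg Λ₀, mul_nonneg (norm_nonneg Λ₀) ha]
    have h5 : |T - (empMean (G s₀) x + Λ₀ (s - s₀))| ≤ K + (K + ‖Λ₀‖ * a) :=
      (abs_sub _ _).trans (add_le_add hTK ((abs_add_le _ _).trans (add_le_add h1 h2)))
    have h6 : 0 ≤ (2 * K / δ ^ 2 + ‖Λ₀‖ / δ) * b ^ 2 := by positivity
    have h7 : 0 ≤ (C * Wb + 1) * (a ^ 2 + b ^ 2) := by positivity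
    nlinarith

/-- A Lipschitz cutoff equal to `1` for `r ≤ δ / 4` and to `0` for `r ≥ δ / 2`. -/
def cutoff (δ r : ℝ) : ℝ := max 0 (min 1 (2 - 4 * r / δ))

theorem cutoff_nonneg (δ r : ℝ) : 0 ≤ cutoff δ r := le_max_left _ _

theorem cutoff_le_one (δ r : ℝ) : cutoff δ r ≤ 1 := max_le zero_le_one (min_le_left _ _)

theorem abs_cutoff_le_one (δ r : ℝ) : |cutoff δ r| ≤ 1 := by
  rw [abs_of_nonneg (cutoff_nonneg δ r)]; exact cutoff_le_one δ r

theorem cutoff_eq_one {δ r : ℝ} (hδ : 0 < δ) (hr : r ≤ δ / 4) : cutoff δ r = 1 := by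
  have : 4 * r / δ ≤ 1 := by rw [div_le_one hδ]; linarith
  rw [cutoff, min_eq_left (by linarith), max_eq_right zero_le_one]

theorem cutoff_eq_zero {δ r : ℝ} (hδ : 0 < δ) (hr : δ / 2 ≤ r) : cutoff δ r = 0 := by
  have : 2 ≤ 4 * r / δ := by rw [le_div_iff₀ hδ]; linarith
  rw [cutoff, max_eq_left]
  exact (min_le_right _ _).trans (by linarith)

theorem abs_cutoff_sub_le {δ : ℝ} (hδ : 0 < δ) (r r' : ℝ) :
    |cutoff δ r - cutoff δ r'| ≤ 4 / δ * |r - r'| := by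
  have h1 : |cutoff δ r - cutoff δ r'| ≤ |min 1 (2 - 4 * r / δ) - min 1 (2 - 4 * r' / δ)| := by
    have := abs_max_sub_max_le_max 0 (min 1 (2 - 4 * r / δ)) 0 (min 1 (2 - 4 * r' / δ))
    simpa [cutoff] using this
  have h2 := abs_min_sub_min_le_max 1 (2 - 4 * r / δ) 1 (2 - 4 * r' / δ)
  have h3 : |(2 - 4 * r / δ) - (2 - 4 * r' / δ)| = 4 / δ * |r - r'| := by
    rw [show (2 - 4 * r / δ) - (2 - 4 * r' / δ) = -(4 / δ * (r - r')) by ring, abs_neg, abs_mul,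
      abs_of_nonneg (by positivity)]
  rw [h3] at h2
  simp only [sub_self, abs_zero] at h2
  rw [max_eq_right (by positivity)] at h2
  exact h1.trans h2

theorem measurable_cutoff (δ : ℝ) : Measurable (cutoff δ) := by
  unfold cutoff
  fun_prop

/-- The effect on the localized functional `cutoff · T` of replacing one sample point `x k` by
`x'` is, after multiplication with `N`, approximately `g (x k) - g x'`, where
`g = G s₀ + Λ₀ (ψ - s₀)`: the error is small if the empirical means of `ψ` and `Λ` are near `s₀`
and `Λ₀`, and bounded otherwise. -/
theorem exists_abs_replacement_le [Nonempty 𝒳] (h : IsLinearizable ψ s₀ G Λ κ δ C K)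
    (Λ₀ : V →L[ℝ] ℝ) (x' : 𝒳) {R : ℝ} (hR : 0 ≤ R) :
    ∃ C₁ C₂ η₀, 0 ≤ C₁ ∧ 0 ≤ C₂ ∧ 0 < η₀ ∧ ∀ η, 0 < η → η ≤ η₀ → ∃ N₀ : ℕ, ∀ N, N₀ ≤ N →
      ∀ (T : (Fin N → 𝒳) → ℝ), (∀ x, |T x| ≤ K) →
      (∀ x, ‖empMean ψ x - s₀‖ ≤ δ → T x = empMean (G (empMean ψ x)) x) →
      ∀ (x : Fin N → 𝒳) (k : Fin N), ‖ψ (x k)‖ ≤ R →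
      |N * (cutoff δ ‖empMean ψ x - s₀‖ * T x
          - cutoff δ ‖empMean ψ (Function.update x k x') - s₀‖ * T (Function.update x k x'))
        - ((G s₀ (x k) + Λ₀ (ψ (x k) - s₀)) - (G s₀ x' + Λ₀ (ψ x' - s₀)))|
        ≤ C₁ * η + C₂ / η * (‖empMean ψ x - s₀‖ + ‖empMean Λ x - Λ₀‖) := by
  have hδ := h.δ_pos
  have hC := h.C_nonneg
  have hK := h.K_nonneg
  set Wb := 2 + ‖κ‖ * (‖s₀‖ + δ) with hWbdef
  have hWb : 0 ≤ Wb := by positivity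
  set R₁ := R + ‖ψ x'‖ with hR₁def
  have hR₁ : 0 ≤ R₁ := by positivity
  set w₁ := 2 + ‖κ‖ * R₁ with hw₁def
  have hw₁ : 0 ≤ w₁ := by positivity
  -- a bound for the replacement effect, and one for the change of `g`
  set B := 4 / δ * R₁ * K + (2 * K + C * Wb * R₁ + 2 * δ * C * R₁ * Wb)
  set B' := 2 * K + ‖Λ₀‖ * R₁
  have hB : 0 ≤ B := by positivity
  have hB' : 0 ≤ B' := by positivity
  refine ⟨3 * C * R₁ * Wb + R₁ + 2 * (2 * C * w₁ + 2 * δ * C * w₁), B + B', δ / 8,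
    by positivity, by positivity, by positivity, fun η hη hη₀ => ?_⟩
  obtain ⟨N₀, hN₀⟩ := exists_nat_gt (R₁ / η)
  refine ⟨max 1 N₀, fun N hN T hTK hT x k hxk => ?_⟩
  have hNpos : 0 < N := lt_of_lt_of_le one_pos ((le_max_left _ _).trans hN)
  have hNR : (0 : ℝ) < N := by exact_mod_cast hNpos
  have hNη : R₁ ≤ N * η := by
    have h1 : (N₀ : ℝ) ≤ N := by exact_mod_cast (le_max_right _ _).trans hN
    rw [div_lt_iff₀ hη] at hN₀
    nlinarith
  set z := Function.update x k x'
  set s := empMean ψ x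
  set t := empMean ψ z
  have hst : (N : ℝ) • (s - t) = ψ (x k) - ψ x' := natCast_smul_empMean_update hNpos ψ x k x'
  have hψ : ‖ψ (x k) - ψ x'‖ ≤ R₁ := (norm_sub_le _ _).trans (add_le_add hxk le_rfl)
  have hNst : N * ‖s - t‖ ≤ R₁ := by
    rw [← hst, norm_smul, Real.norm_natCast] at hψ; exact hψ
  have hstη : ‖s - t‖ ≤ η := by
    by_contra! hc
    nlinarith
  -- weights at the two points
  have hwk : 2 + κ (ψ (x k)) ≤ w₁ := by
    have h1 : κ (ψ (x k)) ≤ ‖κ‖ * ‖ψ (x k)‖ := (le_abs_self _).trans (κ.le_opNorm _)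
    have h2 : ‖κ‖ * ‖ψ (x k)‖ ≤ ‖κ‖ * R₁ := by
      gcongr; exact hxk.trans (le_add_of_nonneg_right (norm_nonneg _))
    linarith
  have hwx' : 2 + κ (ψ x') ≤ w₁ := by
    have h1 : κ (ψ x') ≤ ‖κ‖ * ‖ψ x'‖ := (le_abs_self _).trans (κ.le_opNorm _)
    have h2 : ‖κ‖ * ‖ψ x'‖ ≤ ‖κ‖ * R₁ := by
      gcongr; exact le_add_of_nonneg_left hR
    linarith
  -- expansion of the replacement effect near `s₀`
  have hE : ‖s - s₀‖ ≤ δ → ‖t - s₀‖ ≤ δ →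
      |N * (T x - T z) - (G t (x k) - G t x') - empMean Λ x (ψ (x k) - ψ x')|
        ≤ C * (‖s - s₀‖ + ‖t - s₀‖) * R₁ * Wb := fun hs ht => by
    have h1 := h.empMean_expansion hNpos x hs hs ht
    have h2 := natCast_smul_empMean_update hNpos (G t) x k x'
    rw [smul_eq_mul] at h2
    rw [hT x hs, hT z ht]
    have e : N * (empMean (G s) x - empMean (G t) z) - (G t (x k) - G t x')
          - empMean Λ x (ψ (x k) - ψ x')
        = N * (empMean (G s) x - empMean (G t) x - empMean Λ x (s - t)) := by
      rw [← h2, ← hst, map_smul, smul_eq_mul]; ring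
    rw [e, abs_mul, abs_of_pos hNR]
    calc N * |empMean (G s) x - empMean (G t) x - empMean Λ x (s - t)|
        ≤ N * (C * (‖s - s₀‖ + ‖t - s₀‖) * ‖s - t‖ * Wb) := by gcongr
      _ = C * (‖s - s₀‖ + ‖t - s₀‖) * (N * ‖s - t‖) * Wb := by ring
      _ ≤ _ := by gcongr
  have hg : (G s₀ (x k) + Λ₀ (ψ (x k) - s₀)) - (G s₀ x' + Λ₀ (ψ x' - s₀))
      = G s₀ (x k) - G s₀ x' + Λ₀ (ψ (x k) - ψ x') := by
    simp only [map_sub]; ring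
  rw [hg]
  have hg_le : |G s₀ (x k) - G s₀ x' + Λ₀ (ψ (x k) - ψ x')| ≤ B' := by
    have h1 : |G s₀ (x k) - G s₀ x'| ≤ K + K :=
      (abs_sub _ _).trans (add_le_add (h.bound _ _) (h.bound _ _))
    have h2 : |Λ₀ (ψ (x k) - ψ x')| ≤ ‖Λ₀‖ * R₁ := (Λ₀.le_opNorm _).trans (by gcongr)
    exact (abs_add_le _ _).trans (by linarith)
  have habs_st : |‖s - s₀‖ - ‖t - s₀‖| ≤ ‖s - t‖ := by
    have := abs_norm_sub_norm_le (s - s₀) (t - s₀)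
    rwa [sub_sub_sub_cancel_right] at this
  by_cases hgood : ‖s - s₀‖ ≤ η ∧ ‖empMean Λ x - Λ₀‖ ≤ η
  · obtain ⟨hs, hΛ⟩ := hgood
    have ht : ‖t - s₀‖ ≤ 2 * η := by
      have := abs_le.1 habs_st
      linarith
    have hsδ : ‖s - s₀‖ ≤ δ := by linarith
    have htδ : ‖t - s₀‖ ≤ δ := by linarith
    rw [cutoff_eq_one hδ (by linarith), cutoff_eq_one hδ (by linarith), one_mul, one_mul]
    have h1 := hE hsδ htδ
    have hGt : ∀ y, 2 + κ (ψ y) ≤ w₁ →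
        |G t y - G s₀ y| ≤ (2 * C * w₁ + 2 * δ * C * w₁) * η := fun y hy => by
      have h2 := h.expansion t s₀ htδ (by simpa using hδ.le) y
      simp only [sub_self, norm_zero, add_zero] at h2
      have h3 : |Λ y (t - s₀)| ≤ C * w₁ * (2 * η) :=
        ((Λ y).le_opNorm _).trans (mul_le_mul ((h.norm_deriv_le y).trans (by gcongr)) ht
          (norm_nonneg _) (by positivity))
      have h4 : C * ‖t - s₀‖ * ‖t - s₀‖ * (2 + κ (ψ y)) ≤ C * δ * (2 * η) * w₁ := by
        have := h.weight_nonneg y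
        gcongr
      have h5 : |G t y - G s₀ y| ≤ |G t y - G s₀ y - Λ y (t - s₀)| + |Λ y (t - s₀)| := by
        have := abs_add_le (G t y - G s₀ y - Λ y (t - s₀)) (Λ y (t - s₀))
        rwa [sub_add_cancel] at this
      linarith
    have h2 := hGt _ hwk
    have h3 := hGt _ hwx'
    have h4 : |(empMean Λ x - Λ₀) (ψ (x k) - ψ x')| ≤ η * R₁ :=
      ((empMean Λ x - Λ₀).le_opNorm _).trans (by gcongr)
    have h5 : C * (‖s - s₀‖ + ‖t - s₀‖) * R₁ * Wb ≤ 3 * C * R₁ * Wb * η := by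
      calc C * (‖s - s₀‖ + ‖t - s₀‖) * R₁ * Wb ≤ C * (η + 2 * η) * R₁ * Wb := by gcongr
        _ = _ := by ring
    have e : N * (T x - T z) - (G s₀ (x k) - G s₀ x' + Λ₀ (ψ (x k) - ψ x'))
        = (N * (T x - T z) - (G t (x k) - G t x') - empMean Λ x (ψ (x k) - ψ x'))
          + ((empMean Λ x - Λ₀) (ψ (x k) - ψ x')
            + ((G t (x k) - G s₀ (x k)) - (G t x' - G s₀ x'))) := by
      simp only [sub_apply]; ring
    rw [e]
    have h6 : 0 ≤ (B + B') / η * (‖s - s₀‖ + ‖empMean Λ x - Λ₀‖) := by positivity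
    have h7 := abs_add_le
      (N * (T x - T z) - (G t (x k) - G t x') - empMean Λ x (ψ (x k) - ψ x'))
      ((empMean Λ x - Λ₀) (ψ (x k) - ψ x') + ((G t (x k) - G s₀ (x k)) - (G t x' - G s₀ x')))
    have h8 := abs_add_le ((empMean Λ x - Λ₀) (ψ (x k) - ψ x'))
      ((G t (x k) - G s₀ (x k)) - (G t x' - G s₀ x'))
    have h9 := abs_sub (G t (x k) - G s₀ (x k)) (G t x' - G s₀ x')
    linarith
  · have hbad : η ≤ ‖s - s₀‖ + ‖empMean Λ x - Λ₀‖ := by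
      by_contra! hc
      exact hgood ⟨by linarith [norm_nonneg (empMean Λ x - Λ₀)], by linarith [norm_nonneg (s - s₀)]⟩
    have hD : |N * (cutoff δ ‖s - s₀‖ * T x - cutoff δ ‖t - s₀‖ * T z)| ≤ B := by
      by_cases hnear : ‖s - s₀‖ ≤ δ ∧ ‖t - s₀‖ ≤ δ
      · obtain ⟨hs, ht⟩ := hnear
        have h1 := hE hs ht
        have h2 : |G t (x k) - G t x'| ≤ K + K :=
          (abs_sub _ _).trans (add_le_add (h.bound _ _) (h.bound _ _))
        have h3 : ‖empMean Λ x‖ ≤ C * Wb := by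
          refine (norm_empMean_le h.norm_deriv_le x).trans ?_
          rw [empMean_const_mul]
          gcongr
          exact empMean_weight_le hNpos x hs
        have h4 : |empMean Λ x (ψ (x k) - ψ x')| ≤ C * Wb * R₁ :=
          ((empMean Λ x).le_opNorm _).trans (by gcongr)
        have h5 : C * (‖s - s₀‖ + ‖t - s₀‖) * R₁ * Wb ≤ 2 * δ * C * R₁ * Wb := by
          calc C * (‖s - s₀‖ + ‖t - s₀‖) * R₁ * Wb ≤ C * (δ + δ) * R₁ * Wb := by gcongr
            _ = _ := by ring
        have h6 : |N * (T x - T z)| ≤ 2 * K + C * Wb * R₁ + 2 * δ * C * R₁ * Wb := by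
          have e : N * (T x - T z)
              = (N * (T x - T z) - (G t (x k) - G t x') - empMean Λ x (ψ (x k) - ψ x'))
                + ((G t (x k) - G t x') + empMean Λ x (ψ (x k) - ψ x')) := by ring
          rw [e]
          refine (abs_add_le _ _).trans ?_
          have := abs_add_le (G t (x k) - G t x') (empMean Λ x (ψ (x k) - ψ x'))
          linarith
        have h7 : |(N : ℝ) * (cutoff δ ‖s - s₀‖ - cutoff δ ‖t - s₀‖)| ≤ 4 / δ * R₁ := by
          rw [abs_mul, abs_of_pos hNR]
          calc N * |cutoff δ ‖s - s₀‖ - cutoff δ ‖t - s₀‖|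
              ≤ N * (4 / δ * ‖s - t‖) := by
                gcongr
                exact (abs_cutoff_sub_le hδ _ _).trans (by gcongr)
            _ = 4 / δ * (N * ‖s - t‖) := by ring
            _ ≤ _ := by gcongr
        have e : N * (cutoff δ ‖s - s₀‖ * T x - cutoff δ ‖t - s₀‖ * T z)
            = N * (cutoff δ ‖s - s₀‖ - cutoff δ ‖t - s₀‖) * T x
              + cutoff δ ‖t - s₀‖ * (N * (T x - T z)) := by ring
        rw [e]
        refine (abs_add_le _ _).trans (add_le_add ?_ ?_)
        · rw [abs_mul]
          exact mul_le_mul h7 (hTK x) (abs_nonneg _) (by positivity)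
        · rw [abs_mul]
          calc _ ≤ 1 * |N * (T x - T z)| := by gcongr; exact abs_cutoff_le_one _ _
            _ ≤ _ := by rw [one_mul]; exact h6
      · -- if one of the two empirical means is far from `s₀`, then the cutoff kills both terms
        have hfar : δ / 2 ≤ ‖s - s₀‖ ∧ δ / 2 ≤ ‖t - s₀‖ := by
          have := abs_le.1 habs_st
          rw [not_and_or] at hnear
          rcases hnear with hc | hc <;> constructor <;> linarith
        rw [cutoff_eq_zero hδ hfar.1, cutoff_eq_zero hδ hfar.2]
        simpa using hB
    have h1 : B + B' ≤ (B + B') / η * (‖s - s₀‖ + ‖empMean Λ x - Λ₀‖) := by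
      rw [div_mul_eq_mul_div, le_div_iff₀ hη]
      gcongr
    have h2 := abs_sub (N * (cutoff δ ‖s - s₀‖ * T x - cutoff δ ‖t - s₀‖ * T z))
      (G s₀ (x k) - G s₀ x' + Λ₀ (ψ (x k) - ψ x'))
    have h3 : 0 ≤ (3 * C * R₁ * Wb + R₁ + 2 * (2 * C * w₁ + 2 * δ * C * w₁)) * η := by positivity
    linarith

end IsLinearizable

end Linearization

/-! ### Variance of smooth functionals of empirical means -/

section VarianceBounds

/-- The perturbation of a variance; the free parameter `t` trades the relative error against the
size of the perturbation. -/
theorem abs_variance_add_sub_le {Ω : Type*} [MeasurableSpace Ω] {P : Measure Ω}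
    [IsProbabilityMeasure P] {X Y : Ω → ℝ} (hX : MemLp X 2 P) (hY : MemLp Y 2 P) {t : ℝ}
    (ht : 0 < t) :
    |Var[X + Y; P] - Var[X; P]| ≤ t * Var[X; P] + (1 + 1 / t) * ∫ z, Y z ^ 2 ∂P := by
  have hYV : Var[Y; P] ≤ ∫ z, Y z ^ 2 ∂P := by
    have := variance_le_expectation_sq (X := Y) (μ := P) hY.aestronglyMeasurable
    simpa using this
  have key : ∀ c : ℝ, 0 ≤ c ^ 2 * Var[X; P] + 2 * c * cov[X, Y; P] + Var[Y; P] := fun c => by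
    have h1 := variance_nonneg (fun z => c * X z + Y z) P
    rw [variance_fun_add (hX.const_mul c) hY, variance_const_mul, covariance_const_mul_left] at h1
    linarith
  rw [variance_add hX hY]
  have h1 := key t
  have h2 := key (-t)
  have hV : Var[Y; P] / t ≤ (∫ z, Y z ^ 2 ∂P) / t := by gcongr
  have h3 : 2 * cov[X, Y; P] ≤ t * Var[X; P] + Var[Y; P] / t := by
    have : t * (2 * cov[X, Y; P]) ≤ t * (t * Var[X; P] + Var[Y; P] / t) := by
      rw [mul_add, mul_div_cancel₀ _ ht.ne']; nlinarith
    exact le_of_mul_le_mul_left this ht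
  have h4 : -(2 * cov[X, Y; P]) ≤ t * Var[X; P] + Var[Y; P] / t := by
    have : t * -(2 * cov[X, Y; P]) ≤ t * (t * Var[X; P] + Var[Y; P] / t) := by
      rw [mul_add, mul_div_cancel₀ _ ht.ne']; nlinarith
    exact le_of_mul_le_mul_left this ht
  have h5 := variance_nonneg Y P
  have h6 : (1 + 1 / t) * ∫ z, Y z ^ 2 ∂P = ∫ z, Y z ^ 2 ∂P + (∫ z, Y z ^ 2 ∂P) / t := by ring
  rw [h6, abs_le]
  constructor <;> linarith

/-- The Cauchy–Schwarz inequality for the covariance. -/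
theorem sq_covariance_le {Ω : Type*} [MeasurableSpace Ω] {P : Measure Ω}
    [IsProbabilityMeasure P] {X Y : Ω → ℝ} (hX : MemLp X 2 P) (hY : MemLp Y 2 P) :
    cov[X, Y; P] ^ 2 ≤ Var[X; P] * Var[Y; P] := by
  have key : ∀ c : ℝ, 0 ≤ Var[X; P] * (c * c) + 2 * cov[X, Y; P] * c + Var[Y; P] := fun c => by
    have h1 := variance_nonneg (fun z => c * X z + Y z) P
    rw [variance_fun_add (hX.const_mul c) hY, variance_const_mul, covariance_const_mul_left] at h1
    linarith
  have := discrim_le_zero key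
  rw [discrim] at this
  linarith

variable {𝒳 : Type*} [MeasurableSpace 𝒳] {μ : Measure 𝒳} [IsProbabilityMeasure μ]

theorem variance_empMean {N : ℕ} {g : 𝒳 → ℝ} (hg : MemLp g 2 μ) :
    Var[fun x : Fin N → 𝒳 => empMean g x; Measure.pi fun _ => μ] = Var[g; μ] / N := by
  have h1 := variance_sum_pi (μ := fun _ : Fin N => μ) (X := fun _ => g) fun _ => hg
  have h2 : (fun x : Fin N → 𝒳 => empMean g x)
      = fun x => (N : ℝ)⁻¹ * (∑ i : Fin N, fun x : Fin N → 𝒳 => g (x i)) x := by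
    ext x; simp [empMean]
  rw [h2, variance_const_mul, h1]
  simp only [Finset.sum_const, Finset.card_univ, Fintype.card_fin, nsmul_eq_mul]
  rcases eq_or_ne (N : ℝ) 0 with h | h
  · simp [h]
  · field_simp

/-- A function of the remaining sample points is uncorrelated with a centred function of the
`k`-th one. -/
theorem integral_update_mul_eq_zero {N : ℕ} {F : (Fin N → 𝒳) → ℝ} (hF : Measurable F)
    {h : 𝒳 → ℝ} (hh : Measurable h) (h0 : ∫ y, h y ∂μ = 0) (k : Fin N) (x' : 𝒳) :
    ∫ x : Fin N → 𝒳, F (Function.update x k x') * h (x k) ∂(Measure.pi fun _ => μ) = 0 := by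
  classical
  have hind : iIndepFun (fun (i : Fin N) (x : Fin N → 𝒳) => x i) (Measure.pi fun _ => μ) :=
    iIndepFun_comp_eval N measurable_id
  have h1 := hind.indepFun_finset (Finset.univ.erase k) {k} (by simp)
    fun i => measurable_pi_apply i
  let Φ : (∀ _ : (Finset.univ.erase k : Finset (Fin N)), 𝒳) → ℝ := fun z =>
    F fun j => if hj : j ∈ Finset.univ.erase k then z ⟨j, hj⟩ else x'
  have hΦ : Measurable Φ := by
    refine hF.comp (measurable_pi_lambda _ fun j => ?_)
    by_cases hj : j ∈ Finset.univ.erase k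
    · simp only [hj, dif_pos]; exact measurable_pi_apply _
    · simp only [hj, dif_neg, not_false_eq_true]; exact measurable_const
  let H : (∀ _ : ({k} : Finset (Fin N)), 𝒳) → ℝ := fun z => h (z ⟨k, by simp⟩)
  have hH : Measurable H := hh.comp (measurable_pi_apply _)
  have h2 := h1.comp hΦ hH
  have e1 : (fun x : Fin N → 𝒳 => F (Function.update x k x'))
      = Φ ∘ fun x i => x i := by
    ext x
    simp only [Function.comp_apply, Φ]
    congr 1
    ext j
    by_cases hj : j = k
    · subst hj; simp
    · simp [hj]
  have e2 : (fun x : Fin N → 𝒳 => h (x k)) = H ∘ fun x i => x i := rfl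
  have hup : Measurable fun x : Fin N → 𝒳 => F (Function.update x k x') :=
    hF.comp (measurable_update_left)
  have h3 : (fun x : Fin N → 𝒳 => F (Function.update x k x')) ⟂ᵢ[Measure.pi fun _ => μ]
      (fun x => h (x k)) := by rw [e1, e2]; exact h2
  rw [h3.integral_fun_mul_eq_mul_integral hup.aestronglyMeasurable
    (hh.comp (measurable_pi_apply k)).aestronglyMeasurable,
    integral_comp_eval k hh.aestronglyMeasurable, h0, mul_zero]

variable {V : Type*} [NormedAddCommGroup V] [NormedSpace ℝ V] [FiniteDimensional ℝ V]
  [MeasurableSpace V] [BorelSpace V]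
  {ψ : 𝒳 → V} {s₀ : V} {G : V → 𝒳 → ℝ} {Λ : 𝒳 → V →L[ℝ] ℝ} {κ : V →L[ℝ] ℝ} {δ C K : ℝ}

/-- Asymptotics of the variance of a smooth functional of empirical means: up to a relative error
`O(N^{-1/2})` it is the variance of the linearization. -/
theorem IsLinearizable.exists_abs_variance_sub_le [Nonempty 𝒳]
    (hl : IsLinearizable ψ s₀ G Λ κ δ C K)
    (hψ : Measurable ψ) (hψ4 : MemLp ψ 4 μ) (hs₀ : ∫ y, ψ y ∂μ = s₀)
    (hΛ : Measurable Λ) (hΛ4 : MemLp Λ 4 μ) (hG : Measurable (G s₀))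
    {T : (N : ℕ) → (Fin N → 𝒳) → ℝ} (hTm : ∀ N, Measurable (T N)) (hTK : ∀ N x, |T N x| ≤ K)
    (hT : ∀ N x, 0 < N → ‖empMean ψ x - s₀‖ ≤ δ → T N x = empMean (G (empMean ψ x)) x) :
    ∃ c, ∀ N : ℕ, 0 < N →
      |N * Var[T N; Measure.pi fun _ => μ]
        - Var[fun y => G s₀ y + (∫ z, Λ z ∂μ) (ψ y - s₀); μ]| ≤ c * (N : ℝ) ^ (-(1 / 2) : ℝ) := by
  set Λ₀ := ∫ z, Λ z ∂μ with hΛ₀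
  set g : 𝒳 → ℝ := fun y => G s₀ y + Λ₀ (ψ y - s₀)
  obtain ⟨C₁, hC₁, hR⟩ := hl.abs_sub_empMean_le Λ₀
  obtain ⟨Cψ, hCψ, hψd⟩ := integral_norm_empMean_sub_pow_four_le hψ hψ4
  obtain ⟨CΛ, hCΛ, hΛd⟩ := integral_norm_empMean_sub_pow_four_le hΛ hΛ4
  rw [hs₀] at hψd
  rw [← hΛ₀] at hΛd
  have hg : MemLp g 2 μ := by
    refine MemLp.add ?_ ?_
    · exact memLp_of_bounded (ae_of_all _ fun y => abs_le.1 (hl.bound s₀ y))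
        hG.aestronglyMeasurable 2
    · exact Λ₀.comp_memLp' ((hψ4.mono_exponent (by norm_num)).sub (memLp_const s₀))
  refine ⟨Var[g; μ] + 2 * (2 * C₁ ^ 2 * (Cψ + CΛ)), fun N hN => ?_⟩
  have hN0 : (0 : ℝ) < N := by positivity
  have hN1 : (1 : ℝ) ≤ N := by exact_mod_cast hN
  set P : Measure (Fin N → 𝒳) := Measure.pi fun _ => μ
  set X : (Fin N → 𝒳) → ℝ := fun x => empMean g x
  set Y : (Fin N → 𝒳) → ℝ := fun x => T N x - empMean g x
  have hX : MemLp X 2 P := memLp_empMean hg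
  have hTL : MemLp (T N) 2 P := memLp_of_bounded (ae_of_all _ fun x => abs_le.1 (hTK N x))
    (hTm N).aestronglyMeasurable 2
  have hY : MemLp Y 2 P := hTL.sub hX
  have i4 : ∀ {W : Type _} [NormedAddCommGroup W] [NormedSpace ℝ W] {φ : 𝒳 → W} (c : W),
      MemLp φ 4 μ → Integrable (fun x : Fin N → 𝒳 => ‖empMean φ x - c‖ ^ 4) P :=
    fun c hφ => by
      have h := ((memLp_empMean (N := N) hφ).sub (memLp_const c)).integrable_norm_pow
        (p := 4) (by norm_num)
      exact h
  have hYle : ∫ x, Y x ^ 2 ∂P ≤ 2 * C₁ ^ 2 * (Cψ + CΛ) / (N : ℝ) ^ 2 := by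
    calc ∫ x, Y x ^ 2 ∂P
        ≤ ∫ x, 2 * C₁ ^ 2 * (‖empMean ψ x - s₀‖ ^ 4 + ‖empMean Λ x - Λ₀‖ ^ 4) ∂P := by
          refine integral_mono_of_nonneg (ae_of_all _ fun x => by positivity)
            (((i4 s₀ hψ4).add (i4 Λ₀ hΛ4)).const_mul _) (ae_of_all _ fun x => ?_)
          have h1 := hR N hN x (T N x) (hTK N x) (hT N x hN)
          have h2 : Y x ^ 2
              ≤ (C₁ * (‖empMean ψ x - s₀‖ ^ 2 + ‖empMean Λ x - Λ₀‖ ^ 2)) ^ 2 := by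
            rw [← sq_abs (Y x)]
            gcongr
          refine h2.trans ?_
          simp only
          nlinarith [mul_nonneg (sq_nonneg C₁)
            (sq_nonneg (‖empMean ψ x - s₀‖ ^ 2 - ‖empMean Λ x - Λ₀‖ ^ 2))]
      _ = 2 * C₁ ^ 2 * (∫ x, ‖empMean ψ x - s₀‖ ^ 4 ∂P + ∫ x, ‖empMean Λ x - Λ₀‖ ^ 4 ∂P) := by
          rw [integral_const_mul, integral_add (i4 s₀ hψ4) (i4 Λ₀ hΛ4)]
      _ ≤ 2 * C₁ ^ 2 * (Cψ / (N : ℝ) ^ 2 + CΛ / (N : ℝ) ^ 2) := by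
          gcongr
          · exact hψd N hN
          · exact hΛd N hN
      _ = _ := by ring
  set t : ℝ := (N : ℝ) ^ (-(1 / 2) : ℝ) with ht
  have ht0 : 0 < t := by positivity
  have ht1 : t ≤ 1 := Real.rpow_le_one_of_one_le_of_nonpos hN1 (by norm_num)
  have htt : t * t = (N : ℝ)⁻¹ := by
    rw [ht, ← Real.rpow_add hN0, ← Real.rpow_neg_one]; norm_num
  have hmain := abs_variance_add_sub_le hX hY ht0
  have eXY : X + Y = T N := by ext x; simp [X, Y]
  rw [eXY, variance_empMean hg] at hmain
  have h1 : |N * Var[T N; P] - Var[g; μ]| = N * |Var[T N; P] - Var[g; μ] / N| := by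
    rw [← abs_of_pos hN0, ← abs_mul, abs_of_pos hN0, mul_sub, mul_div_cancel₀ _ hN0.ne']
  rw [h1]
  have h2 : (1 + 1 / t) ≤ 2 / t := by
    rw [show 2 / t = 1 / t + 1 / t by ring]
    have : 1 ≤ 1 / t := by rw [le_div_iff₀ ht0]; linarith
    linarith
  set D := 2 * C₁ ^ 2 * (Cψ + CΛ)
  have hD : 0 ≤ D := by positivity
  calc N * |Var[T N; P] - Var[g; μ] / N|
      ≤ N * (t * (Var[g; μ] / N) + 2 / t * (D / (N : ℝ) ^ 2)) := by
        gcongr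
        refine hmain.trans ?_
        have : 0 ≤ ∫ x, Y x ^ 2 ∂P := integral_nonneg fun x => by positivity
        gcongr
    _ = t * Var[g; μ] + 2 * D * ((N : ℝ)⁻¹ / t) := by field_simp
    _ = _ := by rw [← htt, mul_div_assoc, div_self ht0.ne']; ring

/-- The covariance of the localized functional with a sum of centred functions `h` of the single
sample points converges to the covariance of `h` with the linearization. -/
theorem IsLinearizable.tendsto_integral_cutoff_mul [Nonempty 𝒳]
    (hl : IsLinearizable ψ s₀ G Λ κ δ C K)
    (hψ : Measurable ψ) (hψ1 : Integrable ψ μ) (hs₀ : ∫ y, ψ y ∂μ = s₀)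
    (hΛ : Measurable Λ) (hΛ1 : Integrable Λ μ) (hG : Measurable (G s₀))
    {T : (N : ℕ) → (Fin N → 𝒳) → ℝ} (hTm : ∀ N, Measurable (T N)) (hTK : ∀ N x, |T N x| ≤ K)
    (hT : ∀ N x, 0 < N → ‖empMean ψ x - s₀‖ ≤ δ → T N x = empMean (G (empMean ψ x)) x)
    {h : 𝒳 → ℝ} (hh : Measurable h) {H R : ℝ} (hH : ∀ y, |h y| ≤ H)
    (hR : ∀ y, h y ≠ 0 → ‖ψ y‖ ≤ R) (h0 : ∫ y, h y ∂μ = 0) :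
    Tendsto (fun N : ℕ => ∫ x : Fin N → 𝒳, cutoff δ ‖empMean ψ x - s₀‖ * T N x * ∑ k, h (x k)
        ∂(Measure.pi fun _ => μ)) atTop
      (𝓝 (∫ y, (G s₀ y + (∫ z, Λ z ∂μ) (ψ y - s₀)) * h y ∂μ)) := by
  have hK := hl.K_nonneg
  have hH0 : 0 ≤ H := (abs_nonneg _).trans (hH (Classical.arbitrary 𝒳))
  set Λ₀ := ∫ z, Λ z ∂μ with hΛ₀
  set g : 𝒳 → ℝ := fun y => G s₀ y + Λ₀ (ψ y - s₀) with hgdef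
  have hgm : Measurable g := hG.add (Λ₀.continuous.measurable.comp (hψ.sub_const s₀))
  have hgi : Integrable g μ := by
    refine Integrable.add ?_ (Λ₀.integrable_comp (hψ1.sub (integrable_const s₀)))
    exact (integrable_const K).mono' hG.aestronglyMeasurable (ae_of_all _ (hl.bound s₀))
  have hhi : Integrable h μ :=
    (integrable_const H).mono' hh.aestronglyMeasurable (ae_of_all _ hH)
  have hghi : Integrable (fun y => g y * h y) μ :=
    hgi.mul_bdd hh.aestronglyMeasurable (ae_of_all _ hH)
  let x' : 𝒳 := Classical.arbitrary 𝒳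
  obtain ⟨C₁, C₂, η₀, hC₁, hC₂, hη₀, hrep⟩ :=
    hl.exists_abs_replacement_le Λ₀ x' (R := max R 0) (le_max_right _ _)
  have hlim := (tendsto_integral_norm_empMean_sub hψ hψ1).add
    (tendsto_integral_norm_empMean_sub hΛ hΛ1)
  rw [hs₀, add_zero] at hlim
  rw [Metric.tendsto_atTop]
  intro ε hε
  -- choose `η` so that the first error term is below `ε / 2`
  obtain ⟨η, hη, hηη₀, hηε⟩ : ∃ η, 0 < η ∧ η ≤ η₀ ∧ H * (C₁ * η) < ε / 2 := by
    refine ⟨min η₀ (ε / 4 / (H * C₁ + 1)), by positivity, min_le_left _ _, ?_⟩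
    have h1 : min η₀ (ε / 4 / (H * C₁ + 1)) ≤ ε / 4 / (H * C₁ + 1) := min_le_right _ _
    have h2 : (H * C₁ + 1) * (ε / 4 / (H * C₁ + 1)) = ε / 4 := by
      field_simp
    have h3 : 0 < min η₀ (ε / 4 / (H * C₁ + 1)) := by positivity
    nlinarith [mul_le_mul_of_nonneg_left h1 (by positivity : 0 ≤ H * C₁)]
  obtain ⟨N₀, hN₀⟩ := hrep η hη hηη₀
  have hlim2 := hlim.const_mul (H * (C₂ / η))
  rw [mul_zero, Metric.tendsto_atTop] at hlim2
  obtain ⟨N₁, hN₁⟩ := hlim2 (ε / 2) (by positivity)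
  refine ⟨max 1 (max N₀ N₁), fun N hN => ?_⟩
  have hNpos : 0 < N := lt_of_lt_of_le one_pos ((le_max_left _ _).trans hN)
  have hNN₀ : N₀ ≤ N := (le_max_left _ _).trans ((le_max_right _ _).trans hN)
  have hNN₁ : N₁ ≤ N := (le_max_right _ _).trans ((le_max_right _ _).trans hN)
  have hNR : (0 : ℝ) < N := by positivity
  set P : Measure (Fin N → 𝒳) := Measure.pi fun _ => μ
  let F : (Fin N → 𝒳) → ℝ := fun x => cutoff δ ‖empMean ψ x - s₀‖ * T N x
  have hFm : Measurable F :=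
    ((measurable_cutoff δ).comp ((measurable_empMean hψ).sub_const s₀).norm).mul (hTm N)
  have hFK : ∀ x, |F x| ≤ K := fun x => by
    simp only [F, abs_mul]
    calc _ ≤ 1 * K := mul_le_mul (abs_cutoff_le_one _ _) (hTK N x) (abs_nonneg _) zero_le_one
      _ = K := one_mul K
  have hFi : Integrable F P :=
    (integrable_const K).mono' hFm.aestronglyMeasurable (ae_of_all _ hFK)
  have hup : ∀ k, Measurable fun x : Fin N → 𝒳 => F (Function.update x k x') := fun k =>
    hFm.comp measurable_update_left
  have hFui : ∀ k, Integrable (fun x : Fin N → 𝒳 => F (Function.update x k x')) P := fun k =>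
    (integrable_const K).mono' (hup k).aestronglyMeasurable (ae_of_all _ fun x => hFK _)
  have hhk : ∀ k : Fin N, AEStronglyMeasurable (fun x : Fin N → 𝒳 => h (x k)) P := fun k =>
    (hh.comp (measurable_pi_apply k)).aestronglyMeasurable
  have hFh : ∀ k : Fin N, Integrable (fun x : Fin N → 𝒳 => F x * h (x k)) P := fun k =>
    hFi.mul_bdd (hhk k) (ae_of_all _ fun x => hH _)
  have hFuh : ∀ k : Fin N,
      Integrable (fun x : Fin N → 𝒳 => F (Function.update x k x') * h (x k)) P := fun k =>
    (hFui k).mul_bdd (hhk k) (ae_of_all _ fun x => hH _)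
  have hgh : ∀ k : Fin N, Integrable (fun x : Fin N → 𝒳 => (g (x k) - g x') * h (x k)) P :=
    fun k => ((integrable_comp_eval k hgi).sub (integrable_const (g x'))).mul_bdd (hhk k)
      (ae_of_all _ fun x => hH _)
  have e1 : ∀ k : Fin N, ∫ x, (g (x k) - g x') * h (x k) ∂P = ∫ y, g y * h y ∂μ := fun k => by
    rw [integral_comp_eval k (φ := fun y => (g y - g x') * h y)
      ((hgm.sub_const _).mul hh).aestronglyMeasurable]
    simp only [sub_mul]
    rw [integral_sub hghi (hhi.const_mul _), integral_const_mul, h0, mul_zero, sub_zero]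
  have e2 : ∀ k : Fin N, ∫ x, F x * h (x k) ∂P
      = ∫ x, (F x - F (Function.update x k x')) * h (x k) ∂P := fun k => by
    simp only [sub_mul]
    rw [integral_sub (hFh k) (hFuh k), integral_update_mul_eq_zero hFm hh h0, sub_zero]
  have e3 : ∀ k : Fin N, ∫ x, F x * h (x k) ∂P - (N : ℝ)⁻¹ * ∫ y, g y * h y ∂μ
      = (N : ℝ)⁻¹ * ∫ x, (N * (F x - F (Function.update x k x')) - (g (x k) - g x')) * h (x k)
        ∂P := fun k => by
    have : ∀ x : Fin N → 𝒳,
        (N * (F x - F (Function.update x k x')) - (g (x k) - g x')) * h (x k)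
          = N * ((F x - F (Function.update x k x')) * h (x k)) - (g (x k) - g x') * h (x k) :=
      fun x => by ring
    simp only [this]
    rw [integral_sub _ (hgh k), integral_const_mul, e1, ← e2, mul_sub, ← mul_assoc,
      inv_mul_cancel₀ hNR.ne', one_mul]
    refine Integrable.const_mul ?_ _
    simp only [sub_mul]
    exact (hFh k).sub (hFuh k)
  have hdev : Integrable
      (fun x : Fin N → 𝒳 => ‖empMean ψ x - s₀‖ + ‖empMean Λ x - Λ₀‖) P := by
    have j : ∀ {W : Type _} [NormedAddCommGroup W] [NormedSpace ℝ W] {φ : 𝒳 → W} (c : W),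
        Integrable φ μ → Integrable (fun x : Fin N → 𝒳 => ‖empMean φ x - c‖) P :=
      fun c hφ => ((memLp_one_iff_integrable.1
        (memLp_empMean (N := N) (memLp_one_iff_integrable.2 hφ))).sub (integrable_const c)).norm
    exact (j s₀ hψ1).add (j Λ₀ hΛ1)
  set d := ∫ x : Fin N → 𝒳, ‖empMean ψ x - s₀‖ + ‖empMean Λ x - Λ₀‖ ∂P with hd
  have hdadd : d = ∫ x : Fin N → 𝒳, ‖empMean ψ x - s₀‖ ∂P
      + ∫ x : Fin N → 𝒳, ‖empMean Λ x - Λ₀‖ ∂P := by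
    have j : ∀ {W : Type _} [NormedAddCommGroup W] [NormedSpace ℝ W] {φ : 𝒳 → W} (c : W),
        Integrable φ μ → Integrable (fun x : Fin N → 𝒳 => ‖empMean φ x - c‖) P :=
      fun c hφ => ((memLp_one_iff_integrable.1
        (memLp_empMean (N := N) (memLp_one_iff_integrable.2 hφ))).sub (integrable_const c)).norm
    rw [hd, integral_add (j s₀ hψ1) (j Λ₀ hΛ1)]
  have hbound : ∀ k : Fin N,
      |∫ x, (N * (F x - F (Function.update x k x')) - (g (x k) - g x')) * h (x k) ∂P|
        ≤ H * (C₁ * η) + H * (C₂ / η) * d := fun k => by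
    rw [← Real.norm_eq_abs]
    calc _ ≤ ∫ x, (H * (C₁ * η)
          + H * (C₂ / η) * (‖empMean ψ x - s₀‖ + ‖empMean Λ x - Λ₀‖)) ∂P := by
          refine norm_integral_le_of_norm_le
            ((integrable_const _).add (hdev.const_mul _)) (ae_of_all _ fun x => ?_)
          rw [Real.norm_eq_abs, abs_mul]
          by_cases hx : h (x k) = 0
          · rw [hx, abs_zero, mul_zero]; positivity
          · have h1 := hN₀ N hNN₀ (T N) (hTK N) (fun x => hT N x hNpos) x k
              ((hR _ hx).trans (le_max_left _ _))
            calc _ ≤ (C₁ * η + C₂ / η * (‖empMean ψ x - s₀‖ + ‖empMean Λ x - Λ₀‖)) * H :=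
                  mul_le_mul h1 (hH _) (abs_nonneg _) (by positivity)
              _ = _ := by ring
      _ = _ := by
          rw [integral_add (integrable_const _) (hdev.const_mul _), integral_const,
            integral_const_mul]
          simp [hd]
  have hd1 := hN₁ N hNN₁
  rw [Real.dist_eq, sub_zero, ← hdadd] at hd1
  have hd2 := (le_abs_self _).trans_lt hd1
  have e4 : ∫ x : Fin N → 𝒳, cutoff δ ‖empMean ψ x - s₀‖ * T N x * ∑ k, h (x k) ∂P
      - ∫ y, g y * h y ∂μ
      = ∑ k : Fin N, (∫ x, F x * h (x k) ∂P - (N : ℝ)⁻¹ * ∫ y, g y * h y ∂μ) := by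
    simp only [Finset.mul_sum]
    rw [integral_finsetSum _ fun k _ => hFh k, Finset.sum_sub_distrib]
    simp only [Finset.sum_const, Finset.card_univ, Fintype.card_fin, nsmul_eq_mul]
    rw [← mul_assoc, mul_inv_cancel₀ hNR.ne', one_mul]
  rw [Real.dist_eq, e4]
  calc _ ≤ ∑ k : Fin N, |∫ x, F x * h (x k) ∂P - (N : ℝ)⁻¹ * ∫ y, g y * h y ∂μ| :=
        Finset.abs_sum_le_sum_abs _ _
    _ ≤ ∑ _k : Fin N, (N : ℝ)⁻¹ * (H * (C₁ * η) + H * (C₂ / η) * d) := by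
        refine Finset.sum_le_sum fun k _ => ?_
        rw [e3, abs_mul, abs_of_pos (inv_pos.2 hNR)]
        gcongr
        exact hbound k
    _ = H * (C₁ * η) + H * (C₂ / η) * d := by
        simp only [Finset.sum_const, Finset.card_univ, Fintype.card_fin, nsmul_eq_mul]
        rw [← mul_assoc, mul_inv_cancel₀ hNR.ne', one_mul]
    _ < ε := by linarith

/-- Asymptotic lower bound for the variance under mere integrability of the statistics. The
functional is tested against the localized sum `cutoff · ∑ₖ h(X(k))`, whose second moment is at
most `N 𝔼[h²]`; the localization makes all quantities bounded. -/
theorem IsLinearizable.sq_integral_mul_le [Nonempty 𝒳]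
    (hl : IsLinearizable ψ s₀ G Λ κ δ C K)
    (hψ : Measurable ψ) (hψ1 : Integrable ψ μ) (hs₀ : ∫ y, ψ y ∂μ = s₀)
    (hΛ : Measurable Λ) (hΛ1 : Integrable Λ μ) (hG : Measurable (G s₀))
    {T : (N : ℕ) → (Fin N → 𝒳) → ℝ} (hTm : ∀ N, Measurable (T N)) (hTK : ∀ N x, |T N x| ≤ K)
    (hT : ∀ N x, 0 < N → ‖empMean ψ x - s₀‖ ≤ δ → T N x = empMean (G (empMean ψ x)) x)
    {h : 𝒳 → ℝ} (hh : Measurable h) {H R : ℝ} (hH : ∀ y, |h y| ≤ H)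
    (hR : ∀ y, h y ≠ 0 → ‖ψ y‖ ≤ R) (h0 : ∫ y, h y ∂μ = 0)
    {B : ℕ → ℝ} {b : ℝ} (hVB : ∀ᶠ N : ℕ in atTop, N * Var[T N; Measure.pi fun _ => μ] ≤ B N)
    (hB : Tendsto B atTop (𝓝 b)) :
    (∫ y, (G s₀ y + (∫ z, Λ z ∂μ) (ψ y - s₀)) * h y ∂μ) ^ 2 ≤ b * ∫ y, h y ^ 2 ∂μ := by
  have hK := hl.K_nonneg
  have hlim1 := hl.tendsto_integral_cutoff_mul hψ hψ1 hs₀ hΛ hΛ1 hG hTm hTK hT hh hH hR h0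
  -- the constant functional `1`
  have hl1 : IsLinearizable ψ s₀ (fun _ _ => 1) (fun _ => 0) κ δ 0 1 :=
    ⟨hl.δ_pos, le_rfl, hl.weight_nonneg, by simp, by simp, by simp⟩
  have hlim2 := hl1.tendsto_integral_cutoff_mul (T := fun _ _ => 1) hψ hψ1 hs₀ measurable_const
    (integrable_const 0) measurable_const (fun _ => measurable_const) (by simp)
    (fun N x hN _ => (empMean_const hN 1 x).symm) hh hH hR h0
  simp only [integral_zero, zero_apply, add_zero, one_mul, h0, mul_one] at hlim2
  have hh2 : MemLp h 2 μ := memLp_of_bounded (ae_of_all _ fun y => abs_le.1 (hH y))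
    hh.aestronglyMeasurable 2
  set Q := ∫ y, h y ^ 2 ∂μ
  set I : ℕ → ℝ := fun N => ∫ x : Fin N → 𝒳, cutoff δ ‖empMean ψ x - s₀‖ * T N x * ∑ k, h (x k)
        ∂(Measure.pi fun _ => μ)
  set J : ℕ → ℝ := fun N => ∫ x : Fin N → 𝒳, cutoff δ ‖empMean ψ x - s₀‖ * ∑ k, h (x k)
        ∂(Measure.pi fun _ => μ)
  set E : ℕ → ℝ := fun N => ∫ x : Fin N → 𝒳, T N x ∂(Measure.pi fun _ => μ)
  have hE : ∀ N, |E N| ≤ K := fun N => by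
    have := norm_integral_le_of_norm_le_const (μ := Measure.pi fun _ : Fin N => μ)
      (f := T N) (C := K) (ae_of_all _ fun x => hTK N x)
    simpa using this
  have hEJ : Tendsto (fun N => E N * J N) atTop (𝓝 0) := by
    rw [tendsto_zero_iff_abs_tendsto_zero]
    refine squeeze_zero (fun _ => abs_nonneg _) (fun N => ?_)
      (g := fun N => K * |J N|) (by simpa using (hlim2.abs).const_mul K)
    simp only [Function.comp_apply, abs_mul]
    gcongr
    exact hE N
  have hlim := (hlim1.sub hEJ).pow 2
  rw [sub_zero] at hlim
  refine le_of_tendsto_of_tendsto hlim (hB.mul_const Q) ?_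
  filter_upwards [hVB, eventually_gt_atTop 0] with N hN hNpos
  set P : Measure (Fin N → 𝒳) := Measure.pi fun _ => μ
  have hTL : MemLp (T N) 2 P := memLp_of_bounded (ae_of_all _ fun x => abs_le.1 (hTK N x))
    (hTm N).aestronglyMeasurable 2
  let S : (Fin N → 𝒳) → ℝ := fun x => ∑ k, h (x k)
  have hSL : MemLp S 2 P := memLp_finsetSum Finset.univ
    (f := fun (k : Fin N) (x : Fin N → 𝒳) => h (x k)) fun k _ => memLp_comp_eval k hh2
  have hcm : Measurable fun x : Fin N → 𝒳 => cutoff δ ‖empMean ψ x - s₀‖ :=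
    (measurable_cutoff δ).comp ((measurable_empMean hψ).sub_const s₀).norm
  have hYle : ∀ x : Fin N → 𝒳, ‖cutoff δ ‖empMean ψ x - s₀‖ * S x‖ ≤ ‖S x‖ := fun x => by
    rw [norm_mul]
    exact mul_le_of_le_one_left (norm_nonneg _) (abs_cutoff_le_one _ _)
  have hYL : MemLp (fun x : Fin N → 𝒳 => cutoff δ ‖empMean ψ x - s₀‖ * S x) 2 P :=
    hSL.mono (hcm.aestronglyMeasurable.mul hSL.1) (ae_of_all _ hYle)
  have hcs := sq_covariance_le hTL hYL
  rw [covariance_eq_sub hTL hYL] at hcs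
  have e1 : ∫ x, (T N * fun x : Fin N → 𝒳 => cutoff δ ‖empMean ψ x - s₀‖ * S x) x ∂P = I N := by
    refine integral_congr_ae (ae_of_all _ fun x => ?_)
    simp only [Pi.mul_apply, S]; ring
  rw [e1] at hcs
  have hvar : Var[fun x : Fin N → 𝒳 => cutoff δ ‖empMean ψ x - s₀‖ * S x; P] ≤ N * Q := by
    calc _ ≤ ∫ x, (cutoff δ ‖empMean ψ x - s₀‖ * S x) ^ 2 ∂P :=
          variance_le_expectation_sq hYL.1
      _ ≤ ∫ x, S x ^ 2 ∂P := by
          refine integral_mono hYL.integrable_sq hSL.integrable_sq fun x => ?_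
          exact sq_le_sq.2 (hYle x)
      _ = Var[S; P] := by
          rw [variance_of_integral_eq_zero hSL.1.aemeasurable]
          rw [integral_finsetSum _ fun k _ =>
            (memLp_comp_eval k hh2).integrable (by norm_num)]
          simp [integral_comp_eval _ hh.aestronglyMeasurable, h0]
      _ = N * Q := by
          have h1 := variance_sum_pi (μ := fun _ : Fin N => μ) (X := fun _ => h) fun _ => hh2
          have h2 : S = ∑ i : Fin N, fun x : Fin N → 𝒳 => h (x i) := by ext x; simp [S]
          rw [h2, h1, variance_of_integral_eq_zero hh.aemeasurable h0]
          simp [Q]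
  calc (I N - E N * J N) ^ 2 ≤ Var[T N; P] * (N * Q) :=
        hcs.trans (mul_le_mul_of_nonneg_left hvar (variance_nonneg _ _))
    _ = (N * Var[T N; P]) * Q := by ring
    _ ≤ B N * Q := by
        have : 0 ≤ Q := integral_nonneg fun y => by positivity
        gcongr

end VarianceBounds

/-! ### Composition with a parametrized affine transformation -/

section AffineFamily

/-- The two-point Taylor expansion of a function that is twice continuously differentiable at a
point. -/
theorem exists_two_point_expansion {V W : Type*} [NormedAddCommGroup V] [NormedSpace ℝ V]
    [NormedAddCommGroup W] [NormedSpace ℝ W] {Θ : V → W} {s₀ : V} (hΘ : ContDiffAt ℝ 2 Θ s₀) :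
    ∃ δ C, 0 < δ ∧ 0 ≤ C ∧ ∀ s t, ‖s - s₀‖ ≤ δ → ‖t - s₀‖ ≤ δ →
      ‖Θ s - Θ t - fderiv ℝ Θ s₀ (s - t)‖ ≤ C * (‖s - s₀‖ + ‖t - s₀‖) * ‖s - t‖ := by
  have h1 : ContDiffAt ℝ 1 (fderiv ℝ Θ) s₀ := hΘ.fderiv_right (by norm_num)
  obtain ⟨K, u, hu, hK⟩ := h1.exists_lipschitzOnWith
  have h2 : ∀ᶠ s in 𝓝 s₀, DifferentiableAt ℝ Θ s :=
    (hΘ.eventually (by simp)).mono fun s hs => hs.differentiableAt (by norm_num)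
  obtain ⟨δ, hδ, hball⟩ := Metric.nhds_basis_closedBall.mem_iff.1 (Filter.inter_mem hu h2)
  refine ⟨δ, K, hδ, K.2, fun s t hs ht => ?_⟩
  set ρ := max ‖s - s₀‖ ‖t - s₀‖
  have hρδ : Metric.closedBall s₀ ρ ⊆ Metric.closedBall s₀ δ :=
    Metric.closedBall_subset_closedBall (max_le hs ht)
  have h3 := (convex_closedBall s₀ ρ).norm_image_sub_le_of_norm_hasFDerivWithin_le'
    (f := Θ) (f' := fderiv ℝ Θ) (φ := fderiv ℝ Θ s₀) (C := K * ρ) (x := t) (y := s)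
    (fun x hx => (hball (hρδ hx)).2.hasFDerivAt.hasFDerivWithinAt)
    (fun x hx => by
      have := hK.dist_le_mul x (hball (hρδ hx)).1 s₀ (mem_of_mem_nhds hu)
      rw [dist_eq_norm, dist_eq_norm] at this
      refine this.trans ?_
      gcongr
      simpa [dist_eq_norm] using hx)
    (by simp [ρ, dist_eq_norm]) (by simp [ρ, dist_eq_norm])
  refine h3.trans ?_
  gcongr
  exact max_le_add_of_nonneg (norm_nonneg _) (norm_nonneg _)

variable {E V : Type*} [NormedAddCommGroup E] [NormedSpace ℝ E]
  [NormedAddCommGroup V] [NormedSpace ℝ V]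

theorem norm_clm_apply_add_le (Θ : (E →L[ℝ] E) × E) (y : E) :
    ‖Θ.1 y + Θ.2‖ ≤ ‖Θ‖ * (1 + ‖y‖) := by
  calc ‖Θ.1 y + Θ.2‖ ≤ ‖Θ.1‖ * ‖y‖ + ‖Θ.2‖ :=
        (norm_add_le _ _).trans (by gcongr; exact Θ.1.le_opNorm y)
    _ ≤ ‖Θ‖ * ‖y‖ + ‖Θ‖ := by
        gcongr
        · exact norm_fst_le Θ
        · exact norm_snd_le Θ
    _ = _ := by ring

/-- The derivative in the parameter `s` of `f (m + A y + c)`, `y = x - m`, at a parameter with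
`A = id` and `c = 0`, when `(A, c)` has the derivative `Θ'`. -/
def affineDeriv (f : E → ℝ) (m : E) (Θ' : V →L[ℝ] (E →L[ℝ] E) × E) (x : E) : V →L[ℝ] ℝ :=
  (fderiv ℝ f x).comp
    (((ContinuousLinearMap.apply ℝ E (x - m)).comp (ContinuousLinearMap.fst ℝ _ _)
      + ContinuousLinearMap.snd ℝ _ _).comp Θ')

theorem affineDeriv_apply (f : E → ℝ) (m : E) (Θ' : V →L[ℝ] (E →L[ℝ] E) × E) (x : E) (v : V) :
    affineDeriv f m Θ' x v = fderiv ℝ f x ((Θ' v).1 (x - m) + (Θ' v).2) := by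
  simp [affineDeriv]

/-- Composing `f` with an affine transformation that depends smoothly on `s` and is the identity at
`s₀` gives a linearizable family. The second order remainder grows like `(1 + ‖x - m‖)²`, which the
weight has to dominate. -/
theorem exists_isLinearizable_of_contDiffAt {f : E → ℝ} {K L : ℝ} (hf : Differentiable ℝ f)
    (hfK : ∀ x, |f x| ≤ K) (hfL : ∀ x, ‖fderiv ℝ f x‖ ≤ L) (hL : 0 ≤ L)
    (hfLip : ∀ x x', ‖fderiv ℝ f x - fderiv ℝ f x'‖ ≤ L * ‖x - x'‖)
    {Θ : V → (E →L[ℝ] E) × E} {s₀ : V} (hΘ : ContDiffAt ℝ 2 Θ s₀)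
    (h0 : Θ s₀ = (ContinuousLinearMap.id ℝ E, 0)) (m : E) {ψ : E → V} {κ : V →L[ℝ] ℝ}
    (hκ0 : ∀ x, 0 ≤ κ (ψ x)) (hκ : ∀ x, (1 + ‖x - m‖) ^ 2 ≤ 2 + κ (ψ x)) :
    ∃ δ₀ C, 0 < δ₀ ∧ ∀ δ, 0 < δ → δ ≤ δ₀ →
      IsLinearizable ψ s₀ (fun s x => f (m + (Θ s).1 (x - m) + (Θ s).2))
        (affineDeriv f m (fderiv ℝ Θ s₀)) κ δ C K := by
  obtain ⟨δ₀, C, hδ₀, hC, hexp⟩ := exists_two_point_expansion hΘ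
  set Θ' := fderiv ℝ Θ s₀
  set C₁ := C * (δ₀ + δ₀) + ‖Θ'‖
  have hC₁ : 0 ≤ C₁ := by positivity
  have hLip : ∀ s t, ‖s - s₀‖ ≤ δ₀ → ‖t - s₀‖ ≤ δ₀ → ‖Θ s - Θ t‖ ≤ C₁ * ‖s - t‖ :=
    fun s t hs ht => by
    calc ‖Θ s - Θ t‖ = ‖(Θ s - Θ t - Θ' (s - t)) + Θ' (s - t)‖ := by congr 1; abel
      _ ≤ C * (‖s - s₀‖ + ‖t - s₀‖) * ‖s - t‖ + ‖Θ'‖ * ‖s - t‖ :=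
        (norm_add_le _ _).trans (add_le_add (hexp s t hs ht) (Θ'.le_opNorm _))
      _ ≤ C * (δ₀ + δ₀) * ‖s - t‖ + ‖Θ'‖ * ‖s - t‖ := by gcongr
      _ = _ := by ring
  have hle : ∀ x, 1 + ‖x - m‖ ≤ 2 + κ (ψ x) := fun x =>
    le_trans (by nlinarith [norm_nonneg (x - m)]) (hκ x)
  refine ⟨δ₀, L * (C + C₁ * C₁) + L * ‖Θ'‖, hδ₀, fun δ hδ hδδ₀ =>
    ⟨hδ, by positivity, hκ0, fun s t hs ht x => ?_, fun x => ?_, fun s x => hfK _⟩⟩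
  · replace hs := hs.trans hδδ₀
    replace ht := ht.trans hδδ₀
    have hs₀' : ‖s₀ - s₀‖ ≤ δ₀ := by simpa using hδ₀.le
    set y := x - m with hy
    set u := m + (Θ s).1 y + (Θ s).2
    set v := m + (Θ t).1 y + (Θ t).2
    have huv : u - v = (Θ s - Θ t).1 y + (Θ s - Θ t).2 := by
      simp only [u, v, Prod.fst_sub, Prod.snd_sub, sub_apply]; abel
    have hnear : ∀ r, ‖r - s₀‖ ≤ δ₀ →
        ‖(m + (Θ r).1 y + (Θ r).2) - x‖ ≤ C₁ * ‖r - s₀‖ * (1 + ‖y‖) := fun r hr => by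
      have e : (m + (Θ r).1 y + (Θ r).2) - x = (Θ r - Θ s₀).1 y + (Θ r - Θ s₀).2 := by
        simp only [h0, Prod.fst_sub, Prod.snd_sub, sub_apply, ContinuousLinearMap.id_apply, hy]
        abel
      rw [e]
      exact (norm_clm_apply_add_le _ _).trans (by gcongr; exact hLip r s₀ hr hs₀')
    have huv_le : ‖u - v‖ ≤ C₁ * ‖s - t‖ * (1 + ‖y‖) := by
      rw [huv]
      exact (norm_clm_apply_add_le _ _).trans (by gcongr; exact hLip s t hs ht)
    set ρ := C₁ * (‖s - s₀‖ + ‖t - s₀‖) * (1 + ‖y‖)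
    have hu : ‖u - x‖ ≤ ρ := (hnear s hs).trans (by
      simp only [ρ]; gcongr; exact le_add_of_nonneg_right (norm_nonneg _))
    have hv : ‖v - x‖ ≤ ρ := (hnear t ht).trans (by
      simp only [ρ]; gcongr; exact le_add_of_nonneg_left (norm_nonneg _))
    have h1 : ‖f u - f v - fderiv ℝ f x (u - v)‖ ≤ L * ρ * ‖u - v‖ :=
      (convex_closedBall x ρ).norm_image_sub_le_of_norm_hasFDerivWithin_le'
        (f' := fderiv ℝ f) (fun z _ => (hf z).hasFDerivAt.hasFDerivWithinAt)
        (fun z hz => (hfLip z x).trans (by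
          gcongr; simpa [dist_eq_norm] using hz))
        (by simpa [dist_eq_norm] using hv) (by simpa [dist_eq_norm] using hu)
    have h2 : |fderiv ℝ f x (u - v) - affineDeriv f m Θ' x (s - t)|
        ≤ L * (C * (‖s - s₀‖ + ‖t - s₀‖) * ‖s - t‖ * (1 + ‖y‖)) := by
      rw [affineDeriv_apply, ← map_sub, huv]
      have e : (Θ s - Θ t).1 y + (Θ s - Θ t).2 - ((Θ' (s - t)).1 y + (Θ' (s - t)).2)
          = (Θ s - Θ t - Θ' (s - t)).1 y + (Θ s - Θ t - Θ' (s - t)).2 := by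
        simp only [Prod.fst_sub, Prod.snd_sub, sub_apply]; abel
      rw [e]
      refine ((fderiv ℝ f x).le_opNorm _).trans ?_
      refine mul_le_mul (hfL x) ((norm_clm_apply_add_le _ _).trans ?_) (norm_nonneg _) hL
      gcongr
      exact hexp s t hs ht
    set d := ‖s - s₀‖ + ‖t - s₀‖
    set e := ‖s - t‖
    have hw1 := hle x
    have hw2 := hκ x
    rw [← hy] at hw1 hw2
    set w := 2 + κ (ψ x)
    have h3 : L * ρ * ‖u - v‖ ≤ L * (C₁ * C₁) * (d * e) * w := by
      calc L * ρ * ‖u - v‖ ≤ L * ρ * (C₁ * e * (1 + ‖y‖)) := by gcongr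
        _ = L * (C₁ * C₁) * (d * e) * (1 + ‖y‖) ^ 2 := by simp only [ρ]; ring
        _ ≤ _ := by gcongr
    have h4 : L * (C * d * e * (1 + ‖y‖)) ≤ L * C * (d * e) * w := by
      calc L * (C * d * e * (1 + ‖y‖)) = L * C * (d * e) * (1 + ‖y‖) := by ring
        _ ≤ _ := by gcongr
    have h5 : |f u - f v - affineDeriv f m Θ' x (s - t)|
        ≤ |f u - f v - fderiv ℝ f x (u - v)|
          + |fderiv ℝ f x (u - v) - affineDeriv f m Θ' x (s - t)| := abs_sub_le _ _ _
    rw [Real.norm_eq_abs] at h1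
    have h6 : 0 ≤ L * ‖Θ'‖ * (d * e) * w := by
      have : 0 ≤ w := by have := hκ0 x; positivity
      positivity
    calc _ ≤ L * (C₁ * C₁) * (d * e) * w + L * C * (d * e) * w := by linarith
      _ ≤ _ := by linarith
  · have h1 : ‖affineDeriv f m Θ' x‖ ≤ L * (‖Θ'‖ * (1 + ‖x - m‖)) := by
      refine ContinuousLinearMap.opNorm_le_bound _ (by positivity) fun v => ?_
      rw [affineDeriv_apply]
      refine ((fderiv ℝ f x).le_opNorm _).trans ?_
      calc ‖fderiv ℝ f x‖ * ‖(Θ' v).1 (x - m) + (Θ' v).2‖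
          ≤ L * (‖Θ' v‖ * (1 + ‖x - m‖)) :=
            mul_le_mul (hfL x) (norm_clm_apply_add_le _ _) (norm_nonneg _) hL
        _ ≤ L * (‖Θ'‖ * ‖v‖ * (1 + ‖x - m‖)) := by gcongr; exact Θ'.le_opNorm v
        _ = _ := by ring
    have h2 := hle x
    have h3 := hκ0 x
    calc _ ≤ L * (‖Θ'‖ * (2 + κ (ψ x))) := h1.trans (by gcongr)
      _ ≤ _ := by
        have : 0 ≤ L * (C + C₁ * C₁) * (2 + κ (ψ x)) := by positivity
        linarith

theorem exists_norm_fderiv_le_of_hasCompactSupport {F : Type*} [NormedAddCommGroup F]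
    [NormedSpace ℝ F] {g : E → F} (hg : ContDiff ℝ ∞ g) (hc : HasCompactSupport g) :
    ∃ L, ∀ x, ‖fderiv ℝ g x‖ ≤ L :=
  (hc.fderiv ℝ).exists_bound_of_continuous (hg.continuous_fderiv (by simp))

theorem norm_sub_le_of_norm_fderiv_le {F : Type*} [NormedAddCommGroup F] [NormedSpace ℝ F]
    {g : E → F} {L : ℝ} (hg : Differentiable ℝ g) (hL : ∀ x, ‖fderiv ℝ g x‖ ≤ L) (x x' : E) :
    ‖g x - g x'‖ ≤ L * ‖x - x'‖ :=
  convex_univ.norm_image_sub_le_of_norm_fderiv_le (𝕜 := ℝ) (fun z _ => hg z)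
    (fun z _ => hL z) (Set.mem_univ x') (Set.mem_univ x)

/-- A smooth function with compact support is bounded, with bounded and Lipschitz derivative. -/
theorem exists_bounds_of_hasCompactSupport {f : E → ℝ} (hf : ContDiff ℝ ∞ f)
    (hc : HasCompactSupport f) :
    ∃ K L, 0 ≤ L ∧ (∀ x, |f x| ≤ K) ∧ (∀ x, ‖fderiv ℝ f x‖ ≤ L) ∧
      ∀ x x', ‖fderiv ℝ f x - fderiv ℝ f x'‖ ≤ L * ‖x - x'‖ := by
  have h1 : ContDiff ℝ ∞ (fderiv ℝ f) := (contDiff_infty_iff_fderiv.1 hf).2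
  obtain ⟨K, hK⟩ := hc.exists_bound_of_continuous hf.continuous
  obtain ⟨L₁, hL₁⟩ := exists_norm_fderiv_le_of_hasCompactSupport hf hc
  obtain ⟨L₂, hL₂⟩ := exists_norm_fderiv_le_of_hasCompactSupport h1 (hc.fderiv ℝ)
  have hL0 : 0 ≤ L₁ := (norm_nonneg _).trans (hL₁ 0)
  exact ⟨K, max L₁ L₂, hL0.trans (le_max_left _ _), hK,
    fun x => (hL₁ x).trans (le_max_left _ _), norm_sub_le_of_norm_fderiv_le
      (h1.differentiable (by simp)) fun z => (hL₂ z).trans (le_max_right _ _)⟩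

end AffineFamily

/-! ### The square root of the sample covariance matrix -/

section MatrixSqrt

open scoped Matrix.Norms.L2Operator

variable {n : ℕ}

/-- The derivative of `Q ↦ Q * Q` at a positive definite matrix is injective. -/
theorem sylvester_injective {P H : Matrix (Fin n) (Fin n) ℝ} (hP : P.PosDef)
    (h : P * H + H * P = 0) : H = 0 := by
  obtain ⟨D, rfl⟩ := CStarAlgebra.nonneg_iff_eq_star_mul_self.mp hP.posSemidef.nonneg
  have hD : IsUnit D := by
    have := hP.isUnit
    exact isUnit_of_mul_isUnit_right this
  simp only [Matrix.star_eq_conjTranspose] at h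
  have h1 : ((D * H)ᴴ * (D * H)).trace + ((D * Hᴴ)ᴴ * (D * Hᴴ)).trace = 0 := by
    have h2 : (Hᴴ * (Dᴴ * D * H + H * (Dᴴ * D))).trace = 0 := by rw [h]; simp
    rw [mul_add, Matrix.trace_add] at h2
    rw [← h2]
    congr 1
    · simp only [Matrix.conjTranspose_mul, Matrix.mul_assoc]
    · rw [Matrix.conjTranspose_mul, Matrix.conjTranspose_conjTranspose]
      rw [Matrix.trace_mul_comm, Matrix.mul_assoc, Matrix.trace_mul_comm]
      rw [Matrix.trace_mul_comm Hᴴ]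
      simp only [Matrix.mul_assoc]
      rw [Matrix.trace_mul_comm]
      simp only [Matrix.mul_assoc]
  have h3 := (Matrix.posSemidef_conjTranspose_mul_self (D * H)).trace_nonneg
  have h4 := (Matrix.posSemidef_conjTranspose_mul_self (D * Hᴴ)).trace_nonneg
  have h5 : ((D * H)ᴴ * (D * H)).trace = 0 := by linarith
  rw [Matrix.trace_conjTranspose_mul_self_eq_zero_iff] at h5
  exact hD.mul_right_eq_zero.1 h5

/-- Near the square of a positive definite matrix `P` there is a smooth square root, the local
inverse of `Q ↦ Q * Q`. -/
theorem exists_local_sqrt {P : Matrix (Fin n) (Fin n) ℝ} (hP : P.PosDef) :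
    ∃ R : Matrix (Fin n) (Fin n) ℝ → Matrix (Fin n) (Fin n) ℝ,
      ContDiffAt ℝ 2 R (P * P) ∧ R (P * P) = P ∧ (∀ᶠ Q in 𝓝 P, R (Q * Q) = Q) ∧
        ∀ᶠ S in 𝓝 (P * P), R S * R S = S := by
  let D : Matrix (Fin n) (Fin n) ℝ →ₗ[ℝ] Matrix (Fin n) (Fin n) ℝ :=
    LinearMap.mulLeft ℝ P + LinearMap.mulRight ℝ P
  have hD : Function.Injective D := by
    rw [← LinearMap.ker_eq_bot, LinearMap.ker_eq_bot']
    intro H hH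
    exact sylvester_injective hP (by simpa [D] using hH)
  let D' : Matrix (Fin n) (Fin n) ℝ ≃L[ℝ] Matrix (Fin n) (Fin n) ℝ :=
    (LinearEquiv.ofInjectiveEndo D hD).toContinuousLinearEquiv
  have hsq : ContDiffAt ℝ 2 (fun Q : Matrix (Fin n) (Fin n) ℝ => Q * Q) P := by fun_prop
  have hderiv : HasFDerivAt (fun Q : Matrix (Fin n) (Fin n) ℝ => Q * Q)
      (D' : Matrix (Fin n) (Fin n) ℝ →L[ℝ] Matrix (Fin n) (Fin n) ℝ) P := by
    refine ((hasFDerivAt_id (𝕜 := ℝ) P).mul' (hasFDerivAt_id P)).congr_fderiv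
      (ContinuousLinearMap.ext fun H => ?_)
    simp [D', D]
  have hstrict := hsq.hasStrictFDerivAt' hderiv (by norm_num)
  exact ⟨hsq.localInverse hderiv (by norm_num), hsq.to_localInverse hderiv (by norm_num),
    hsq.localInverse_apply_image hderiv (by norm_num), hstrict.eventually_left_inverse,
    hstrict.eventually_right_inverse⟩

theorem posDef_sqrt {S : Matrix (Fin n) (Fin n) ℝ} (hS : S.PosDef) : (CFC.sqrt S).PosDef := by
  rw [(Matrix.nonneg_iff_posSemidef.1 (CFC.sqrt_nonneg S)).posDef_iff_isUnit]
  have h := hS.isUnit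
  rw [← CFC.sqrt_mul_sqrt_self S hS.posSemidef.nonneg] at h
  exact isUnit_of_mul_isUnit_left h

/-- The positive semidefinite square root coincides near a positive definite matrix `S` with a
local smooth square root. -/
theorem eventually_local_sqrt_eq {S : Matrix (Fin n) (Fin n) ℝ} (hS : S.PosDef)
    {R : Matrix (Fin n) (Fin n) ℝ → Matrix (Fin n) (Fin n) ℝ}
    (hR : ∀ᶠ Q in 𝓝 (CFC.sqrt S), R (Q * Q) = Q) :
    ∀ᶠ S' in 𝓝 S, S'.PosSemidef → CFC.sqrt S' = R S' := by
  have hc : ContinuousOn CFC.sqrt {a : Matrix (Fin n) (Fin n) ℝ | 0 ≤ a} := CFC.continuousOn_sqrt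
  have h1 := (hc S hS.posSemidef.nonneg).eventually hR
  rw [eventually_nhdsWithin_iff] at h1
  filter_upwards [h1] with S' hS' hpos
  have h2 := hS' hpos.nonneg
  rw [CFC.sqrt_mul_sqrt_self S' hpos.nonneg] at h2
  exact h2.symm

end MatrixSqrt

/-! ### The matched estimator as a functional of empirical means -/

section Statistic

open scoped Matrix.Norms.L2Operator

variable {n N : ℕ}

/-- The centred first and second order statistics `(x - m, (x - m)(x - m)ᵀ)`. -/
def stat (m x : EuclideanSpace ℝ (Fin n)) :
    EuclideanSpace ℝ (Fin n) × Matrix (Fin n) (Fin n) ℝ :=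
  (x - m, Matrix.vecMulVec (x - m).ofLp (x - m).ofLp)

/-- The covariance matrix in terms of the first and second order statistics. -/
def statCov (s : EuclideanSpace ℝ (Fin n) × Matrix (Fin n) (Fin n) ℝ) :
    Matrix (Fin n) (Fin n) ℝ :=
  s.2 - Matrix.vecMulVec s.1.ofLp s.1.ofLp

theorem sampleMean_sub (hN : 0 < N) (m : EuclideanSpace ℝ (Fin n))
    (x : Fin N → EuclideanSpace ℝ (Fin n)) :
    sampleMean x - m = (empMean (stat m) x).1 := by
  have h1 := clm_empMean (ContinuousLinearMap.fst ℝ (EuclideanSpace ℝ (Fin n))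
    (Matrix (Fin n) (Fin n) ℝ)) (stat m) x
  simp only [ContinuousLinearMap.coe_fst'] at h1
  rw [h1]
  exact empMean_sub_const hN (fun y => y) m x

theorem sampleCov_apply (x : Fin N → EuclideanSpace ℝ (Fin n)) (i j : Fin n) :
    sampleCov x i j = (N : ℝ)⁻¹ * ∑ k, x k i * x k j - sampleMean x i * sampleMean x j := by
  simp [sampleCov, Matrix.vecMulVec_apply, Matrix.sum_apply]

theorem sampleMean_apply (x : Fin N → EuclideanSpace ℝ (Fin n)) (i : Fin n) :
    sampleMean x i = (N : ℝ)⁻¹ * ∑ k, x k i := by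
  simp [sampleMean]

theorem sampleCov_eq_statCov (hN : 0 < N) (m : EuclideanSpace ℝ (Fin n))
    (x : Fin N → EuclideanSpace ℝ (Fin n)) :
    sampleCov x = statCov (empMean (stat m) x) := by
  have hN' : (N : ℝ) ≠ 0 := by positivity
  have h2 : (empMean (stat m) x).2
      = (N : ℝ)⁻¹ • ∑ k, Matrix.vecMulVec (x k - m).ofLp (x k - m).ofLp := by
    simp [empMean, stat, Prod.snd_sum]
  ext i j
  rw [sampleCov_apply, statCov, ← sampleMean_sub hN, h2]
  simp only [Matrix.sub_apply, Matrix.smul_apply, Matrix.sum_apply, Matrix.vecMulVec_apply,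
    PiLp.sub_apply, smul_eq_mul, sampleMean_apply]
  have h3 : ∑ k, (x k i - m i) * (x k j - m j)
      = ∑ k, x k i * x k j - m j * ∑ k, x k i - m i * ∑ k, x k j + N * (m i * m j) := by
    simp only [Finset.mul_sum, ← Finset.sum_sub_distrib]
    rw [show (N : ℝ) * (m i * m j) = ∑ _k : Fin N, m i * m j by simp, ← Finset.sum_add_distrib]
    exact Finset.sum_congr rfl fun k _ => by ring
  rw [h3]
  field_simp
  ring

theorem posSemidef_sampleCov (x : Fin N → EuclideanSpace ℝ (Fin n)) :
    (sampleCov x).PosSemidef := by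
  rcases Nat.eq_zero_or_pos N with rfl | hN
  · have : sampleCov x = 0 := by ext i j; simp [sampleCov_apply, sampleMean_apply]
    rw [this]
    exact Matrix.PosSemidef.zero
  · rw [sampleCov_eq_statCov hN (sampleMean x), statCov, ← sampleMean_sub hN]
    simp only [sub_self, WithLp.ofLp_zero, Matrix.vecMulVec_zero, sub_zero]
    have h2 : (empMean (stat (sampleMean x)) x).2 = (N : ℝ)⁻¹ •
        ∑ k, Matrix.vecMulVec (x k - sampleMean x).ofLp (x k - sampleMean x).ofLp := by
      simp [empMean, stat, Prod.snd_sum]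
    rw [h2]
    refine Matrix.PosSemidef.smul (Matrix.posSemidef_sum _ fun k _ => ?_) (by positivity)
    simpa using Matrix.posSemidef_vecMulVec_self_star (x k - sampleMean x).ofLp

theorem continuous_sampleMean :
    Continuous fun x : Fin N → EuclideanSpace ℝ (Fin n) => sampleMean x := by
  unfold sampleMean; fun_prop

theorem continuous_sampleCov :
    Continuous fun x : Fin N → EuclideanSpace ℝ (Fin n) => sampleCov x := by
  refine continuous_matrix fun i j => ?_
  simp only [sampleCov_apply, sampleMean_apply]
  fun_prop

theorem measurable_matched (μ : Measure (EuclideanSpace ℝ (Fin n))) (k : Fin N) :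
    Measurable fun x => matched μ x k := by
  have hs : Continuous fun x : Fin N → EuclideanSpace ℝ (Fin n) => CFC.sqrt (sampleCov x) :=
    (CFC.continuousOn_sqrt (A := Matrix (Fin n) (Fin n) ℝ)).comp_continuous continuous_sampleCov
      fun x => (posSemidef_sampleCov x).nonneg
  have e : (fun x => matched μ x k) = fun x =>
      (CFC.sqrt (sampleCov x)).det⁻¹ • WithLp.toLp 2
        ((CFC.sqrt (covMatrix μ) * (CFC.sqrt (sampleCov x)).adjugate) *ᵥ
          (x k - sampleMean x).ofLp) + mean μ := by
    ext1 x
    rw [matched, Matrix.inv_def, Ring.inverse_eq_inv', Matrix.mul_smul, map_smul]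
    rfl
  rw [e]
  have h1 : Continuous fun x : Fin N → EuclideanSpace ℝ (Fin n) => WithLp.toLp 2
        ((CFC.sqrt (covMatrix μ) * (CFC.sqrt (sampleCov x)).adjugate) *ᵥ
          (x k - sampleMean x).ofLp) := by
    have := continuous_sampleMean (n := n) (N := N)
    refine (PiLp.continuous_toLp 2 _).comp (Continuous.matrix_mulVec ?_ (by fun_prop))
    exact continuous_const.mul hs.matrix_adjugate
  exact ((hs.matrix_det.measurable.inv).smul h1.measurable).add_const _

theorem measurable_matchedEstimator (μ : Measure (EuclideanSpace ℝ (Fin n)))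
    {f : EuclideanSpace ℝ (Fin n) → ℝ} (hf : Measurable f) :
    Measurable fun x : Fin N → EuclideanSpace ℝ (Fin n) => matchedEstimator μ f x :=
  (Finset.measurable_sum _ fun k _ => hf.comp (measurable_matched μ k)).const_mul _

theorem abs_matchedEstimator_le (μ : Measure (EuclideanSpace ℝ (Fin n)))
    {f : EuclideanSpace ℝ (Fin n) → ℝ} {K : ℝ} (hK : ∀ x, |f x| ≤ K)
    (x : Fin N → EuclideanSpace ℝ (Fin n)) : |matchedEstimator μ f x| ≤ K := by
  have hK0 : 0 ≤ K := (abs_nonneg _).trans (hK 0)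
  rcases Nat.eq_zero_or_pos N with rfl | hN
  · simpa [matchedEstimator] using hK0
  · have h1 : |∑ k, f (matched μ x k)| ≤ N * K := by
      refine (Finset.abs_sum_le_sum_abs _ _).trans ?_
      calc ∑ k, |f (matched μ x k)| ≤ ∑ _k : Fin N, K := Finset.sum_le_sum fun k _ => hK _
        _ = N * K := by simp
    have hN' : (0 : ℝ) < N := by positivity
    rw [matchedEstimator, abs_mul, abs_of_pos (inv_pos.2 hN'), inv_mul_le_iff₀ hN']
    exact h1

/-- The linear part and the translation of the moment matching transformation, as a function of
the first and second order statistics; `P` is the square root of the covariance matrix and `R` a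
smooth square root near the covariance matrix. -/
def matchParam (P : Matrix (Fin n) (Fin n) ℝ)
    (R : Matrix (Fin n) (Fin n) ℝ → Matrix (Fin n) (Fin n) ℝ)
    (s : EuclideanSpace ℝ (Fin n) × Matrix (Fin n) (Fin n) ℝ) :
    (EuclideanSpace ℝ (Fin n) →L[ℝ] EuclideanSpace ℝ (Fin n)) × EuclideanSpace ℝ (Fin n) :=
  (Matrix.toEuclideanCLM (𝕜 := ℝ) (P * (R (statCov s))⁻¹),
    -(Matrix.toEuclideanCLM (𝕜 := ℝ) (P * (R (statCov s))⁻¹) s.1))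

theorem contDiff_vecMulVec_self :
    ContDiff ℝ ∞ fun y : EuclideanSpace ℝ (Fin n) => Matrix.vecMulVec y.ofLp y.ofLp := by
  have e : (fun y : EuclideanSpace ℝ (Fin n) => Matrix.vecMulVec y.ofLp y.ofLp)
      = fun y => ∑ i, ∑ j, (y i * y j) • Matrix.single i j (1 : ℝ) := by
    ext1 y
    conv_lhs => rw [Matrix.matrix_eq_sum_single (Matrix.vecMulVec y.ofLp y.ofLp)]
    simp [Matrix.vecMulVec_apply, Matrix.smul_single]
  rw [e]
  fun_prop

theorem contDiff_statCov : ContDiff ℝ ∞ (statCov (n := n)) := by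
  unfold statCov
  exact contDiff_snd.sub (contDiff_vecMulVec_self.comp contDiff_fst)

/-- The matrix-to-operator correspondence as a continuous linear map. -/
def toEuclideanL : Matrix (Fin n) (Fin n) ℝ →L[ℝ]
    (EuclideanSpace ℝ (Fin n) →L[ℝ] EuclideanSpace ℝ (Fin n)) :=
  LinearMap.toContinuousLinearMap
    ((Matrix.toEuclideanCLM (n := Fin n) (𝕜 := ℝ)).toAlgEquiv.toLinearMap)

theorem toEuclideanL_apply (A : Matrix (Fin n) (Fin n) ℝ) :
    toEuclideanL A = Matrix.toEuclideanCLM (𝕜 := ℝ) A := rfl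

theorem contDiffAt_matrix_inv {A : Matrix (Fin n) (Fin n) ℝ} (hA : IsUnit A) :
    ContDiffAt ℝ 2 (fun B : Matrix (Fin n) (Fin n) ℝ => B⁻¹) A := by
  obtain ⟨u, rfl⟩ := hA
  have e : (fun B : Matrix (Fin n) (Fin n) ℝ => B⁻¹) = Ring.inverse := by
    ext1 B; exact Matrix.nonsing_inv_eq_ringInverse B
  rw [e]
  exact contDiffAt_ringInverse ℝ u

theorem contDiffAt_matchLinear {P : Matrix (Fin n) (Fin n) ℝ} (hP : P.PosDef)
    {R : Matrix (Fin n) (Fin n) ℝ → Matrix (Fin n) (Fin n) ℝ} (hR : ContDiffAt ℝ 2 R (P * P))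
    (hR0 : R (P * P) = P) :
    ContDiffAt ℝ 2 (fun s : EuclideanSpace ℝ (Fin n) × Matrix (Fin n) (Fin n) ℝ =>
      P * (R (statCov s))⁻¹) (0, P * P) := by
  have h0 : statCov ((0 : EuclideanSpace ℝ (Fin n)), P * P) = P * P := by simp [statCov]
  have h1 : ContDiffAt ℝ 2 (statCov (n := n)) (0, P * P) :=
    (contDiff_infty.1 contDiff_statCov 2).contDiffAt
  have h2 : ContDiffAt ℝ 2 (fun s => R (statCov (n := n) s)) (0, P * P) :=
    ContDiffAt.comp (g := R) _ (by rw [h0]; exact hR) h1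
  have h3 : ContDiffAt ℝ 2 (fun s => (R (statCov (n := n) s))⁻¹) (0, P * P) :=
    ContDiffAt.comp (g := fun B : Matrix (Fin n) (Fin n) ℝ => B⁻¹) _
      (by rw [h0, hR0]; exact contDiffAt_matrix_inv hP.isUnit) h2
  exact contDiffAt_const.mul h3

theorem contDiffAt_matchParam {P : Matrix (Fin n) (Fin n) ℝ} (hP : P.PosDef)
    {R : Matrix (Fin n) (Fin n) ℝ → Matrix (Fin n) (Fin n) ℝ} (hR : ContDiffAt ℝ 2 R (P * P))
    (hR0 : R (P * P) = P) : ContDiffAt ℝ 2 (matchParam P R) (0, P * P) := by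
  have h1 : ContDiffAt ℝ 2 (fun s : EuclideanSpace ℝ (Fin n) × Matrix (Fin n) (Fin n) ℝ =>
      toEuclideanL (P * (R (statCov s))⁻¹)) (0, P * P) :=
    toEuclideanL.contDiff.contDiffAt.comp _ (contDiffAt_matchLinear hP hR hR0)
  exact h1.prodMk (h1.clm_apply contDiffAt_fst).neg

theorem matchParam_base {P : Matrix (Fin n) (Fin n) ℝ} (hP : P.PosDef)
    {R : Matrix (Fin n) (Fin n) ℝ → Matrix (Fin n) (Fin n) ℝ} (hR0 : R (P * P) = P) :
    matchParam P R (0, P * P) = (ContinuousLinearMap.id ℝ _, 0) := by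
  have h0 : statCov ((0 : EuclideanSpace ℝ (Fin n)), P * P) = P * P := by simp [statCov]
  have h1 : P * P⁻¹ = 1 := Matrix.mul_nonsing_inv _ ((Matrix.isUnit_iff_isUnit_det P).1 hP.isUnit)
  simp only [matchParam, h0, hR0, h1, map_one, map_zero, neg_zero]
  rfl

/-- Near the true moments the matched estimator is an empirical mean of `f` composed with the
affine transformation determined by the empirical moments. -/
theorem exists_matchedEstimator_eq {μ : Measure (EuclideanSpace ℝ (Fin n))}
    (hS : (covMatrix μ).PosDef)
    {R : Matrix (Fin n) (Fin n) ℝ → Matrix (Fin n) (Fin n) ℝ}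
    (hR : ∀ᶠ Q in 𝓝 (CFC.sqrt (covMatrix μ)), R (Q * Q) = Q) :
    ∃ δ, 0 < δ ∧ ∀ (f : EuclideanSpace ℝ (Fin n) → ℝ) (N : ℕ)
      (x : Fin N → EuclideanSpace ℝ (Fin n)), 0 < N →
      ‖empMean (stat (mean μ)) x - (0, covMatrix μ)‖ ≤ δ →
      matchedEstimator μ f x = empMean (fun y => f (mean μ
        + (matchParam (CFC.sqrt (covMatrix μ)) R (empMean (stat (mean μ)) x)).1 (y - mean μ)
        + (matchParam (CFC.sqrt (covMatrix μ)) R (empMean (stat (mean μ)) x)).2)) x := by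
  have h0 : statCov ((0 : EuclideanSpace ℝ (Fin n)), covMatrix μ) = covMatrix μ := by
    simp [statCov]
  have h1 : Tendsto (statCov (n := n)) (𝓝 (0, covMatrix μ)) (𝓝 (covMatrix μ)) := by
    have := contDiff_statCov.continuous.tendsto ((0 : EuclideanSpace ℝ (Fin n)), covMatrix μ)
    rwa [h0] at this
  obtain ⟨δ, hδ, hball⟩ := Metric.nhds_basis_closedBall.mem_iff.1
    (h1.eventually (eventually_local_sqrt_eq hS hR))
  refine ⟨δ, hδ, fun f N x hN hx => ?_⟩
  set s := empMean (stat (mean μ)) x with hs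
  have h2 : CFC.sqrt (sampleCov x) = R (statCov s) := by
    rw [sampleCov_eq_statCov hN (mean μ)]
    refine hball (by simpa [dist_eq_norm] using hx) ?_
    rw [← sampleCov_eq_statCov hN]
    exact posSemidef_sampleCov x
  rw [matchedEstimator, empMean, smul_eq_mul]
  congr 1
  refine Finset.sum_congr rfl fun k _ => ?_
  congr 1
  rw [matched, h2]
  have h3 : x k - sampleMean x = (x k - mean μ) - s.1 := by
    rw [hs, ← sampleMean_sub hN]; abel
  rw [h3, map_sub]
  simp only [matchParam]
  rw [← Matrix.coe_toEuclideanCLM_eq_toEuclideanLin]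
  simp only [ContinuousLinearMap.coe_coe]
  abel

/-- The linear functional `(b, S) ↦ 2 tr S`, which controls the size of a sample point by its
second order statistic. -/
def twoTrace : (EuclideanSpace ℝ (Fin n) × Matrix (Fin n) (Fin n) ℝ) →L[ℝ] ℝ :=
  LinearMap.toContinuousLinearMap
    ((2 : ℝ) • (Matrix.traceLinearMap (Fin n) ℝ ℝ).comp (LinearMap.snd ℝ _ _))

theorem twoTrace_stat (m x : EuclideanSpace ℝ (Fin n)) :
    twoTrace (stat m x) = 2 * ‖x - m‖ ^ 2 := by
  rw [EuclideanSpace.real_norm_sq_eq]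
  simp [twoTrace, stat, Matrix.trace, Matrix.vecMulVec_apply, sq]

end Statistic

/-! ### Variance asymptotics of the matched estimator -/

section Matching

open scoped Matrix.Norms.L2Operator

variable {n : ℕ}

theorem hasFDerivAt_statCov (S : Matrix (Fin n) (Fin n) ℝ) :
    HasFDerivAt (statCov (n := n)) (ContinuousLinearMap.snd ℝ _ _) (0, S) := by
  have h1 : HasFDerivAt (fun y : EuclideanSpace ℝ (Fin n) => Matrix.vecMulVec y.ofLp y.ofLp)
      (0 : EuclideanSpace ℝ (Fin n) →L[ℝ] Matrix (Fin n) (Fin n) ℝ) 0 := by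
    have hd := (contDiff_vecMulVec_self (n := n)).differentiable (by simp) 0
    set D := fderiv ℝ (fun y : EuclideanSpace ℝ (Fin n) => Matrix.vecMulVec y.ofLp y.ofLp) 0
    have h2 : HasFDerivAt (fun y : EuclideanSpace ℝ (Fin n) => Matrix.vecMulVec y.ofLp y.ofLp)
      D 0 := hd.hasFDerivAt
    -- the derivative of an even function vanishes at the origin
    have h3 := HasFDerivAt.comp (0 : EuclideanSpace ℝ (Fin n)) (f := fun y => -y)
      (by rw [neg_zero]; exact h2) (hasFDerivAt_id (0 : EuclideanSpace ℝ (Fin n))).neg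
    have e : (fun y : EuclideanSpace ℝ (Fin n) => Matrix.vecMulVec y.ofLp y.ofLp) ∘ (fun y => -y)
        = fun y => Matrix.vecMulVec y.ofLp y.ofLp := by
      ext1 y; simp [Matrix.neg_vecMulVec, Matrix.vecMulVec_neg]
    rw [e] at h3
    have h4 := h2.unique h3
    have h5 : D = 0 := by
      ext1 v
      have h6 := congrArg (fun A => A v) h4
      simp only [ContinuousLinearMap.comp_apply, neg_apply, ContinuousLinearMap.id_apply,
        map_neg] at h6
      have h7 : (2 : ℝ) • D v = 0 := by rw [two_smul]; nth_rewrite 1 [h6]; simp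
      exact (smul_eq_zero_iff_right two_ne_zero).1 h7
    rw [h5] at h2
    exact h2
  have h6 : HasFDerivAt (fun s : EuclideanSpace ℝ (Fin n) × Matrix (Fin n) (Fin n) ℝ =>
      Matrix.vecMulVec s.1.ofLp s.1.ofLp)
      ((0 : EuclideanSpace ℝ (Fin n) →L[ℝ] Matrix (Fin n) (Fin n) ℝ).comp
        (ContinuousLinearMap.fst ℝ _ _)) (0, S) :=
    HasFDerivAt.comp (0, S) (f := Prod.fst) (g := fun y : EuclideanSpace ℝ (Fin n) =>
      Matrix.vecMulVec y.ofLp y.ofLp) h1 hasFDerivAt_fst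
  refine (hasFDerivAt_snd.sub h6).congr_fderiv ?_
  simp

theorem fderiv_mul_self_apply {X A : Type*} [NormedAddCommGroup X] [NormedSpace ℝ X]
    [NormedRing A] [NormedAlgebra ℝ A] {r c : X → A} {r' c' : X →L[ℝ] A} {s₀ : X}
    (hr : HasFDerivAt r r' s₀) (hc : HasFDerivAt c c' s₀) (h : ∀ᶠ s in 𝓝 s₀, r s * r s = c s)
    (v : X) : r' v * r s₀ + r s₀ * r' v = c' v := by
  have h1 := hr.mul' hr
  have h2 : HasFDerivAt (r * r) c' s₀ := hc.congr_of_eventuallyEq h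
  have h3 := congrArg (fun A => A v) (h1.unique h2)
  simp only [add_apply, smul_apply, smul_eq_mul, op_smul_eq_mul] at h3
  rw [add_comm]; exact h3

/-- Differentiating `M r = P` at a point with `M = 1` gives `M' r = -r'`. -/
theorem fderiv_left_inverse_apply {X A : Type*} [NormedAddCommGroup X] [NormedSpace ℝ X]
    [NormedRing A] [NormedAlgebra ℝ A] {r M : X → A} {r' M' : X →L[ℝ] A} {s₀ : X} {P : A}
    (hr : HasFDerivAt r r' s₀) (hM : HasFDerivAt M M' s₀) (h1 : M s₀ = 1)
    (h : ∀ᶠ s in 𝓝 s₀, M s * r s = P) (v : X) : M' v * r s₀ = -r' v := by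
  have h2 := hM.mul' hr
  have h3 : HasFDerivAt (M * r) (0 : X →L[ℝ] A) s₀ :=
    (hasFDerivAt_const P s₀).congr_of_eventuallyEq h
  have h4 := congrArg (fun A => A v) (h2.unique h3)
  simp only [add_apply, smul_apply, smul_eq_mul, op_smul_eq_mul, h1, one_mul, zero_apply] at h4
  exact eq_neg_of_add_eq_zero_right h4

/-- The derivative of the moment matching transformation at the true moments: the translation
part is `-b`, and the linear part is `-K P⁻¹` with `K` the solution of the Sylvester equation
`K P + P K = H`. -/
theorem fderiv_matchParam {P : Matrix (Fin n) (Fin n) ℝ} (hP : P.PosDef)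
    {R : Matrix (Fin n) (Fin n) ℝ → Matrix (Fin n) (Fin n) ℝ} (hR : ContDiffAt ℝ 2 R (P * P))
    (hR0 : R (P * P) = P) (hRR : ∀ᶠ S in 𝓝 (P * P), R S * R S = S)
    (v : EuclideanSpace ℝ (Fin n) × Matrix (Fin n) (Fin n) ℝ) :
    (fderiv ℝ (matchParam P R) (0, P * P) v).2 = -v.1 ∧
    ∃ K : Matrix (Fin n) (Fin n) ℝ, K * P + P * K = v.2 ∧
      (fderiv ℝ (matchParam P R) (0, P * P) v).1
        = Matrix.toEuclideanCLM (𝕜 := ℝ) (-(K * P⁻¹)) := by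
  have h0 : statCov ((0 : EuclideanSpace ℝ (Fin n)), P * P) = P * P := by simp [statCov]
  have hPu : IsUnit P.det := (Matrix.isUnit_iff_isUnit_det P).1 hP.isUnit
  have hcont : Tendsto (statCov (n := n)) (𝓝 (0, P * P)) (𝓝 (P * P)) := by
    have := (hasFDerivAt_statCov (P * P)).continuousAt.tendsto
    rwa [h0] at this
  -- the derivative `r'` of the square root `r` of the covariance
  obtain ⟨r, hrdef⟩ : ∃ r : EuclideanSpace ℝ (Fin n) × Matrix (Fin n) (Fin n) ℝ →
    Matrix (Fin n) (Fin n) ℝ, r = fun s => R (statCov s) := ⟨_, rfl⟩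
  have hr0 : r (0, P * P) = P := by rw [hrdef]; simp only [h0, hR0]
  obtain ⟨r', hr⟩ : ∃ r' : (EuclideanSpace ℝ (Fin n) × Matrix (Fin n) (Fin n) ℝ) →L[ℝ]
      Matrix (Fin n) (Fin n) ℝ, HasFDerivAt r r' (0, P * P) := by
    rw [hrdef]
    exact ⟨_, HasFDerivAt.comp _ (g := R)
      (by rw [h0]; exact (hR.differentiableAt (by simp)).hasFDerivAt)
      (hasFDerivAt_statCov (P * P))⟩
  have hK := fderiv_mul_self_apply hr (hasFDerivAt_statCov (P * P))
    (by rw [hrdef]; exact hcont.eventually hRR) v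
  rw [hr0] at hK
  -- the derivative of the linear part
  obtain ⟨M, hMdef⟩ : ∃ M : EuclideanSpace ℝ (Fin n) × Matrix (Fin n) (Fin n) ℝ →
    Matrix (Fin n) (Fin n) ℝ, M = fun s => P * (R (statCov s))⁻¹ := ⟨_, rfl⟩
  have hM : ∃ M' : (EuclideanSpace ℝ (Fin n) × Matrix (Fin n) (Fin n) ℝ) →L[ℝ]
      Matrix (Fin n) (Fin n) ℝ,
      HasFDerivAt M M' (0, P * P) := by
    rw [hMdef]
    exact ⟨_, ((contDiffAt_matchLinear hP hR hR0).differentiableAt (by simp)).hasFDerivAt⟩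
  obtain ⟨M', hM'⟩ := hM
  have hM0 : M (0, P * P) = 1 := by
    rw [hMdef]
    simp only [h0, hR0]
    exact Matrix.mul_nonsing_inv _ hPu
  have hunit : ∀ᶠ s in 𝓝 (0, P * P), IsUnit (r s).det := by
    have h1 : Tendsto r (𝓝 (0, P * P)) (𝓝 P) := by
      have := hr.continuousAt.tendsto
      rwa [hr0] at this
    have hc : Tendsto (fun s => (r s).det) (𝓝 (0, P * P)) (𝓝 P.det) :=
      ((continuous_id.matrix_det).tendsto P).comp h1
    filter_upwards [hc.eventually_ne hPu.ne_zero] with s hs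
    exact isUnit_iff_ne_zero.2 hs
  have hMr : M' v = -(r' v * P⁻¹) := by
    have h4 := fderiv_left_inverse_apply (P := P) hr hM' hM0 (by
      filter_upwards [hunit] with s hs
      rw [hrdef] at hs
      rw [hMdef, hrdef]
      simp only
      rw [Matrix.mul_assoc, Matrix.nonsing_inv_mul _ hs, Matrix.mul_one]) v
    rw [hr0] at h4
    calc M' v = M' v * P * P⁻¹ := by
          rw [Matrix.mul_assoc, Matrix.mul_nonsing_inv _ hPu, Matrix.mul_one]
      _ = _ := by rw [h4, neg_mul]
  have hA : HasFDerivAt (fun s => toEuclideanL (M s)) (toEuclideanL.comp M') (0, P * P) :=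
    toEuclideanL.hasFDerivAt.comp _ hM'
  have hc := (hA.clm_apply (hasFDerivAt_fst (𝕜 := ℝ)
    (p := ((0 : EuclideanSpace ℝ (Fin n)), P * P)))).neg
  have hΘ := (hA.prodMk hc).congr_of_eventuallyEq (f₁ := matchParam P R)
    (Filter.Eventually.of_forall fun s => by rw [hMdef]; rfl)
  rw [hΘ.fderiv]
  refine ⟨?_, r' v, hK, ?_⟩
  · simp [hM0, toEuclideanL_apply]
  · simp only [ContinuousLinearMap.prod_apply, ContinuousLinearMap.comp_apply, hMr,
      toEuclideanL_apply]

theorem posSemidef_covMatrix {μ : Measure (EuclideanSpace ℝ (Fin n))} [IsProbabilityMeasure μ]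
    (hμ : MemLp id 2 μ) : (covMatrix μ).PosSemidef := by
  have hi : ∀ i, MemLp (fun x : EuclideanSpace ℝ (Fin n) => x i) 2 μ := fun i =>
    (EuclideanSpace.proj (𝕜 := ℝ) i).comp_memLp' hμ
  refine Matrix.PosSemidef.of_dotProduct_mulVec_nonneg ?_ fun u => ?_
  · ext i j
    simp [covMatrix, covariance_comm]
  · have h1 : star u ⬝ᵥ covMatrix μ *ᵥ u
        = cov[fun x => ∑ i, u i * x i, fun x => ∑ j, u j * x j; μ] := by
      rw [covariance_fun_sum_fun_sum (fun i => (hi i).const_mul (u i))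
        (fun j => (hi j).const_mul (u j))]
      simp only [dotProduct, Matrix.mulVec, star_trivial, Finset.mul_sum,
        covariance_const_mul_left, covariance_const_mul_right, covMatrix, Matrix.of_apply]
      refine Finset.sum_congr rfl fun i _ => Finset.sum_congr rfl fun j _ => by ring
    rw [h1, covariance_self]
    · exact variance_nonneg _ _
    · exact (Measurable.aemeasurable (by fun_prop))

theorem posDef_covMatrix {μ : Measure (EuclideanSpace ℝ (Fin n))} [IsProbabilityMeasure μ]
    (hμ : MemLp id 2 μ) (hcov : IsUnit (covMatrix μ).det) : (covMatrix μ).PosDef := by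
  rw [(posSemidef_covMatrix hμ).posDef_iff_isUnit, Matrix.isUnit_iff_isUnit_det]
  exact hcov

/-- The matched estimator of `f` is, near the true moments, an empirical mean of a linearizable
family in the first and second order statistics. The derivative `Θ'` of the affine transformation
does not depend on `f`. -/
theorem exists_linearization {μ : Measure (EuclideanSpace ℝ (Fin n))} (hS : (covMatrix μ).PosDef) :
    ∃ Θ' : (EuclideanSpace ℝ (Fin n) × Matrix (Fin n) (Fin n) ℝ) →L[ℝ]
        (EuclideanSpace ℝ (Fin n) →L[ℝ] EuclideanSpace ℝ (Fin n)) × EuclideanSpace ℝ (Fin n),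
      (∀ v, (Θ' v).2 = -v.1 ∧ ∃ K : Matrix (Fin n) (Fin n) ℝ,
        K * CFC.sqrt (covMatrix μ) + CFC.sqrt (covMatrix μ) * K = v.2 ∧
          (Θ' v).1 = Matrix.toEuclideanCLM (𝕜 := ℝ) (-(K * (CFC.sqrt (covMatrix μ))⁻¹))) ∧
      ∀ f : EuclideanSpace ℝ (Fin n) → ℝ, ContDiff ℝ ∞ f → HasCompactSupport f →
        ∃ G δ C K, IsLinearizable (stat (mean μ)) (0, covMatrix μ) G
            (affineDeriv f (mean μ) Θ') twoTrace δ C K ∧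
          G (0, covMatrix μ) = f ∧ (∀ x, |f x| ≤ K) ∧
          ∀ (N : ℕ) (x : Fin N → EuclideanSpace ℝ (Fin n)), 0 < N →
            ‖empMean (stat (mean μ)) x - (0, covMatrix μ)‖ ≤ δ →
            matchedEstimator μ f x = empMean (G (empMean (stat (mean μ)) x)) x := by
  set P := CFC.sqrt (covMatrix μ) with hPdef
  have hP : P.PosDef := posDef_sqrt hS
  have hPP : P * P = covMatrix μ := CFC.sqrt_mul_sqrt_self _ hS.posSemidef.nonneg
  obtain ⟨R, hR, hR0, hRQ, hRR⟩ := exists_local_sqrt hP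
  refine ⟨fderiv ℝ (matchParam P R) (0, P * P), fderiv_matchParam hP hR hR0 hRR,
    fun f hf hc => ?_⟩
  obtain ⟨K, L, hL, hfK, hfL, hfLip⟩ := exists_bounds_of_hasCompactSupport hf hc
  obtain ⟨δ₁, hδ₁, hmatch⟩ := exists_matchedEstimator_eq hS (R := R) hRQ
  obtain ⟨δ₀, C, hδ₀, hlin⟩ := exists_isLinearizable_of_contDiffAt (hf.differentiable (by simp))
    hfK hfL hL hfLip (contDiffAt_matchParam hP hR hR0) (matchParam_base hP hR0) (mean μ)
    (ψ := stat (mean μ)) (κ := twoTrace) (fun x => by rw [twoTrace_stat]; positivity)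
    (fun x => by rw [twoTrace_stat]; nlinarith [sq_nonneg (1 - ‖x - mean μ‖)])
  rw [hPP] at hlin ⊢
  refine ⟨_, min δ₀ δ₁, C, K, hlin (min δ₀ δ₁) (by positivity) (min_le_left _ _), ?_, hfK,
    fun N x hN hx => hmatch f N x hN (hx.trans (min_le_right _ _))⟩
  ext1 x
  have := matchParam_base hP hR0
  rw [hPP] at this
  simp [this]

/-- The Borel structure on matrices. -/
@[reducible] def matrixMeasurableSpace : MeasurableSpace (Matrix (Fin n) (Fin n) ℝ) := borel _

attribute [local instance] matrixMeasurableSpace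

theorem matrixBorelSpace : BorelSpace (Matrix (Fin n) (Fin n) ℝ) := ⟨rfl⟩

attribute [local instance] matrixBorelSpace

theorem continuous_stat (m : EuclideanSpace ℝ (Fin n)) : Continuous (stat m) := by
  unfold stat
  exact (by fun_prop : Continuous fun x : EuclideanSpace ℝ (Fin n) => x - m).prodMk
    (contDiff_vecMulVec_self.continuous.comp
      (by fun_prop : Continuous fun x : EuclideanSpace ℝ (Fin n) => x - m))

theorem exists_norm_stat_le (m : EuclideanSpace ℝ (Fin n)) :
    ∃ C, 0 ≤ C ∧ ∀ x, ‖stat m x‖ ≤ C * (1 + ‖x - m‖ ^ 2) := by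
  -- each entry of `(x - m)(x - m)ᵀ` is bounded by `‖x - m‖²`
  refine ⟨1 + ∑ i : Fin n, ∑ j : Fin n, ‖Matrix.single i j (1 : ℝ)‖, by positivity, fun x => ?_⟩
  set y := x - m
  have h1 : ‖Matrix.vecMulVec y.ofLp y.ofLp‖
      ≤ (∑ i : Fin n, ∑ j : Fin n, ‖Matrix.single i j (1 : ℝ)‖) * ‖y‖ ^ 2 := by
    conv_lhs => rw [Matrix.matrix_eq_sum_single (Matrix.vecMulVec y.ofLp y.ofLp)]
    rw [Finset.sum_mul]
    refine (norm_sum_le _ _).trans (Finset.sum_le_sum fun i _ => ?_)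
    rw [Finset.sum_mul]
    refine (norm_sum_le _ _).trans (Finset.sum_le_sum fun j _ => ?_)
    rw [show Matrix.single i j (Matrix.vecMulVec y.ofLp y.ofLp i j)
      = (y i * y j) • Matrix.single i j (1 : ℝ) by
        simp [Matrix.vecMulVec_apply, Matrix.smul_single], norm_smul, norm_mul, mul_comm, sq]
    gcongr
    · exact PiLp.norm_apply_le y i
    · exact PiLp.norm_apply_le y j
  have h2 : 0 ≤ ∑ i : Fin n, ∑ j : Fin n, ‖Matrix.single i j (1 : ℝ)‖ := by positivity
  rw [stat, Prod.norm_mk]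
  refine max_le ?_ ?_
  · nlinarith [sq_nonneg (1 - ‖y‖), mul_nonneg h2 (by positivity : 0 ≤ 1 + ‖y‖ ^ 2),
      norm_nonneg y]
  · nlinarith [sq_nonneg ‖y‖]

theorem memLp_stat {μ : Measure (EuclideanSpace ℝ (Fin n))} [IsProbabilityMeasure μ] {p : ENNReal}
    (hμ : MemLp id (2 * p) μ) (m : EuclideanSpace ℝ (Fin n)) :
    MemLp (stat m) p μ := by
  obtain ⟨C, hC, hle⟩ := exists_norm_stat_le m
  have h1 : MemLp (fun x => ‖x - m‖) (2 * p) μ := (hμ.sub (memLp_const m)).norm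
  have h2 : MemLp (fun x => ‖x - m‖ ^ 2) p μ := by
    have h := h1.norm_rpow_div 2
    rw [mul_comm, ENNReal.mul_div_cancel_right (by simp) (by simp)] at h
    simpa using h
  refine ((memLp_const (1 : ℝ)).add h2).const_mul C |>.mono
    (continuous_stat m).aestronglyMeasurable (ae_of_all _ fun x => ?_)
  refine (hle x).trans (le_abs_self _)

end Matching

/-! ### The influence functional of the matched estimator -/

section Influence

open scoped Matrix.Norms.L2Operator

attribute [local instance] matrixMeasurableSpace matrixBorelSpace

variable {n : ℕ} {μ : Measure (EuclideanSpace ℝ (Fin n))} [IsProbabilityMeasure μ]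

theorem integrable_stat (hμ : MemLp id 2 μ) (m : EuclideanSpace ℝ (Fin n)) :
    Integrable (stat m) μ :=
  memLp_one_iff_integrable.1 (memLp_stat (by simpa using hμ) m)

theorem integral_stat (hμ : MemLp id 2 μ) :
    ∫ x, stat (mean μ) x ∂μ = (0, covMatrix μ) := by
  have h1 : Integrable (fun x => x) μ := hμ.integrable (by norm_num)
  have hst := integrable_stat hμ (mean μ)
  have hpi : Integrable (fun x : EuclideanSpace ℝ (Fin n) => x - mean μ) μ := hst.fst
  have hps : Integrable (fun x : EuclideanSpace ℝ (Fin n) =>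
    Matrix.vecMulVec (x - mean μ).ofLp (x - mean μ).ofLp) μ := hst.snd
  have h2 : ∫ x, stat (mean μ) x ∂μ = (∫ x, (x - mean μ) ∂μ,
      ∫ x, Matrix.vecMulVec (x - mean μ).ofLp (x - mean μ).ofLp ∂μ) := integral_pair hpi hps
  rw [h2, integral_sub h1 (integrable_const _)]
  congr 1
  · simp [mean]
  · ext i j
    have h3 := ((Matrix.entryLinearMap ℝ ℝ i j).toContinuousLinearMap).integral_comp_comm hps
    have h4 : ∀ i, ∫ x : EuclideanSpace ℝ (Fin n), x i ∂μ = mean μ i := fun i =>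
      (EuclideanSpace.proj (𝕜 := ℝ) i).integral_comp_comm h1
    calc _ = _ := h3.symm
      _ = _ := by
        simp [covMatrix, covariance, h4, Matrix.vecMulVec_apply]

theorem continuous_affineDeriv {f : EuclideanSpace ℝ (Fin n) → ℝ} (hf : ContDiff ℝ ∞ f)
    (m : EuclideanSpace ℝ (Fin n))
    (Θ' : (EuclideanSpace ℝ (Fin n) × Matrix (Fin n) (Fin n) ℝ) →L[ℝ]
        (EuclideanSpace ℝ (Fin n) →L[ℝ] EuclideanSpace ℝ (Fin n)) × EuclideanSpace ℝ (Fin n)) :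
    Continuous (affineDeriv f m Θ') := by
  unfold affineDeriv
  have h1 : Continuous (fderiv ℝ f) := hf.continuous_fderiv (by simp)
  have h2 : Continuous fun x : EuclideanSpace ℝ (Fin n) =>
      ContinuousLinearMap.apply ℝ (EuclideanSpace ℝ (Fin n)) (x - m) :=
    (ContinuousLinearMap.apply ℝ (EuclideanSpace ℝ (Fin n))).continuous.comp
      (continuous_id.sub continuous_const)
  exact h1.clm_comp (((h2.clm_comp continuous_const).add continuous_const).clm_comp
    continuous_const)

theorem memLp_of_norm_le_twoTrace {F : Type*} [NormedAddCommGroup F] {p : ENNReal}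
    {Λ : EuclideanSpace ℝ (Fin n) → F} (hΛ : AEStronglyMeasurable Λ μ)
    (hμ : MemLp id (2 * p) μ) {C : ℝ}
    (h : ∀ x, ‖Λ x‖ ≤ C * (2 + twoTrace (stat (mean μ) x))) : MemLp Λ p μ := by
  have h1 : MemLp (fun x => C * (2 + twoTrace (stat (mean μ) x))) p μ :=
    ((memLp_const (2 : ℝ)).add (twoTrace.comp_memLp' (memLp_stat hμ (mean μ)))).const_mul C
  exact h1.mono hΛ (ae_of_all _ fun x => (h x).trans (le_abs_self _))

/-- The influence functional `ℓ f` of the moment matching estimator: the estimator behaves like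
the empirical mean of `f + ℓ f (ψ - 𝔼 ψ)`, where `ψ` is the statistic of first and second
moments. Its values are expected derivatives of `f`. With eighth moments this determines the
variance of the estimator up to `O(N^{-3/2})`. With second moments only, an asymptotic upper bound
`b / N` for the variance still bounds the covariances of the linearization with bounded centred
functions `h` of bounded support. -/
theorem exists_influence (hμ : MemLp id 2 μ) (hS : (covMatrix μ).PosDef) :
    ∃ ℓ : (EuclideanSpace ℝ (Fin n) → ℝ) →
        (EuclideanSpace ℝ (Fin n) × Matrix (Fin n) (Fin n) ℝ) →L[ℝ] ℝ,
      ∀ f : EuclideanSpace ℝ (Fin n) → ℝ, ContDiff ℝ ∞ f → HasCompactSupport f →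
        (∀ b S, ∃ K, K * CFC.sqrt (covMatrix μ) + CFC.sqrt (covMatrix μ) * K = S ∧
          ℓ f (b, S) = -∫ x, fderiv ℝ f x (Matrix.toEuclideanCLM (𝕜 := ℝ)
            (K * (CFC.sqrt (covMatrix μ))⁻¹) (x - mean μ) + b) ∂μ) ∧
        (MemLp id 8 μ → ∃ c, ∀ N : ℕ, 0 < N →
          |N * Var[matchedEstimator μ f; sampleLaw μ N]
            - Var[fun y => f y + ℓ f (stat (mean μ) y - (0, covMatrix μ)); μ]|
              ≤ c * (N : ℝ) ^ (-(1 / 2) : ℝ)) ∧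
        ∀ (h : EuclideanSpace ℝ (Fin n) → ℝ) (H R : ℝ) (B : ℕ → ℝ) (b : ℝ), Measurable h →
          (∀ y, |h y| ≤ H) → (∀ y, h y ≠ 0 → ‖y‖ ≤ R) → (∫ y, h y ∂μ = 0) →
          (∀ᶠ N : ℕ in atTop, N * Var[matchedEstimator μ f; sampleLaw μ N] ≤ B N) →
          Tendsto B atTop (𝓝 b) →
          (∫ y, (f y + ℓ f (stat (mean μ) y - (0, covMatrix μ))) * h y ∂μ) ^ 2
            ≤ b * ∫ y, h y ^ 2 ∂μ := by
  obtain ⟨Θ', hΘ', hlin⟩ := exists_linearization hS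
  refine ⟨fun f => ∫ z, affineDeriv f (mean μ) Θ' z ∂μ, fun f hf hc => ?_⟩
  obtain ⟨G, δ, C, K, hl, hG, hfK, hT⟩ := hlin f hf hc
  have hΛm := (continuous_affineDeriv hf (mean μ) Θ').measurable
  have hΛs := (continuous_affineDeriv hf (mean μ) Θ').aestronglyMeasurable (μ := μ)
  have hψm := (continuous_stat (mean μ)).measurable
  have hΛ1 : Integrable (affineDeriv f (mean μ) Θ') μ := memLp_one_iff_integrable.1
    (memLp_of_norm_le_twoTrace hΛs (by simpa using hμ) hl.norm_deriv_le)
  have hGm : Measurable (G (0, covMatrix μ)) := by rw [hG]; exact hf.continuous.measurable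
  have hTm : ∀ N, Measurable (matchedEstimator (N := N) μ f) := fun N =>
    measurable_matchedEstimator μ hf.continuous.measurable
  have hTK : ∀ N (x : Fin N → EuclideanSpace ℝ (Fin n)), |matchedEstimator μ f x| ≤ K :=
    fun N x => abs_matchedEstimator_le μ hfK x
  refine ⟨fun b S => ?_, fun h8 => ?_, fun h H R B b hh hH hR h0 hVB hB => ?_⟩
  · obtain ⟨h1, L, hL, h2⟩ := hΘ' (b, S)
    refine ⟨L, hL, ?_⟩
    rw [ContinuousLinearMap.integral_apply hΛ1, ← integral_neg]
    refine integral_congr_ae (ae_of_all _ fun x => ?_)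
    simp only [affineDeriv_apply, h1, h2, map_neg, neg_apply, map_add, neg_add]
  · have := hl.exists_abs_variance_sub_le hψm (memLp_stat (by norm_num; exact h8) _)
      (integral_stat hμ) hΛm (memLp_of_norm_le_twoTrace hΛs (by norm_num; exact h8)
        hl.norm_deriv_le) hGm hTm hTK hT
    rw [hG] at this
    exact this
  · obtain ⟨D, hD, hle⟩ := exists_norm_stat_le (mean μ)
    have := hl.sq_integral_mul_le hψm (integrable_stat hμ _) (integral_stat hμ) hΛm hΛ1 hGm hTm
      hTK hT hh hH (R := D * (1 + (R + ‖mean μ‖) ^ 2)) (fun y hy => (hle y).trans (by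
        gcongr
        exact (norm_sub_le _ _).trans (by gcongr; exact hR y hy))) h0 hVB hB
    rw [hG] at this
    exact this

end Influence

/-! ### Densities of Gaussian measures -/

section GaussianDensity

variable {n : ℕ}

theorem integrable_exp_neg_sq_norm :
    Integrable fun x : EuclideanSpace ℝ (Fin n) => Real.exp (-(1 / 2) * ‖x‖ ^ 2) := by
  have h := (GaussianFourier.integrable_cexp_neg_mul_sq_norm_add (V := EuclideanSpace ℝ (Fin n))
    (b := (1 / 2 : ℝ)) (by simp) 0 0).re
  refine h.congr (ae_of_all _ fun x => ?_)
  simp only [zero_mul, add_zero]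
  rw [← Complex.exp_ofReal_re]
  push_cast
  rfl

theorem stdGaussian_eq_withDensity :
    ∃ c : ℝ, 0 < c ∧ stdGaussian (EuclideanSpace ℝ (Fin n))
      = volume.withDensity fun x => ENNReal.ofReal (c * Real.exp (-(1 / 2) * ‖x‖ ^ 2)) := by
  set I := ∫ x : EuclideanSpace ℝ (Fin n), Real.exp (-(1 / 2) * ‖x‖ ^ 2) with hI
  have hIv : I = (Real.pi / (1 / 2)) ^ (Module.finrank ℝ (EuclideanSpace ℝ (Fin n)) / 2 : ℝ) :=
    GaussianFourier.integral_rexp_neg_mul_sq_norm (V := EuclideanSpace ℝ (Fin n)) (b := 1 / 2)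
      (by norm_num)
  have hI0 : 0 < I := by rw [hIv]; positivity
  refine ⟨I⁻¹, by positivity, ?_⟩
  set d : EuclideanSpace ℝ (Fin n) → ℝ := fun x => I⁻¹ * Real.exp (-(1 / 2) * ‖x‖ ^ 2)
  have hd0 : ∀ x, 0 ≤ d x := fun x => by positivity
  have hdm : Measurable fun x => ENNReal.ofReal (d x) := by fun_prop
  have hfin : IsFiniteMeasure (volume.withDensity fun x => ENNReal.ofReal (d x)) :=
    isFiniteMeasure_withDensity_ofReal (integrable_exp_neg_sq_norm.const_mul _).2
  refine Measure.ext_of_charFun ?_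
  ext1 t
  have hb : (0 : ℝ) < ((1 / 2 : ℝ) : ℂ).re := by simp
  have key := GaussianFourier.integral_cexp_neg_mul_sq_norm_add (V := EuclideanSpace ℝ (Fin n))
    hb Complex.I t
  have key0 := GaussianFourier.integral_cexp_neg_mul_sq_norm (V := EuclideanSpace ℝ (Fin n)) hb
  have hI' : ((Real.pi : ℂ) / ((1 / 2 : ℝ) : ℂ))
      ^ (Module.finrank ℝ (EuclideanSpace ℝ (Fin n)) / 2 : ℂ) = (I : ℂ) := by
    rw [← key0, hI, ← integral_complex_ofReal]
    refine integral_congr_ae (ae_of_all _ fun x => ?_)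
    push_cast
    ring_nf
  rw [charFun_stdGaussian, charFun_apply,
    integral_withDensity_eq_integral_toReal_smul hdm (ae_of_all _ fun x => by simp)]
  rw [hI'] at key
  have : (fun x : EuclideanSpace ℝ (Fin n) => (ENNReal.ofReal (d x)).toReal
        • Complex.exp (inner ℝ x t * Complex.I))
      = fun x => ((I⁻¹ : ℝ) : ℂ) * Complex.exp (-((1 / 2 : ℝ) : ℂ) * ‖x‖ ^ 2
          + Complex.I * inner ℝ t x) := by
    ext1 x
    rw [ENNReal.toReal_ofReal (hd0 x), Complex.real_smul, real_inner_comm, Complex.exp_add]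
    simp only [d]
    push_cast
    ring_nf
  rw [this, integral_const_mul, key, ← mul_assoc, ← Complex.ofReal_mul,
    inv_mul_cancel₀ hI0.ne', Complex.ofReal_one, one_mul]
  congr 1
  rw [Complex.I_sq]
  push_cast
  ring

/-- Change of variables for a density with respect to a measure that `e` scales by a constant. -/
theorem map_withDensity_of_map_eq_smul {X : Type*} [MeasurableSpace X] {ν : Measure X}
    (e : X ≃ᵐ X) {c : ENNReal} (he : ν.map e = c • ν) (d : X → ENNReal) :
    (ν.withDensity d).map e = c • ν.withDensity fun x => d (e.symm x) := by
  ext s hs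
  rw [e.map_apply, withDensity_apply _ (e.measurable hs), Measure.smul_apply,
    withDensity_apply _ hs, ← lintegral_smul_measure, ← Measure.restrict_smul, ← he,
    e.restrict_map, lintegral_map_equiv]
  simp

/-- The nondegenerate Gaussian measure has the density `c exp(-(x - m)ᵀ S⁻¹ (x - m) / 2)`. -/
theorem multivariateGaussian_eq_withDensity (m : EuclideanSpace ℝ (Fin n))
    {S : Matrix (Fin n) (Fin n) ℝ} (hS : S.PosDef) :
    ∃ c : ℝ, 0 < c ∧ multivariateGaussian m S = volume.withDensity fun x => ENNReal.ofReal
      (c * Real.exp (-(1 / 2) * ((x - m).ofLp ⬝ᵥ S⁻¹ *ᵥ (x - m).ofLp))) := by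
  obtain ⟨c, hc, hstd⟩ := stdGaussian_eq_withDensity (n := n)
  set P := CFC.sqrt S with hPdef
  have hP : P.PosDef := posDef_sqrt hS
  have hPP : P * P = S := CFC.sqrt_mul_sqrt_self _ hS.posSemidef.nonneg
  have hPu : IsUnit P.det := (Matrix.isUnit_iff_isUnit_det P).1 hP.isUnit
  set L : EuclideanSpace ℝ (Fin n) →L[ℝ] EuclideanSpace ℝ (Fin n) :=
    Matrix.toEuclideanCLM (𝕜 := ℝ) P
  set L' : EuclideanSpace ℝ (Fin n) →L[ℝ] EuclideanSpace ℝ (Fin n) :=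
    Matrix.toEuclideanCLM (𝕜 := ℝ) P⁻¹
  have hLL' : L * L' = 1 := by
    rw [← map_mul, Matrix.mul_nonsing_inv _ hPu, map_one]
  have hL'L : L' * L = 1 := by
    rw [← map_mul, Matrix.nonsing_inv_mul _ hPu, map_one]
  let e₁ : EuclideanSpace ℝ (Fin n) ≃L[ℝ] EuclideanSpace ℝ (Fin n) :=
    ContinuousLinearEquiv.equivOfInverse L L' (fun x => by
      rw [← mul_apply_eq_comp, hL'L]; rfl) (fun x => by
      rw [← mul_apply_eq_comp, hLL']; rfl)
  let e : EuclideanSpace ℝ (Fin n) ≃ᵐ EuclideanSpace ℝ (Fin n) :=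
    (e₁.toHomeomorph.trans (Homeomorph.addLeft m)).toMeasurableEquiv
  have he : (e : EuclideanSpace ℝ (Fin n) → _) = fun x => m + L x := rfl
  have hes : ∀ x, e.symm x = L' (x - m) := fun x => by
    have : e.symm x = L' (-m + x) := rfl
    rw [this, neg_add_eq_sub]
  have hdet : LinearMap.det (L : EuclideanSpace ℝ (Fin n) →ₗ[ℝ] EuclideanSpace ℝ (Fin n)) ≠ 0 :=
    (LinearEquiv.isUnit_det' e₁.toLinearEquiv).ne_zero
  set D := |(LinearMap.det (L : EuclideanSpace ℝ (Fin n) →ₗ[ℝ] EuclideanSpace ℝ (Fin n)))⁻¹|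
  have hD : 0 < D := abs_pos.2 (inv_ne_zero hdet)
  have hmap : (volume : Measure (EuclideanSpace ℝ (Fin n))).map e = ENNReal.ofReal D • volume := by
    have h1 := Measure.map_linearMap_addHaar_eq_smul_addHaar
      (volume : Measure (EuclideanSpace ℝ (Fin n))) hdet
    rw [he, show (fun x => m + L x) = (fun x => m + x) ∘ L from rfl,
      ← Measure.map_map (measurable_const_add m) L.measurable]
    erw [h1]
    rw [Measure.map_smul, map_add_left_eq_self]
  refine ⟨D * c, by positivity, ?_⟩
  rw [multivariateGaussian, hstd, ← he, map_withDensity_of_map_eq_smul e hmap,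
    ← withDensity_smul _ (by fun_prop)]
  congr 1
  ext1 x
  rw [Pi.smul_apply, smul_eq_mul, ← ENNReal.ofReal_mul hD.le, hes, mul_assoc]
  congr 4
  have h2 : S⁻¹ = P⁻¹ * P⁻¹ := by rw [← hPP, Matrix.mul_inv_rev]
  have h3 : (P⁻¹)ᵀ = P⁻¹ := by
    rw [Matrix.transpose_nonsing_inv]
    have := hP.isHermitian.eq
    rw [Matrix.conjTranspose_eq_transpose_of_trivial] at this
    rw [this]
  congr 1
  rw [EuclideanSpace.real_norm_sq_eq, h2, ← Matrix.mulVec_mulVec, Matrix.dotProduct_mulVec,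
    ← Matrix.mulVec_transpose, h3]
  simp [dotProduct, sq, L', Matrix.ofLp_toEuclideanCLM, Matrix.mulVec_sub]

theorem eq_multivariateGaussian {μ : Measure (EuclideanSpace ℝ (Fin n))} [IsGaussian μ] :
    μ = multivariateGaussian (mean μ) (covMatrix μ) := by
  have h2 : MemLp id 2 μ := IsGaussian.memLp_two_id
  have hS := posSemidef_covMatrix h2
  refine IsGaussian.ext (by simp [mean]) ?_
  rw [← ContinuousLinearMap.toBilinForm_inj]
  refine LinearMap.BilinForm.ext_basis (EuclideanSpace.basisFun (Fin n) ℝ).toBasis fun i j => ?_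
  have (i : Fin n) : (fun x : EuclideanSpace ℝ (Fin n) ↦ x i) =
      fun x ↦ inner ℝ (EuclideanSpace.basisFun (Fin n) ℝ i) x := by ext; simp [PiLp.inner_apply]
  rw [ContinuousLinearMap.toBilinForm_apply, ContinuousLinearMap.toBilinForm_apply,
    covarianceBilin_multivariateGaussian hS, covarianceBilin_apply_eq_cov h2]
  simp [covMatrix, this]

end GaussianDensity

/-! ### The Stein identity -/

section Stein

open Function

variable {n : ℕ} {μ : Measure (EuclideanSpace ℝ (Fin n))}

theorem hasTemperateGrowth_fderiv {E F : Type*} [NormedAddCommGroup E] [NormedSpace ℝ E]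
    [NormedAddCommGroup F] [NormedSpace ℝ F] {f : E → F} (hf : HasTemperateGrowth f) :
    HasTemperateGrowth (fderiv ℝ f) := by
  refine ⟨hf.1.fderiv_right (by simp), fun k => ?_⟩
  obtain ⟨j, C, h⟩ := hf.2 (k + 1)
  exact ⟨j, C, fun x => by rw [norm_iteratedFDeriv_fderiv]; exact h x⟩

theorem hasTemperateGrowth_partialDeriv {F : EuclideanSpace ℝ (Fin n) → ℝ}
    (hF : HasTemperateGrowth F) (i : Fin n) : HasTemperateGrowth (partialDeriv i F) :=
  (ContinuousLinearMap.apply ℝ ℝ (EuclideanSpace.single i (1 : ℝ))).hasTemperateGrowth.comp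
    (hasTemperateGrowth_fderiv hF)

theorem hasTemperateGrowth_coord (m : EuclideanSpace ℝ (Fin n)) (i : Fin n) :
    HasTemperateGrowth fun x : EuclideanSpace ℝ (Fin n) => (x - m) i := by
  have h : HasTemperateGrowth fun x : EuclideanSpace ℝ (Fin n) => x - m := by fun_prop
  exact (EuclideanSpace.proj (𝕜 := ℝ) i).hasTemperateGrowth.comp h

theorem hasFDerivAt_coord (m : EuclideanSpace ℝ (Fin n)) (i : Fin n)
    (x : EuclideanSpace ℝ (Fin n)) :
    HasFDerivAt (fun x : EuclideanSpace ℝ (Fin n) => (x - m) i)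
      (EuclideanSpace.proj (𝕜 := ℝ) i : EuclideanSpace ℝ (Fin n) →L[ℝ] ℝ) x :=
  ((EuclideanSpace.proj (𝕜 := ℝ) i : EuclideanSpace ℝ (Fin n) →L[ℝ] ℝ).hasFDerivAt).comp x
    ((hasFDerivAt_id x).sub_const m)

theorem fderiv_eq_sum_partialDeriv {F : EuclideanSpace ℝ (Fin n) → ℝ}
    (x v : EuclideanSpace ℝ (Fin n)) : fderiv ℝ F x v = ∑ i, v i * partialDeriv i F x := by
  conv_lhs => rw [← (EuclideanSpace.basisFun (Fin n) ℝ).sum_repr v]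
  simp [partialDeriv]

theorem partialDeriv_mul_coord {F : EuclideanSpace ℝ (Fin n) → ℝ} (hF : Differentiable ℝ F)
    (m : EuclideanSpace ℝ (Fin n)) (l j : Fin n) (x : EuclideanSpace ℝ (Fin n)) :
    partialDeriv l (fun x => F x * (x - m) j) x
      = partialDeriv l F x * (x - m) j + (1 : Matrix (Fin n) (Fin n) ℝ) l j * F x := by
  have h : HasFDerivAt (fun x => F x * (x - m) j) _ x :=
    (hF x).hasFDerivAt.mul (hasFDerivAt_coord m j x)
  rw [partialDeriv, h.fderiv]
  simp [partialDeriv, Matrix.one_apply, eq_comm]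
  ring

theorem memLp_of_hasTemperateGrowth [IsGaussian μ] {F : EuclideanSpace ℝ (Fin n) → ℝ}
    (hF : HasTemperateGrowth F) : MemLp F 2 μ := by
  obtain ⟨k, C, h⟩ := hF.2 0
  have h1 : MemLp (fun x : EuclideanSpace ℝ (Fin n) => ‖x‖ ^ k) 2 μ := by
    have h2 := (IsGaussian.memLp_id μ ((2 * k : ℕ) : ENNReal) (ENNReal.natCast_ne_top _)).norm
    rcases Nat.eq_zero_or_pos k with rfl | hk
    · simpa using memLp_const (1 : ℝ)
    · have h3 := h2.norm_rpow_div k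
      have e : ((2 * k : ℕ) : ENNReal) / (k : ENNReal) = 2 := by
        push_cast
        exact ENNReal.mul_div_cancel_right (by simpa using hk.ne') (by simp)
      rw [e] at h3
      simpa using h3
  have h4 : MemLp (fun x : EuclideanSpace ℝ (Fin n) => C * (2 ^ k * (1 + ‖x‖ ^ k))) 2 μ :=
    (((memLp_const (1 : ℝ)).add h1).const_mul _).const_mul _
  refine h4.mono hF.1.continuous.aestronglyMeasurable (ae_of_all _ fun x => ?_)
  have hC : 0 ≤ C := by
    have := (norm_nonneg _).trans (h 0)
    simpa using this
  refine le_trans ?_ (le_abs_self _)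
  have := h x
  rw [norm_iteratedFDeriv_zero] at this
  refine this.trans (mul_le_mul_of_nonneg_left ?_ hC)
  have h5 := add_pow_le zero_le_one (norm_nonneg x) k
  rw [one_pow] at h5
  refine h5.trans (mul_le_mul_of_nonneg_right ?_ (by positivity))
  exact pow_le_pow_right₀ (by norm_num) (by omega)

theorem integrable_of_hasTemperateGrowth [IsGaussian μ] {F : EuclideanSpace ℝ (Fin n) → ℝ}
    (hF : HasTemperateGrowth F) : Integrable F μ :=
  (memLp_of_hasTemperateGrowth hF).integrable (by norm_num)

theorem transpose_covMatrix : (covMatrix μ)ᵀ = covMatrix μ := by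
  ext i j
  simp [covMatrix, covariance_comm]

theorem hasFDerivAt_gaussian {c : ℝ} (m : EuclideanSpace ℝ (Fin n))
    {W : Matrix (Fin n) (Fin n) ℝ} (hW : Wᵀ = W) (x : EuclideanSpace ℝ (Fin n)) :
    ∃ D : EuclideanSpace ℝ (Fin n) →L[ℝ] ℝ,
      HasFDerivAt (fun x : EuclideanSpace ℝ (Fin n) =>
        c * Real.exp (-(1 / 2) * ((x - m).ofLp ⬝ᵥ W *ᵥ (x - m).ofLp))) D x ∧
      ∀ v, D v = -(c * Real.exp (-(1 / 2) * ((x - m).ofLp ⬝ᵥ W *ᵥ (x - m).ofLp)))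
        * ((x - m).ofLp ⬝ᵥ W *ᵥ v.ofLp) := by
  set B : EuclideanSpace ℝ (Fin n) →L[ℝ] EuclideanSpace ℝ (Fin n) :=
    Matrix.toEuclideanCLM (𝕜 := ℝ) W
  have h1 : HasFDerivAt (fun x : EuclideanSpace ℝ (Fin n) => x - m)
    (ContinuousLinearMap.id ℝ _) x := (hasFDerivAt_id x).sub_const m
  have h2 := h1.inner ℝ (B.hasFDerivAt.comp x h1)
  simp only [Function.comp_apply, B, Matrix.inner_toEuclideanCLM] at h2
  refine ⟨_, ((h2.const_mul (-(1 / 2))).exp).const_mul c, fun v => ?_⟩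
  have h3 : v.ofLp ⬝ᵥ W *ᵥ (x - m).ofLp = (x - m).ofLp ⬝ᵥ W *ᵥ v.ofLp := by
    rw [Matrix.dotProduct_mulVec, ← Matrix.mulVec_transpose, hW, dotProduct_comm]
  simp only [smul_apply, ContinuousLinearMap.comp_apply, fderivInnerCLM_apply,
    ContinuousLinearMap.prod_apply, ContinuousLinearMap.id_apply, Matrix.inner_toEuclideanCLM,
    smul_eq_mul, h3]
  ring

/-- Integration by parts against the Gaussian density. -/
theorem stein_identity [IsGaussian μ] (hS : (covMatrix μ).PosDef)
    {F : EuclideanSpace ℝ (Fin n) → ℝ} (hF : HasTemperateGrowth F) (i : Fin n) :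
    ∫ x, F x * (x - mean μ) i ∂μ = (covMatrix μ *ᵥ expGrad μ F) i := by
  obtain ⟨c, hc, hμ⟩ := multivariateGaussian_eq_withDensity (mean μ) hS
  rw [← eq_multivariateGaussian] at hμ
  set m := mean μ
  set S := covMatrix μ
  obtain ⟨d, hd⟩ : ∃ d : EuclideanSpace ℝ (Fin n) → ℝ, d = fun x =>
    c * Real.exp (-(1 / 2) * ((x - m).ofLp ⬝ᵥ S⁻¹ *ᵥ (x - m).ofLp)) := ⟨_, rfl⟩
  have hd0 : ∀ x, 0 ≤ d x := fun x => by rw [hd]; positivity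
  have hμ' : μ = volume.withDensity fun x => ENNReal.ofReal (d x) := by rw [hd]; exact hμ
  have hSu : IsUnit S.det := (Matrix.isUnit_iff_isUnit_det S).1 hS.isUnit
  have hW : (S⁻¹)ᵀ = S⁻¹ := by rw [Matrix.transpose_nonsing_inv, transpose_covMatrix]
  have hdd := fun x => hasFDerivAt_gaussian (c := c) m hW x
  rw [← hd] at hdd
  have hddiff : Differentiable ℝ d := fun x => (hdd x).choose_spec.1.differentiableAt
  have hdm : Measurable fun x => ENNReal.ofReal (d x) :=
    hddiff.continuous.measurable.ennreal_ofReal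
  have hint : ∀ {G : EuclideanSpace ℝ (Fin n) → ℝ}, ∫ x, G x ∂μ = ∫ x, G x * d x := by
    intro G
    conv_lhs => rw [hμ']
    rw [integral_withDensity_eq_integral_toReal_smul hdm (ae_of_all _ fun x => by simp)]
    refine integral_congr_ae (ae_of_all _ fun x => ?_)
    simp only [ENNReal.toReal_ofReal (hd0 x), smul_eq_mul, mul_comm]
  have hintg : ∀ {G : EuclideanSpace ℝ (Fin n) → ℝ}, Integrable G μ →
      Integrable fun x => G x * d x := by
    intro G hG
    rw [hμ', integrable_withDensity_iff_integrable_smul' hdm (ae_of_all _ fun x => by simp)] at hG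
    refine hG.congr (ae_of_all _ fun x => ?_)
    simp only [ENNReal.toReal_ofReal (hd0 x), smul_eq_mul, mul_comm]
  set v : EuclideanSpace ℝ (Fin n) := WithLp.toLp 2 (S *ᵥ Pi.single i 1)
  have hdv : ∀ x, fderiv ℝ d x v = -((x - m) i * d x) := fun x => by
    obtain ⟨D, hD, hDv⟩ := hdd x
    rw [hD.fderiv, hDv]
    have : (x - m).ofLp ⬝ᵥ S⁻¹ *ᵥ v.ofLp = (x - m) i := by
      simp only [v, Matrix.mulVec_mulVec, Matrix.nonsing_inv_mul _ hSu, Matrix.one_mulVec]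
      simp
    rw [this, hd]
    ring
  have hFi : Integrable F μ := integrable_of_hasTemperateGrowth hF
  have hFy : Integrable (fun x => F x * (x - m) i) μ :=
    integrable_of_hasTemperateGrowth (hF.mul (hasTemperateGrowth_coord m i))
  have hFp : ∀ l, Integrable (partialDeriv l F) μ := fun l =>
    integrable_of_hasTemperateGrowth (hasTemperateGrowth_partialDeriv hF l)
  have hFv : Integrable (fun x => fderiv ℝ F x v) μ := by
    simp_rw [fderiv_eq_sum_partialDeriv]
    exact integrable_finsetSum _ fun l _ => (hFp l).const_mul _
  have key := integral_mul_fderiv_eq_neg_fderiv_mul_of_integrable (μ := volume) (f := F) (g := d)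
    (v := v) (hintg hFv) ((hintg hFy).neg.congr (ae_of_all _ fun x => by
      simp only [Pi.neg_apply, hdv]; ring)) (hintg hFi)
    (fun x _ => hF.1.differentiable (by simp) x) (fun x _ => hddiff x)
  calc ∫ x, F x * (x - m) i ∂μ = -∫ x, F x * fderiv ℝ d x v := by
        rw [hint, ← integral_neg]
        refine integral_congr_ae (ae_of_all _ fun x => ?_)
        simp only [hdv]; ring
    _ = ∫ x, fderiv ℝ F x v ∂μ := by rw [key, neg_neg, hint]
    _ = _ := by
        simp_rw [fderiv_eq_sum_partialDeriv]
        rw [integral_finsetSum _ fun l _ => (hFp l).const_mul _]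
        simp only [integral_const_mul, Matrix.mulVec, dotProduct, expGrad]
        refine Finset.sum_congr rfl fun l _ => ?_
        have h1 : v l = S l i := by simp [v]
        have h2 : S l i = S i l := congrFun (congrFun (transpose_covMatrix (μ := μ)) i) l
        rw [h1, h2]

/-- The second order Stein identity. -/
theorem integral_mul_coord_mul_coord [IsGaussian μ] (hS : (covMatrix μ).PosDef)
    {F : EuclideanSpace ℝ (Fin n) → ℝ} (hF : HasTemperateGrowth F) (i j : Fin n) :
    ∫ x, F x * ((x - mean μ) i * (x - mean μ) j - covMatrix μ i j) ∂μ
      = (covMatrix μ * (expHess μ F)ᵀ * covMatrix μ) i j := by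
  set m := mean μ
  have hFi : Integrable F μ := integrable_of_hasTemperateGrowth hF
  have hFj : HasTemperateGrowth fun x => F x * (x - m) j := hF.mul (hasTemperateGrowth_coord m j)
  have hFij : Integrable (fun x => F x * (x - m) j * (x - m) i) μ :=
    integrable_of_hasTemperateGrowth (hFj.mul (hasTemperateGrowth_coord m i))
  have h1 : ∀ l, expGrad μ (fun x => F x * (x - m) j) l
      = (covMatrix μ *ᵥ expGrad μ (partialDeriv l F)) j
        + (1 : Matrix (Fin n) (Fin n) ℝ) l j * ∫ x, F x ∂μ := fun l => by
    simp only [expGrad, partialDeriv_mul_coord (hF.1.differentiable (by simp))]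
    have h2 : Integrable (fun x => partialDeriv l F x * (x - m) j) μ :=
      integrable_of_hasTemperateGrowth
        ((hasTemperateGrowth_partialDeriv hF l).mul (hasTemperateGrowth_coord m j))
    rw [integral_add h2 (hFi.const_mul _), integral_const_mul,
      stein_identity hS (hasTemperateGrowth_partialDeriv hF l)]
  calc _ = ∫ x, F x * (x - m) j * (x - m) i ∂μ - covMatrix μ i j * ∫ x, F x ∂μ := by
        rw [← integral_const_mul, ← integral_sub hFij (hFi.const_mul _)]
        refine integral_congr_ae (ae_of_all _ fun x => ?_)
        simp only
        ring
    _ = _ := by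
        rw [stein_identity hS hFj]
        have hT : ∀ k, covMatrix μ j k = covMatrix μ k j := fun k =>
          congrFun (congrFun (transpose_covMatrix (μ := μ)) k) j
        rw [Matrix.mulVec, dotProduct]
        simp only [h1, mul_add, Finset.sum_add_distrib]
        have h3 : ∑ l, covMatrix μ i l * ((1 : Matrix (Fin n) (Fin n) ℝ) l j * ∫ x, F x ∂μ)
            = covMatrix μ i j * ∫ x, F x ∂μ := by
          simp [Matrix.one_apply]
        rw [h3, add_sub_cancel_right]
        simp only [Matrix.mulVec, dotProduct, Matrix.mul_apply, Finset.sum_mul,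
          Finset.mul_sum, Matrix.transpose_apply, expHess, Matrix.of_apply, expGrad, hT]
        rw [Finset.sum_comm]
        refine Finset.sum_congr rfl fun k _ => Finset.sum_congr rfl fun l _ => by ring

theorem transpose_expHess {f : EuclideanSpace ℝ (Fin n) → ℝ} (hf : ContDiff ℝ ∞ f) :
    (expHess μ f)ᵀ = expHess μ f := by
  ext i j
  simp only [Matrix.transpose_apply, expHess, Matrix.of_apply]
  refine integral_congr_ae (ae_of_all _ fun x => ?_)
  have h : ∀ k l, partialDeriv k (partialDeriv l f) x
      = fderiv ℝ (fderiv ℝ f) x (EuclideanSpace.single k 1) (EuclideanSpace.single l 1) := by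
    intro k l
    have hd : DifferentiableAt ℝ (fderiv ℝ f) x :=
      (hf.fderiv_right (m := 1) (by norm_cast)).differentiable (by simp) x
    have : HasFDerivAt (partialDeriv l f) _ x :=
      (ContinuousLinearMap.apply ℝ ℝ (EuclideanSpace.single l (1 : ℝ))).hasFDerivAt.comp x
        hd.hasFDerivAt
    rw [partialDeriv, this.fderiv]
    rfl
  simp only [h]
  exact (hf.contDiffAt.isSymmSndFDerivAt (by simp; norm_cast)) _ _

end Stein

/-! ### The quadratic part of a function -/

section QuadraticPart

open Function

variable {n : ℕ} {μ : Measure (EuclideanSpace ℝ (Fin n))}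

/-- The centred quadratic polynomial with the same expected gradient and expected Hessian
as `f`. For a Gaussian `μ` it is the `L²` projection of `f - 𝔼 f` to the centred polynomials of
degree at most two. -/
def quadraticPart (μ : Measure (EuclideanSpace ℝ (Fin n))) (f : EuclideanSpace ℝ (Fin n) → ℝ)
    (x : EuclideanSpace ℝ (Fin n)) : ℝ :=
  ∑ i, expGrad μ f i * (x - mean μ) i
    + 1 / 2 * ∑ i, ∑ j, expHess μ f i j * ((x - mean μ) i * (x - mean μ) j - covMatrix μ i j)

theorem hasTemperateGrowth_sq_coord (m : EuclideanSpace ℝ (Fin n)) (i j : Fin n) (s : ℝ) :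
    HasTemperateGrowth fun x : EuclideanSpace ℝ (Fin n) => (x - m) i * (x - m) j - s :=
  ((hasTemperateGrowth_coord m i).mul (hasTemperateGrowth_coord m j)).sub (.const s)

theorem hasTemperateGrowth_quadraticPart (f : EuclideanSpace ℝ (Fin n) → ℝ) :
    HasTemperateGrowth (quadraticPart μ f) := by
  refine HasTemperateGrowth.add (.sum fun i _ => (HasTemperateGrowth.const _).mul
    (hasTemperateGrowth_coord _ i)) ((HasTemperateGrowth.const _).mul (.sum fun i _ =>
      .sum fun j _ => (HasTemperateGrowth.const _).mul (hasTemperateGrowth_sq_coord _ i j _)))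

theorem sum_mul_eq_trace {A B : Matrix (Fin n) (Fin n) ℝ} (hA : Aᵀ = A) :
    ∑ i, ∑ j, A i j * B i j = (A * B).trace := by
  rw [Finset.sum_comm]
  simp only [Matrix.trace, Matrix.diag, Matrix.mul_apply]
  refine Finset.sum_congr rfl fun j _ => Finset.sum_congr rfl fun i _ => ?_
  have : A i j = A j i := congrFun (congrFun hA j) i
  rw [this]

/-- The covariance of a function with the quadratic part of `f`, by the Stein identity. -/
theorem integral_mul_quadraticPart [IsGaussian μ] (hS : (covMatrix μ).PosDef)
    {f F : EuclideanSpace ℝ (Fin n) → ℝ} (hf : ContDiff ℝ ∞ f) (hF : HasTemperateGrowth F) :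
    ∫ x, F x * quadraticPart μ f x ∂μ = expGrad μ f ⬝ᵥ (covMatrix μ *ᵥ expGrad μ F)
      + 1 / 2 * (expHess μ f * (covMatrix μ * (expHess μ F)ᵀ * covMatrix μ)).trace := by
  set m := mean μ with hm
  have h1 : ∀ i, Integrable (fun x => expGrad μ f i * (F x * (x - m) i)) μ := fun i =>
    (integrable_of_hasTemperateGrowth (hF.mul (hasTemperateGrowth_coord m i))).const_mul _
  have h2 : ∀ i j, Integrable (fun x => expHess μ f i j
      * (F x * ((x - m) i * (x - m) j - covMatrix μ i j))) μ := fun i j =>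
    (integrable_of_hasTemperateGrowth (hF.mul (hasTemperateGrowth_sq_coord m i j _))).const_mul _
  have e : ∀ x, F x * quadraticPart μ f x = ∑ i, expGrad μ f i * (F x * (x - m) i)
      + 1 / 2 * ∑ i, ∑ j, expHess μ f i j
        * (F x * ((x - m) i * (x - m) j - covMatrix μ i j)) := fun x => by
    rw [quadraticPart, mul_add, Finset.mul_sum, mul_left_comm, Finset.mul_sum]
    simp only [Finset.mul_sum (s := Finset.univ) (f := fun j => expHess μ f _ j * _), ← hm]
    congr 1
    · exact Finset.sum_congr rfl fun i _ => by ring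
    · congr 1
      exact Finset.sum_congr rfl fun i _ => Finset.sum_congr rfl fun j _ => by ring
  simp_rw [e]
  rw [integral_add (integrable_finsetSum _ fun i _ => h1 i)
    ((integrable_finsetSum _ fun i _ => integrable_finsetSum _ fun j _ => h2 i j).const_mul _),
    integral_const_mul, integral_finsetSum _ fun i _ => h1 i,
    integral_finsetSum _ fun i _ => integrable_finsetSum _ fun j _ => h2 i j]
  congr 1
  · simp only [integral_const_mul, hm, stein_identity hS hF, dotProduct]
  · rw [← sum_mul_eq_trace (transpose_expHess hf)]
    congr 1
    refine Finset.sum_congr rfl fun i _ => ?_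
    rw [integral_finsetSum _ fun j _ => h2 i j]
    simp only [integral_const_mul, hm, integral_mul_coord_mul_coord hS hF]

theorem expGrad_const (c : ℝ) : expGrad μ (fun _ => c) = 0 := by
  ext i
  simp [expGrad, partialDeriv]

theorem expHess_const (c : ℝ) : expHess μ (fun _ => c) = 0 := by
  ext i j
  have : ∀ (c : ℝ) (j : Fin n),
      partialDeriv j (fun _ : EuclideanSpace ℝ (Fin n) => c) = fun _ => 0 :=
    fun c j => by ext x; simp [partialDeriv]
  simp only [expHess, Matrix.of_apply, this, integral_zero, Matrix.zero_apply]

theorem integral_quadraticPart [IsGaussian μ] (hS : (covMatrix μ).PosDef)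
    {f : EuclideanSpace ℝ (Fin n) → ℝ} (hf : ContDiff ℝ ∞ f) :
    ∫ x, quadraticPart μ f x ∂μ = 0 := by
  have h := integral_mul_quadraticPart hS hf (F := fun _ => 1) (.const 1)
  simpa [expGrad_const, expHess_const] using h

theorem partialDeriv_quadraticPart {f : EuclideanSpace ℝ (Fin n) → ℝ} (hf : ContDiff ℝ ∞ f)
    (l : Fin n) : partialDeriv l (quadraticPart μ f)
      = fun x => expGrad μ f l + ∑ j, expHess μ f l j * (x - mean μ) j := by
  ext1 x
  have hH : ∀ i, expHess μ f i l = expHess μ f l i := fun i =>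
    congrFun (congrFun (transpose_expHess (μ := μ) hf) l) i
  have h1 := HasFDerivAt.fun_sum (u := Finset.univ) fun i _ =>
    (hasFDerivAt_coord (mean μ) i x).const_mul (expGrad μ f i)
  have h2 := HasFDerivAt.fun_sum (u := Finset.univ) fun i _ =>
    HasFDerivAt.fun_sum (u := Finset.univ) fun j _ => (((hasFDerivAt_coord (mean μ) i x).fun_mul
      (hasFDerivAt_coord (mean μ) j x)).sub_const (covMatrix μ i j)).const_mul (expHess μ f i j)
  have h3 : HasFDerivAt (quadraticPart μ f) _ x := h1.fun_add (h2.const_mul (1 / 2))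
  rw [partialDeriv, h3.fderiv]
  have e : ∀ j : Fin n, (EuclideanSpace.proj (𝕜 := ℝ) j : EuclideanSpace ℝ (Fin n) →L[ℝ] ℝ)
      (EuclideanSpace.single l 1) = if j = l then 1 else 0 := fun j => by
    simp
  simp only [add_apply, sum_apply, smul_apply, e, smul_eq_mul,
    mul_ite, mul_one, mul_zero, mul_add, Finset.sum_add_distrib,
    Finset.sum_ite_eq', Finset.mem_univ, if_true]
  rw [Finset.sum_comm (γ := Fin n) (f := fun i j => if i = l then _ else 0)]
  simp only [Finset.sum_ite_eq', Finset.mem_univ, if_true, hH]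
  ring

theorem expGrad_quadraticPart [IsGaussian μ] (hS : (covMatrix μ).PosDef)
    {f : EuclideanSpace ℝ (Fin n) → ℝ} (hf : ContDiff ℝ ∞ f) :
    expGrad μ (quadraticPart μ f) = expGrad μ f := by
  ext l
  have h1 : ∀ j, ∫ x, (x - mean μ) j ∂μ = 0 := fun j => by
    have := stein_identity hS (F := fun _ => 1) (.const 1) j
    simpa [expGrad_const] using this
  have h2 : ∀ j, Integrable (fun x => expHess μ f l j * (x - mean μ) j) μ := fun j =>
    (integrable_of_hasTemperateGrowth (hasTemperateGrowth_coord _ j)).const_mul _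
  rw [expGrad, partialDeriv_quadraticPart hf, integral_add (integrable_const _)
    (integrable_finsetSum _ fun j _ => h2 j), integral_finsetSum _ fun j _ => h2 j]
  simp only [integral_const_mul, h1, integral_const, probReal_univ, one_smul, mul_zero,
    Finset.sum_const_zero, add_zero]

theorem expHess_quadraticPart [IsProbabilityMeasure μ] {f : EuclideanSpace ℝ (Fin n) → ℝ}
    (hf : ContDiff ℝ ∞ f) : expHess μ (quadraticPart μ f) = expHess μ f := by
  ext k l
  have hH : expHess μ f l k = expHess μ f k l :=
    congrFun (congrFun (transpose_expHess (μ := μ) hf) k) l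
  rw [expHess, Matrix.of_apply, partialDeriv_quadraticPart hf]
  have h : ∀ x, partialDeriv k (fun x => expGrad μ f l
      + ∑ j, expHess μ f l j * (x - mean μ) j) x = expHess μ f k l := fun x => by
    have h1 : HasFDerivAt (fun x : EuclideanSpace ℝ (Fin n) => expGrad μ f l
      + ∑ j, expHess μ f l j * (x - mean μ) j) _ x :=
      (HasFDerivAt.fun_sum (u := Finset.univ) fun j _ =>
        (hasFDerivAt_coord (mean μ) j x).const_mul (expHess μ f l j)).const_add _
    rw [partialDeriv, h1.fderiv]
    simp [hH]
  simp only [h, integral_const, probReal_univ, one_smul]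

theorem trace_expHess_mul {f : EuclideanSpace ℝ (Fin n) → ℝ} (hf : ContDiff ℝ ∞ f) :
    (expHess μ f * (covMatrix μ * (expHess μ f)ᵀ * covMatrix μ)).trace
      = ((covMatrix μ * expHess μ f) ^ 2).trace := by
  rw [transpose_expHess hf, sq, ← Matrix.mul_assoc, Matrix.trace_mul_comm, Matrix.mul_assoc]

theorem variance_quadraticPart [IsGaussian μ] (hS : (covMatrix μ).PosDef)
    {f : EuclideanSpace ℝ (Fin n) → ℝ} (hf : ContDiff ℝ ∞ f) :
    Var[quadraticPart μ f; μ] = expGrad μ f ⬝ᵥ (covMatrix μ *ᵥ expGrad μ f)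
      + 1 / 2 * ((covMatrix μ * expHess μ f) ^ 2).trace := by
  have hq := hasTemperateGrowth_quadraticPart (μ := μ) f
  have hq2 := memLp_of_hasTemperateGrowth (μ := μ) hq
  rw [← covariance_self hq2.aemeasurable, covariance_eq_sub hq2 hq2,
    integral_quadraticPart hS hf, mul_zero, sub_zero]
  simp only [Pi.mul_apply]
  rw [integral_mul_quadraticPart hS hf hq, expGrad_quadraticPart hS hf,
    expHess_quadraticPart hf, trace_expHess_mul hf]

/-- Subtracting its quadratic part removes exactly the variance that `f` shares with the
polynomials of degree at most two. -/
theorem variance_sub_quadraticPart [IsGaussian μ] (hS : (covMatrix μ).PosDef)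
    {f : EuclideanSpace ℝ (Fin n) → ℝ} (hf : HasTemperateGrowth f) :
    Var[fun x => f x - quadraticPart μ f x; μ] = Var[f; μ]
      - expGrad μ f ⬝ᵥ (covMatrix μ *ᵥ expGrad μ f)
      - 1 / 2 * ((covMatrix μ * expHess μ f) ^ 2).trace := by
  have hf2 := memLp_of_hasTemperateGrowth (μ := μ) hf
  have hq2 := memLp_of_hasTemperateGrowth (μ := μ) (hasTemperateGrowth_quadraticPart (μ := μ) f)
  have h1 : cov[f, quadraticPart μ f; μ] = Var[quadraticPart μ f; μ] := by
    rw [covariance_eq_sub hf2 hq2, integral_quadraticPart hS hf.1, mul_zero, sub_zero]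
    simp only [Pi.mul_apply]
    rw [integral_mul_quadraticPart hS hf.1 hf, trace_expHess_mul hf.1,
      variance_quadraticPart hS hf.1]
  rw [variance_fun_sub hf2 hq2, h1, variance_quadraticPart hS hf.1]
  ring

/-- The influence functional of the moment matching estimator at a Gaussian measure, evaluated at
the centred statistic of a sample point, is minus the quadratic part of `f`. -/
theorem influence_eq_neg_quadraticPart [IsGaussian μ] (hS : (covMatrix μ).PosDef)
    {f : EuclideanSpace ℝ (Fin n) → ℝ} (hf : HasTemperateGrowth f)
    {K : Matrix (Fin n) (Fin n) ℝ} (y : EuclideanSpace ℝ (Fin n))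
    (hK : K * CFC.sqrt (covMatrix μ) + CFC.sqrt (covMatrix μ) * K
      = (stat (mean μ) y - (0, covMatrix μ)).2) :
    ∫ x, fderiv ℝ f x (Matrix.toEuclideanCLM (𝕜 := ℝ) (K * (CFC.sqrt (covMatrix μ))⁻¹)
      (x - mean μ) + (stat (mean μ) y - (0, covMatrix μ)).1) ∂μ = quadraticPart μ f y := by
  set m := mean μ with hm
  set S := covMatrix μ with hSdef
  set P := CFC.sqrt S with hPdef
  set H := expHess μ f with hHdef
  have hP : P.PosDef := posDef_sqrt hS
  have hPP : P * P = S := CFC.sqrt_mul_sqrt_self _ hS.posSemidef.nonneg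
  have hPu : IsUnit P.det := (Matrix.isUnit_iff_isUnit_det P).1 hP.isUnit
  have hPt : Pᵀ = P := by
    rw [← Matrix.conjTranspose_eq_transpose_of_trivial]; exact hP.isHermitian.eq
  have hHt : Hᵀ = H := transpose_expHess hf.1
  have hSt : Sᵀ = S := transpose_covMatrix
  set T := (stat m y - (0, S)).2 with hT
  have hTe : T = Matrix.vecMulVec (y - m).ofLp (y - m).ofLp - S := rfl
  have hTt : Tᵀ = T := by rw [hTe, Matrix.transpose_sub, Matrix.transpose_vecMulVec, hSt]
  have hb : (stat m y - (0, S)).1 = y - m := by simp [stat]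
  -- the solution of the Sylvester equation is symmetric
  have hKt : Kᵀ = K := by
    have h1 := congrArg Matrix.transpose hK
    rw [Matrix.transpose_add, Matrix.transpose_mul, Matrix.transpose_mul, hPt, hTt, ← hK] at h1
    have h2 := sylvester_injective hP (H := Kᵀ - K) (by
      rw [mul_sub, sub_mul, sub_add_sub_comm, h1, add_comm, sub_self])
    exact sub_eq_zero.1 h2
  set L := K * P⁻¹
  have hfi : ∀ i, HasTemperateGrowth (partialDeriv i f) := hasTemperateGrowth_partialDeriv hf
  have hi1 : ∀ i j, Integrable (fun x => L i j * (partialDeriv i f x * (x - m) j)) μ := fun i j =>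
    (integrable_of_hasTemperateGrowth ((hfi i).mul (hasTemperateGrowth_coord m j))).const_mul _
  have hi2 : ∀ i, Integrable (fun x => (y - m) i * partialDeriv i f x) μ := fun i =>
    (integrable_of_hasTemperateGrowth (hfi i)).const_mul _
  have e : ∀ x, fderiv ℝ f x (Matrix.toEuclideanCLM (𝕜 := ℝ) L (x - m) + (y - m))
      = ∑ i, ∑ j, L i j * (partialDeriv i f x * (x - m) j)
        + ∑ i, (y - m) i * partialDeriv i f x := fun x => by
    rw [map_add, fderiv_eq_sum_partialDeriv, fderiv_eq_sum_partialDeriv (v := y - m)]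
    congr 1
    refine Finset.sum_congr rfl fun i _ => ?_
    rw [Matrix.ofLp_toEuclideanCLM, Matrix.mulVec, dotProduct, Finset.sum_mul]
    exact Finset.sum_congr rfl fun j _ => by ring
  rw [hb]
  simp_rw [e]
  rw [integral_add (integrable_finsetSum _ fun i _ => integrable_finsetSum _ fun j _ => hi1 i j)
    (integrable_finsetSum _ fun i _ => hi2 i), integral_finsetSum _ fun i _ => hi2 i,
    integral_finsetSum _ fun i _ => integrable_finsetSum _ fun j _ => hi1 i j]
  have h3 : ∀ i, ∫ x, ∑ j, L i j * (partialDeriv i f x * (x - m) j) ∂μ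
      = ∑ j, L i j * (S * H) j i := fun i => by
    rw [integral_finsetSum _ fun j _ => hi1 i j]
    refine Finset.sum_congr rfl fun j _ => ?_
    rw [integral_const_mul, hm, stein_identity hS (hfi i) j]
    rfl
  simp only [h3, integral_const_mul]
  have h4 : ∑ i, ∑ j, L i j * (S * H) j i = (K * P * H).trace := by
    have : K * P * H = L * (S * H) := by
      rw [← hPP]
      simp only [L, Matrix.mul_assoc, Matrix.nonsing_inv_mul_cancel_left _ _ hPu]
    rw [this]
    simp [Matrix.trace, Matrix.mul_apply]
  have h5 : (P * K * H).trace = (K * P * H).trace := by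
    rw [← Matrix.trace_transpose, Matrix.transpose_mul, Matrix.transpose_mul, hKt, hPt, hHt,
      Matrix.trace_mul_comm]
  have h6 : (H * T).trace = 2 * (K * P * H).trace := by
    rw [Matrix.trace_mul_comm, ← hK, Matrix.add_mul, Matrix.trace_add, h5]; ring
  rw [h4, quadraticPart, ← hm, ← hSdef, ← hHdef]
  have h7 : ∑ i, ∑ j, H i j * ((y - m) i * (y - m) j - S i j) = (H * T).trace := by
    rw [← sum_mul_eq_trace hHt]; rfl
  rw [h7, h6, add_comm]
  congr 1
  · exact Finset.sum_congr rfl fun i _ => by rw [mul_comm]; rfl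
  · ring

end QuadraticPart

/-! ### Universal moment matching for normal distributions -/

section Normal

open scoped Matrix.Norms.L2Operator
open Function

variable {n : ℕ} {μ : Measure (EuclideanSpace ℝ (Fin n))}

theorem continuous_gaussian (c : ℝ) (m : EuclideanSpace ℝ (Fin n))
    {W : Matrix (Fin n) (Fin n) ℝ} (hW : Wᵀ = W) :
    Continuous fun x : EuclideanSpace ℝ (Fin n) =>
      c * Real.exp (-(1 / 2) * ((x - m).ofLp ⬝ᵥ W *ᵥ (x - m).ofLp)) :=
  continuous_iff_continuousAt.2 fun x => by
    obtain ⟨D, hD, -⟩ := hasFDerivAt_gaussian (c := c) m hW x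
    exact hD.continuousAt

theorem absolutelyContinuous_of_isGaussian [IsGaussian μ] (hS : (covMatrix μ).PosDef) :
    volume ≪ μ := by
  obtain ⟨c, hc, hμ⟩ := multivariateGaussian_eq_withDensity (mean μ) hS
  rw [← eq_multivariateGaussian] at hμ
  rw [hμ]
  refine withDensity_absolutelyContinuous' ?_ (ae_of_all _ fun x => ?_)
  · exact (ENNReal.continuous_ofReal.comp (continuous_gaussian c (mean μ)
      (by rw [Matrix.transpose_nonsing_inv, transpose_covMatrix]))).aemeasurable
  · have : 0 < c * Real.exp (-(1 / 2) * ((x - mean μ).ofLp ⬝ᵥ (covMatrix μ)⁻¹ *ᵥ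
      (x - mean μ).ofLp)) := by positivity
    simpa using this

theorem exists_isDensity [IsGaussian μ] (hS : (covMatrix μ).PosDef) : ∃ p, IsDensity μ p := by
  obtain ⟨c, hc, hμ⟩ := multivariateGaussian_eq_withDensity (mean μ) hS
  rw [← eq_multivariateGaussian] at hμ
  exact ⟨_, (continuous_gaussian c (mean μ) (by
    rw [Matrix.transpose_nonsing_inv, transpose_covMatrix])).measurable,
    fun x => by positivity, hμ⟩

theorem eq_zero_of_quadratic_eq_zero {α β γ T : ℝ}
    (h : ∀ t, T ≤ t → α * t + β * t ^ 2 + γ = 0) : α = 0 ∧ β = 0 ∧ γ = 0 := by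
  have h0 := h T le_rfl
  have h1 := h (T + 1) (by linarith)
  have h2 := h (T + 2) (by linarith)
  have hβ : β = 0 := by linear_combination (h2 - 2 * h1 + h0) / 2
  subst hβ
  have hα : α = 0 := by linear_combination h1 - h0
  subst hα
  exact ⟨rfl, rfl, by linear_combination h0⟩

/-- A quadratic polynomial with compact support on `ℝⁿ` is constant: it vanishes if `n ≥ 1`. -/
theorem eq_const_of_eq_quadraticPart_add_const {f : EuclideanSpace ℝ (Fin n) → ℝ}
    (hc : HasCompactSupport f) {C : ℝ} (h : ∀ x, f x = quadraticPart μ f x + C) :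
    ∀ x, f x = f (mean μ) := by
  intro x
  by_cases hx : x = mean μ
  · rw [hx]
  set v := x - mean μ with hv
  have hv0 : 0 < ‖v‖ := norm_pos_iff.2 (sub_ne_zero.2 hx)
  set α := ∑ i, expGrad μ f i * v i
  set β := 1 / 2 * ∑ i, ∑ j, expHess μ f i j * (v i * v j) with hβ
  set γ := C - 1 / 2 * ∑ i, ∑ j, expHess μ f i j * covMatrix μ i j
  have hline : ∀ t : ℝ, f (mean μ + t • v) = α * t + β * t ^ 2 + γ := fun t => by
    have h1 : ∑ i, expGrad μ f i * (t • v) i = α * t := by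
      rw [Finset.sum_mul]
      exact Finset.sum_congr rfl fun i _ => by rw [PiLp.smul_apply, smul_eq_mul]; ring
    have h2 : 1 / 2 * ∑ i, ∑ j, expHess μ f i j * ((t • v) i * (t • v) j - covMatrix μ i j)
        = β * t ^ 2 + (γ - C) := by
      simp only [β, γ, mul_sub, Finset.sum_sub_distrib]
      rw [mul_assoc (1 / 2 : ℝ), Finset.sum_mul]
      simp only [Finset.sum_mul, PiLp.smul_apply, smul_eq_mul]
      have : ∀ i j, expHess μ f i j * (v i * v j) * t ^ 2
          = expHess μ f i j * (t * v i * (t * v j)) := fun i j => by ring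
      simp only [this]
      ring
    rw [h, quadraticPart, add_sub_cancel_left, h1, h2]
    ring
  obtain ⟨R, hR⟩ := hc.isCompact.isBounded.exists_norm_le
  have hzero : ∀ t, (R + ‖mean μ‖ + 1) / ‖v‖ ≤ t → α * t + β * t ^ 2 + γ = 0 := fun t ht => by
    rw [← hline]
    by_contra hne
    have h1 := hR _ (subset_tsupport f hne)
    have h2 : R + ‖mean μ‖ + 1 ≤ t * ‖v‖ := (div_le_iff₀ hv0).1 ht
    have h3 : t * ‖v‖ ≤ ‖t • v‖ := by
      rw [norm_smul]; exact mul_le_mul_of_nonneg_right (le_abs_self t) hv0.le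
    have h4 : ‖t • v‖ ≤ ‖mean μ + t • v‖ + ‖mean μ‖ := by
      calc ‖t • v‖ = ‖mean μ + t • v - mean μ‖ := by rw [add_sub_cancel_left]
        _ ≤ _ := norm_sub_le _ _
    linarith
  obtain ⟨h1, h2, h3⟩ := eq_zero_of_quadratic_eq_zero hzero
  have hx1 := hline 1
  have hx0 := hline 0
  rw [h1, h2, h3] at hx0 hx1
  simp only [one_smul, zero_smul, add_zero, hv, add_sub_cancel] at hx0 hx1
  rw [hx0, hx1]; ring

theorem eq_const_of_variance_eq_zero [IsGaussian μ] (hS : (covMatrix μ).PosDef)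
    {g : EuclideanSpace ℝ (Fin n) → ℝ} (hg : HasTemperateGrowth g) (h : Var[g; μ] = 0) :
    ∀ x, g x = ∫ y, g y ∂μ := by
  have hg2 := memLp_of_hasTemperateGrowth (μ := μ) hg
  have h1 : g =ᵐ[μ] fun _ => ∫ y, g y ∂μ := by
    rw [variance_eq_integral hg2.aemeasurable] at h
    have h2 := (integral_eq_zero_iff_of_nonneg (fun x => sq_nonneg _)
      (hg2.sub (memLp_const _)).integrable_sq).1 h
    filter_upwards [h2] with x hx
    have : (g x - ∫ y, g y ∂μ) ^ 2 = 0 := hx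
    exact sub_eq_zero.1 (pow_eq_zero_iff two_ne_zero |>.1 this)
  have h3 := (absolutelyContinuous_of_isGaussian hS).ae_eq h1
  exact fun x => congrFun ((hg.1.continuous.ae_eq_iff_eq _ continuous_const).1 h3) x

theorem variance_matchedEstimator_const {f : EuclideanSpace ℝ (Fin n) → ℝ} [IsProbabilityMeasure μ]
    {c : ℝ} (h : ∀ x, f x = c) (N : ℕ) : Var[matchedEstimator μ f; sampleLaw μ N] = 0 := by
  have : matchedEstimator (N := N) μ f = fun _ => (N : ℝ)⁻¹ * (N * c) := by
    ext x
    simp [matchedEstimator, h]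
  have hP : IsProbabilityMeasure (sampleLaw μ N) := by unfold sampleLaw; infer_instance
  rw [this, variance_eq_integral aemeasurable_const]
  simp

/-- The variance of the matched estimator of a normal distribution is asymptotically that of the
empirical mean of `f` minus its quadratic part. -/
theorem exists_variance_matchedEstimator_eq [IsGaussian μ] (hS : (covMatrix μ).PosDef)
    {f : EuclideanSpace ℝ (Fin n) → ℝ} (hf : ContDiff ℝ ∞ f) (hc : HasCompactSupport f) :
    ∃ A : ℕ → ℝ, ((fun N : ℕ => A N - 1) =O[atTop] fun N : ℕ => (N : ℝ) ^ (-(1 / 2) : ℝ)) ∧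
      ∀ N : ℕ, n < N → Var[matchedEstimator μ f; sampleLaw μ N]
        = A N / N * Var[fun x => f x - quadraticPart μ f x; μ] := by
  have hft := hc.hasTemperateGrowth hf
  obtain ⟨ℓ, hℓ⟩ := exists_influence (IsGaussian.memLp_two_id (μ := μ)) hS
  obtain ⟨hℓ1, hℓ2, -⟩ := hℓ f hf hc
  obtain ⟨C, hC⟩ := hℓ2 (IsGaussian.memLp_id μ 8 (by simp))
  have hg : (fun y => f y + ℓ f (stat (mean μ) y - (0, covMatrix μ)))
      = fun y => f y - quadraticPart μ f y := by
    ext1 y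
    obtain ⟨K, hK, h⟩ := hℓ1 (stat (mean μ) y - (0, covMatrix μ)).1
      (stat (mean μ) y - (0, covMatrix μ)).2
    rw [influence_eq_neg_quadraticPart hS hft y hK, Prod.mk.eta] at h
    rw [h, sub_eq_add_neg]
  rw [hg] at hC
  set b := Var[fun y => f y - quadraticPart μ f y; μ] with hb
  by_cases hb0 : b = 0
  -- if the limit variance vanishes, then `f` is constant, and so is the estimator
  · refine ⟨fun _ => 1, by simp [isBigO_zero], fun N _ => ?_⟩
    have h1 := eq_const_of_variance_eq_zero hS
      (hft.sub (hasTemperateGrowth_quadraticPart (μ := μ) f)) hb0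
    have h2 := eq_const_of_eq_quadraticPart_add_const (μ := μ) hc
      fun x => sub_eq_iff_eq_add'.1 (h1 x)
    rw [variance_matchedEstimator_const h2, hb0, mul_zero]
  · refine ⟨fun N => N * Var[matchedEstimator μ f; sampleLaw μ N] / b, ?_, fun N hN => ?_⟩
    · refine IsBigO.of_bound (C / |b|) ?_
      filter_upwards [eventually_gt_atTop 0] with N hN
      rw [show N * Var[matchedEstimator μ f; sampleLaw μ N] / b - 1
        = (N * Var[matchedEstimator μ f; sampleLaw μ N] - b) / b by field_simp, norm_div,
        Real.norm_eq_abs, Real.norm_eq_abs, Real.norm_eq_abs, abs_of_nonneg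
        (by positivity : (0 : ℝ) ≤ (N : ℝ) ^ (-(1 / 2) : ℝ)), div_mul_eq_mul_div]
      gcongr
      exact hC N hN
    · have : (N : ℝ) ≠ 0 := by exact_mod_cast (by omega : N ≠ 0)
      field_simp

theorem variance_plainEstimator [IsProbabilityMeasure μ] {f : EuclideanSpace ℝ (Fin n) → ℝ}
    (hf : MemLp f 2 μ) (N : ℕ) : Var[plainEstimator f; sampleLaw μ N] = Var[f; μ] / N :=
  variance_empMean hf

theorem secondOrderUniversal_of_isGaussian [IsGaussian μ] (hS : (covMatrix μ).PosDef)
    (p : EuclideanSpace ℝ (Fin n) → ℝ) : SecondOrderUniversal μ p := by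
  intro f hf hc _
  obtain ⟨A, hA, h⟩ := exists_variance_matchedEstimator_eq hS hf hc
  have hft := hc.hasTemperateGrowth hf
  -- the absolute value makes the bound monotone in the variance also where `A N` is negative
  refine ⟨fun N => |A N|, ?_, fun N hN => ?_⟩
  · have h0 : Tendsto (fun N : ℕ => (N : ℝ) ^ (-(1 / 2) : ℝ)) atTop (𝓝 0) :=
      (tendsto_rpow_neg_atTop (by norm_num)).comp tendsto_natCast_atTop_atTop
    have h1 := ((hA.trans_tendsto h0).add_const 1).abs
    simpa using h1
  · have h1 : Var[fun x => f x - quadraticPart μ f x; μ] ≤ Var[f; μ] := by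
      have := variance_nonneg (quadraticPart μ f) μ
      rw [variance_quadraticPart hS hf] at this
      rw [variance_sub_quadraticPart hS hft]
      linarith
    rw [h N hN, variance_plainEstimator (memLp_of_hasTemperateGrowth hft), div_mul_eq_mul_div,
      mul_div_assoc']
    have h2 := variance_nonneg (fun x => f x - quadraticPart μ f x) μ
    gcongr
    exact le_abs_self _

end Normal

/-! ### Test functions orthogonal to the polynomials of degree two -/

section Orthogonal

open scoped Matrix.Norms.L2Operator

attribute [local instance] matrixMeasurableSpace matrixBorelSpace

variable {n : ℕ} {μ : Measure (EuclideanSpace ℝ (Fin n))} {p : EuclideanSpace ℝ (Fin n) → ℝ}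

/-- If a linear function of first and second moments is constant on a ball, then its part of
first order vanishes. -/
theorem clm_fst_eq_zero_of_const_on_ball
    (L : (EuclideanSpace ℝ (Fin n) × Matrix (Fin n) (Fin n) ℝ) →L[ℝ] ℝ)
    {m x₀ : EuclideanSpace ℝ (Fin n)} {r c : ℝ} (hr : 0 < r)
    (h : ∀ x ∈ Metric.ball x₀ r, L (stat m x) = c) (u : EuclideanSpace ℝ (Fin n)) :
    L (u, 0) = 0 := by
  set y := x₀ - m with hy
  set V : EuclideanSpace ℝ (Fin n) → EuclideanSpace ℝ (Fin n) → Matrix (Fin n) (Fin n) ℝ :=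
    fun a b => Matrix.vecMulVec a.ofLp b.ofLp with hV
  -- the increments of first and second order
  have hsplit : ∀ u, L (stat m (x₀ + u)) = L (y, V y y) + L (u, V y u + V u y) + L (0, V u u) := by
    intro u
    rw [← map_add, ← map_add]
    congr 1
    have e : x₀ + u - m = y + u := by rw [hy]; abel
    simp only [stat, e, Prod.mk_add_mk, add_zero, hV, WithLp.ofLp_add, Matrix.add_vecMulVec,
      Matrix.vecMulVec_add]
    congr 1
    abel
  have h0 : L (y, V y y) = c := by
    have := h x₀ (Metric.mem_ball_self hr)
    rwa [← add_zero x₀, hsplit, show V y 0 + V 0 y = 0 by simp [hV], show V 0 0 = 0 by simp [hV],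
      ← Prod.zero_eq_mk, map_zero, add_zero, add_zero] at this
  have hsmall : ∀ u : EuclideanSpace ℝ (Fin n), ‖u‖ < r →
      L (u, V y u + V u y) = 0 ∧ L (0, V u u) = 0 := by
    intro u hu
    have h1 := h (x₀ + u) (by simpa using hu)
    have h2 := h (x₀ + -u) (by simpa using hu)
    rw [hsplit, h0] at h1 h2
    have e1 : L (-u, V y (-u) + V (-u) y) = -L (u, V y u + V u y) := by
      rw [← map_neg]
      congr 1
      simp only [hV, WithLp.ofLp_neg, Matrix.vecMulVec_neg, Matrix.neg_vecMulVec, Prod.neg_mk,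
        neg_add]
    have e2 : V (-u) (-u) = V u u := by
      simp only [hV, WithLp.ofLp_neg, Matrix.vecMulVec_neg, Matrix.neg_vecMulVec, neg_neg]
    rw [e1, e2] at h2
    constructor <;> linarith
  have hall : ∀ u : EuclideanSpace ℝ (Fin n),
      L (u, V y u + V u y) = 0 ∧ L (0, V u u) = 0 := by
    intro u
    set t := r / (‖u‖ + 1) with ht
    have ht0 : 0 < t := by positivity
    have h1 := hsmall (t • u) (by
      rw [norm_smul, Real.norm_of_nonneg ht0.le, ht, div_mul_eq_mul_div,
        div_lt_iff₀ (by positivity)]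
      nlinarith [norm_nonneg u])
    have e1 : ((t • u, V y (t • u) + V (t • u) y) :
        EuclideanSpace ℝ (Fin n) × Matrix (Fin n) (Fin n) ℝ) = t • (u, V y u + V u y) := by
      simp only [hV, WithLp.ofLp_smul, Matrix.vecMulVec_smul, Matrix.smul_vecMulVec, Prod.smul_mk,
        smul_add]
    have e2 : ((0, V (t • u) (t • u)) :
        EuclideanSpace ℝ (Fin n) × Matrix (Fin n) (Fin n) ℝ) = (t * t) • (0, V u u) := by
      simp only [hV, WithLp.ofLp_smul, Matrix.vecMulVec_smul, Matrix.smul_vecMulVec, Prod.smul_mk,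
        smul_zero, smul_smul]
    rw [e1, e2, map_smul, map_smul, smul_eq_mul, smul_eq_mul] at h1
    exact ⟨(mul_eq_zero.1 h1.1).resolve_left ht0.ne',
      (mul_eq_zero.1 h1.2).resolve_left (by positivity)⟩
  have h3 : L (0, V y u + V u y) = 0 := by
    have e : ((0, V y u + V u y) : EuclideanSpace ℝ (Fin n) × Matrix (Fin n) (Fin n) ℝ)
        = (0, V (y + u) (y + u)) - (0, V y y) - (0, V u u) := by
      simp only [hV, WithLp.ofLp_add, Matrix.add_vecMulVec, Matrix.vecMulVec_add, Prod.mk_sub_mk,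
        sub_zero]
      congr 1
      abel
    rw [e, map_sub, map_sub, (hall _).2, (hall _).2, (hall _).2]
    simp
  have h4 := (hall u).1
  have e : ((u, V y u + V u y) : EuclideanSpace ℝ (Fin n) × Matrix (Fin n) (Fin n) ℝ)
      = (u, 0) + (0, V y u + V u y) := by simp
  rw [e, map_add, h3, add_zero] at h4
  exact h4

/-- The case of equality in the correlation bound: for a test function `f` with variance `v` and a
correction `k`, with `κ = 𝔼[f k]` and `D = 𝔼[k²]`, the bound tested against `f + k` forces
`D = 0`. -/
theorem eq_zero_of_sq_le {v κ D : ℝ} (hv : 0 ≤ v) (hD : 0 ≤ D)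
    (h : (v + (κ + D)) ^ 2 ≤ v * (v + 2 * κ + D)) (h' : 0 ≤ v + 2 * κ + D) : D = 0 := by
  rcases hv.eq_or_lt with rfl | hv
  · have h2 : κ + D = 0 := by nlinarith
    linarith
  · by_contra hne
    have hD' : 0 < D := lt_of_le_of_ne hD (Ne.symm hne)
    -- the inequality reads `v D + (κ + D)² ≤ 0`
    nlinarith [sq_nonneg (κ + D), mul_pos hv hD']

theorem exists_pos_of_isDensity [IsProbabilityMeasure μ] (hp : IsDensity μ p) : ∃ x, 0 < p x := by
  by_contra! hle
  have h1 : μ = 0 := by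
    rw [hp.eq_withDensity]
    have : (fun x => ENNReal.ofReal (p x)) = 0 := by
      ext1 x; simp [ENNReal.ofReal_of_nonpos (hle x)]
    rw [this, withDensity_zero]
  exact IsProbabilityMeasure.ne_zero μ h1

/-- Under the universal moment matching property, a test function orthogonal to the polynomials of
degree at most two has expected gradient zero: otherwise the first order correction of the
estimator would have a correlation with the plain estimator that the variance bound forbids. -/
theorem integral_fderiv_eq_zero_of_secondOrderUniversal [IsProbabilityMeasure μ]
    (hμ : MemLp id 2 μ) (hS : (covMatrix μ).PosDef) (hp : IsDensity μ p) (hpc : Continuous p)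
    (hU : SecondOrderUniversal μ p) {f : EuclideanSpace ℝ (Fin n) → ℝ} (hf : ContDiff ℝ ∞ f)
    (hc : HasCompactSupport f) (hsupp : tsupport f ⊆ interior (tsupport p))
    (h0 : ∫ x, f x ∂μ = 0) (h1 : ∫ x, f x • stat (mean μ) x ∂μ = 0)
    (v : EuclideanSpace ℝ (Fin n)) : ∫ x, fderiv ℝ f x v ∂μ = 0 := by
  obtain ⟨ℓ, hℓ⟩ := exists_influence hμ hS
  obtain ⟨hℓ1, -, hℓ3⟩ := hℓ f hf hc
  set L := ℓ f
  set s₀ : EuclideanSpace ℝ (Fin n) × Matrix (Fin n) (Fin n) ℝ := (0, covMatrix μ)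
  obtain ⟨q, hq⟩ : ∃ q : EuclideanSpace ℝ (Fin n) → ℝ,
    q = fun x => L (stat (mean μ) x - s₀) := ⟨_, rfl⟩
  have hqc : Continuous q := by
    rw [hq]; exact L.continuous.comp ((continuous_stat _).sub continuous_const)
  obtain ⟨x₀, hx₀⟩ := exists_pos_of_isDensity hp
  obtain ⟨r, hr, hball⟩ := Metric.isOpen_iff.1 (isOpen_lt continuous_const hpc) x₀ hx₀
  -- `q` is the first order correction of the estimator, and `k` its centred restriction to a ball
  -- on which the density is positive
  set B := Metric.ball x₀ r
  set c := (∫ x in B, q x ∂μ) / μ.real B with hcdef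
  obtain ⟨k, hk⟩ : ∃ k : EuclideanSpace ℝ (Fin n) → ℝ,
    k = B.indicator fun x => q x - c := ⟨_, rfl⟩
  have hBm : MeasurableSet B := Metric.isOpen_ball.measurableSet
  obtain ⟨Q, hQ⟩ := (isCompact_closedBall x₀ r).exists_bound_of_continuousOn hqc.continuousOn
  have hkm : Measurable k := by
    rw [hk]; exact (hqc.measurable.sub_const c).indicator hBm
  have hkb : ∀ x, |k x| ≤ |Q| + |c| := fun x => by
    rw [hk]
    by_cases hx : x ∈ B
    · rw [Set.indicator_of_mem hx]
      refine (abs_sub _ _).trans (add_le_add ?_ le_rfl)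
      exact (hQ x (Metric.ball_subset_closedBall hx)).trans (le_abs_self Q)
    · rw [Set.indicator_of_notMem hx, abs_zero]; positivity
  have hqk : ∀ x, q x * k x = k x ^ 2 + c * k x := fun x => by
    rw [hk]
    by_cases hx : x ∈ B
    · rw [Set.indicator_of_mem hx]; ring
    · simp [Set.indicator_of_notMem hx]
  obtain ⟨K, hK⟩ := hc.exists_bound_of_continuous hf.continuous
  have hfb : ∀ x, |f x| ≤ K := hK
  -- integrability
  have hbdd : ∀ {g : EuclideanSpace ℝ (Fin n) → ℝ} {C : ℝ}, Measurable g → (∀ x, |g x| ≤ C) →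
      MemLp g 2 μ := fun hg hgC =>
    memLp_of_bounded (ae_of_all _ fun y => abs_le.1 (hgC y)) hg.aestronglyMeasurable 2
  have hf2 : MemLp f 2 μ := hbdd hf.continuous.measurable hfb
  have hk2 : MemLp k 2 μ := hbdd hkm hkb
  have hff : Integrable (fun x => f x ^ 2) μ := hf2.integrable_sq
  have hkk : Integrable (fun x => k x ^ 2) μ := hk2.integrable_sq
  have hfk : Integrable (fun x => f x * k x) μ := hf2.integrable_mul hk2
  have hki : Integrable k μ := hk2.integrable (by norm_num)
  have hfi : Integrable f μ := hf2.integrable (by norm_num)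
  have hsi := integrable_stat hμ (mean μ)
  have hfs : Integrable (fun x => f x • stat (mean μ) x) μ :=
    hsi.bdd_smul K hf.continuous.aestronglyMeasurable (ae_of_all _ hK)
  have hqf : ∀ x, q x * f x = L (f x • stat (mean μ) x) - L s₀ * f x := fun x => by
    rw [hq]; simp only [map_sub, map_smul, smul_eq_mul]; ring
  have hqfi : Integrable (fun x => q x * f x) μ := by
    simp_rw [hqf]
    exact (L.integrable_comp hfs).sub (hfi.const_mul _)
  have hqf0 : ∫ x, q x * f x ∂μ = 0 := by
    simp_rw [hqf]
    rw [integral_sub (L.integrable_comp hfs) (hfi.const_mul _), integral_const_mul, h0,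
      L.integral_comp_comm hfs, h1]
    simp
  have hqi : Integrable q μ := by
    rw [hq]; exact L.integrable_comp (hsi.sub (integrable_const _))
  have hk0 : ∫ x, k x ∂μ = 0 := by
    rw [hk, integral_indicator hBm, integral_sub hqi.integrableOn (integrable_const _),
      integral_const, smul_eq_mul, measureReal_restrict_apply_univ, hcdef]
    rcases eq_or_ne (μ.real B) 0 with h | h
    · rw [h, zero_mul, sub_zero]
      refine setIntegral_measure_zero _ ?_
      exact (measureReal_eq_zero_iff).1 h
    · field_simp; ring
  set v₂ := ∫ x, f x ^ 2 ∂μ with hv₂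
  set κ := ∫ x, f x * k x ∂μ
  set D := ∫ x, k x ^ 2 ∂μ
  have hvar : Var[f; μ] = v₂ := by
    rw [variance_eq_sub hf2, h0]; simp [hv₂]
  have hsq : ∫ x, (f x + k x) ^ 2 ∂μ = v₂ + 2 * κ + D := by
    have e : ∀ x, (f x + k x) ^ 2 = f x ^ 2 + 2 * (f x * k x) + k x ^ 2 := fun x => by ring
    simp_rw [e]
    have hi : Integrable (fun x => f x ^ 2 + 2 * (f x * k x)) μ := hff.add (hfk.const_mul 2)
    rw [integral_add hi hkk, integral_add hff (hfk.const_mul _), integral_const_mul]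
  obtain ⟨A, hA, hAle⟩ := hU f hf hc hsupp
  -- the correlation bound, tested against `f + k`
  have hineq : (v₂ + (κ + D)) ^ 2 ≤ v₂ * (v₂ + 2 * κ + D) := by
    obtain ⟨R, hR⟩ := hc.isCompact.isBounded.exists_norm_le
    have h2 := hℓ3 (fun x => f x + k x) (K + (|Q| + |c|)) (max R (‖x₀‖ + r))
      (fun N => A N * v₂) v₂ (hf.continuous.measurable.add hkm)
      (fun x => (abs_add_le _ _).trans (add_le_add (hfb x) (hkb x)))
      (fun x hx => by
        by_cases hxB : x ∈ B
        · refine le_max_of_le_right ?_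
          calc ‖x‖ = ‖x₀ + (x - x₀)‖ := by congr 1; abel
            _ ≤ ‖x₀‖ + ‖x - x₀‖ := norm_add_le _ _
            _ ≤ _ := by
              have : ‖x - x₀‖ < r := by simpa [B, dist_eq_norm] using hxB
              linarith
        · refine le_max_of_le_left (hR x (subset_tsupport f fun hfx => hx ?_))
          have : k x = 0 := by rw [hk, Set.indicator_of_notMem hxB]
          simp only [hfx, this, add_zero])
      (by rw [integral_add hfi hki, h0, hk0, add_zero])
      (by
        filter_upwards [eventually_gt_atTop n] with N hN
        have h3 := hAle N hN
        rw [variance_plainEstimator hf2, hvar] at h3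
        have hN0 : (0 : ℝ) < N := by exact_mod_cast (by omega : 0 < N)
        calc N * Var[matchedEstimator μ f; sampleLaw μ N] ≤ N * (A N * (v₂ / N)) := by gcongr
          _ = A N * v₂ := by field_simp)
      (by simpa using hA.mul_const v₂)
    rw [hsq] at h2
    have e : ∫ x, (f x + L (stat (mean μ) x - s₀)) * (f x + k x) ∂μ = v₂ + (κ + D) := by
      have e1 : ∀ x, (f x + L (stat (mean μ) x - s₀)) * (f x + k x)
          = f x ^ 2 + q x * f x + (f x * k x + (k x ^ 2 + c * k x)) := fun x => by
        rw [← hqk, hq]; ring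
      simp_rw [e1]
      have hi1 : Integrable (fun x => f x ^ 2 + q x * f x) μ := hff.add hqfi
      have hi2 : Integrable (fun x => k x ^ 2 + c * k x) μ := hkk.add (hki.const_mul c)
      have hi3 : Integrable (fun x => f x * k x + (k x ^ 2 + c * k x)) μ := hfk.add hi2
      rw [integral_add hi1 hi3, integral_add hff hqfi, integral_add hfk hi2,
        integral_add hkk (hki.const_mul c), integral_const_mul, hqf0, hk0]
      ring
    rw [e] at h2
    exact h2
  have hD0 : D = 0 := eq_zero_of_sq_le (integral_nonneg fun x => sq_nonneg _)
    (integral_nonneg fun x => sq_nonneg _) hineq (by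
      rw [← hsq]; exact integral_nonneg fun x => sq_nonneg _)
  have hae : ∀ᵐ x ∂μ, k x = 0 := by
    filter_upwards [(integral_eq_zero_iff_of_nonneg (fun x => sq_nonneg (k x)) hkk).1 hD0]
      with x hx
    exact pow_eq_zero_iff two_ne_zero |>.1 hx
  rw [hp.eq_withDensity, ae_withDensity_iff hp.measurable.ennreal_ofReal] at hae
  have hae' : q =ᵐ[volume.restrict B] fun _ => c := by
    rw [Filter.EventuallyEq, ae_restrict_iff' hBm]
    filter_upwards [hae] with x hx hxB
    have h2 : k x = 0 := hx (by simpa using hball hxB)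
    rw [hk, Set.indicator_of_mem hxB] at h2
    exact sub_eq_zero.1 h2
  have heq : Set.EqOn q (fun _ => c) B := Measure.eqOn_open_of_ae_eq hae' Metric.isOpen_ball
    hqc.continuousOn continuousOn_const
  have hL0 := clm_fst_eq_zero_of_const_on_ball L (m := mean μ) (c := c + L s₀) hr
    (fun x hx => by
      have := heq hx
      rw [hq] at this
      simp only [map_sub] at this
      linarith) v
  -- the part of first order of the influence functional is minus the expected gradient
  obtain ⟨M, hM, hMv⟩ := hℓ1 v 0
  have hM0 : M = 0 := sylvester_injective (posDef_sqrt hS) (by rw [add_comm]; exact hM)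
  rw [hL0, hM0] at hMv
  simpa using hMv.symm

end Orthogonal

/-! ### The weak logarithmic derivative of the density -/

section Duality

open scoped Matrix.Norms.L2Operator

attribute [local instance] matrixMeasurableSpace matrixBorelSpace

variable {n : ℕ} {μ : Measure (EuclideanSpace ℝ (Fin n))} {p : EuclideanSpace ℝ (Fin n) → ℝ}

/-- A linear map that vanishes on the kernel of `f` factors through `f`. -/
theorem exists_comp_eq_of_ker_le {K V W X : Type*} [Field K] [AddCommGroup V] [Module K V]
    [AddCommGroup W] [Module K W] [AddCommGroup X] [Module K X] (f : V →ₗ[K] W) (g : V →ₗ[K] X)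
    (h : ∀ x, f x = 0 → g x = 0) : ∃ r : W →ₗ[K] X, ∀ x, r (f x) = g x := by
  have hle : LinearMap.ker f ≤ LinearMap.ker g := fun x hx => h x hx
  obtain ⟨r, hr⟩ := LinearMap.exists_extend
    (((LinearMap.ker f).liftQ g hle).comp f.quotKerEquivRange.symm.toLinearMap)
  refine ⟨r, fun x => ?_⟩
  have h1 := LinearMap.congr_fun hr (f.rangeRestrict x)
  have h2 : f.quotKerEquivRange.symm (f.rangeRestrict x) = (LinearMap.ker f).mkQ x := by
    rw [LinearEquiv.symm_apply_eq]
    rfl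
  simp only [LinearMap.comp_apply, Submodule.subtype_apply, LinearEquiv.coe_coe, h2] at h1
  simpa using h1

/-- The smooth functions with compact support in `U`. -/
def testFunctions (U : Set (EuclideanSpace ℝ (Fin n))) :
    Submodule ℝ (EuclideanSpace ℝ (Fin n) → ℝ) where
  carrier := {f | ContDiff ℝ ∞ f ∧ HasCompactSupport f ∧ tsupport f ⊆ U}
  add_mem' := fun ⟨h1, h2, h3⟩ ⟨h4, h5, h6⟩ =>
    ⟨h1.add h4, h2.add h5, (tsupport_add _ _).trans (Set.union_subset h3 h6)⟩
  zero_mem' := ⟨contDiff_const, .zero, by simp [tsupport]⟩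
  smul_mem' := fun c f ⟨h1, h2, h3⟩ => ⟨contDiff_const.smul h1, h2.smul_left,
    (tsupport_smul_subset_right (fun _ => c) f).trans h3⟩

/-- Under the universal moment matching property, the distributional gradient of the law is, on
the interior of the support of the density, the product of the law with a vector field that is
polynomial of degree at most two. -/
theorem exists_weak_gradient [IsProbabilityMeasure μ]
    (hμ : MemLp id 2 μ) (hS : (covMatrix μ).PosDef) (hp : IsDensity μ p) (hpc : Continuous p)
    (hU : SecondOrderUniversal μ p) :
    ∃ r : ℝ × EuclideanSpace ℝ (Fin n) × Matrix (Fin n) (Fin n) ℝ →L[ℝ]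
        EuclideanSpace ℝ (Fin n) →L[ℝ] ℝ,
      ∀ f ∈ testFunctions (interior (tsupport p)), ∀ v,
        ∫ x, fderiv ℝ f x v ∂μ = ∫ x, f x * r (1, stat (mean μ) x) v ∂μ := by
  set W := testFunctions (interior (tsupport p))
  have hsi := integrable_stat hμ (mean μ)
  have hfi : ∀ f : W, Integrable (fun x => (f : EuclideanSpace ℝ (Fin n) → ℝ) x) μ := fun f =>
    f.2.1.continuous.integrable_of_hasCompactSupport f.2.2.1
  have hgi : ∀ (f : W) (v : EuclideanSpace ℝ (Fin n)), Integrable (fun x =>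
      fderiv ℝ (f : EuclideanSpace ℝ (Fin n) → ℝ) x v) μ := fun f v =>
    (((f.2.1.continuous_fderiv (by simp)).clm_apply
      continuous_const)).integrable_of_hasCompactSupport (f.2.2.1.fderiv_apply ℝ v)
  have hfs : ∀ f : W, Integrable
      (fun x => (f : EuclideanSpace ℝ (Fin n) → ℝ) x • stat (mean μ) x) μ := fun f => by
    obtain ⟨K, hK⟩ := f.2.2.1.exists_bound_of_continuous f.2.1.continuous
    exact hsi.bdd_smul K f.2.1.continuous.aestronglyMeasurable (ae_of_all _ hK)
  have hd : ∀ (f : W) (x : EuclideanSpace ℝ (Fin n)),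
      DifferentiableAt ℝ (f : EuclideanSpace ℝ (Fin n) → ℝ) x := fun f x =>
    f.2.1.differentiable (by simp) x
  let Φ : W →ₗ[ℝ] ℝ × EuclideanSpace ℝ (Fin n) × Matrix (Fin n) (Fin n) ℝ :=
    { toFun := fun f => (∫ x, (f : EuclideanSpace ℝ (Fin n) → ℝ) x ∂μ,
        ∫ x, (f : EuclideanSpace ℝ (Fin n) → ℝ) x • stat (mean μ) x ∂μ)
      map_add' := fun f g => by
        rw [Prod.mk_add_mk, ← integral_add (hfi f) (hfi g), ← integral_add (hfs f) (hfs g)]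
        simp only [Submodule.coe_add, Pi.add_apply, add_smul]
      map_smul' := fun c f => by
        rw [RingHom.id_apply, Prod.smul_mk, ← integral_smul, ← integral_smul]
        simp only [Submodule.coe_smul, Pi.smul_apply, smul_assoc] }
  -- the expected derivatives depend linearly on `f` and vanish where the moments `Φ` do
  let D : W →ₗ[ℝ] EuclideanSpace ℝ (Fin n) →ₗ[ℝ] ℝ :=
    LinearMap.mk₂ ℝ (fun f v => ∫ x, fderiv ℝ (f : EuclideanSpace ℝ (Fin n) → ℝ) x v ∂μ)
      (fun f g v => by
        rw [← integral_add (hgi f v) (hgi g v)]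
        refine integral_congr_ae (ae_of_all _ fun x => ?_)
        simp only [Submodule.coe_add]
        rw [fderiv_add (hd f x) (hd g x), add_apply])
      (fun c f v => by
        rw [← integral_smul]
        refine integral_congr_ae (ae_of_all _ fun x => ?_)
        simp only [Submodule.coe_smul]
        rw [fderiv_const_smul (hd f x), smul_apply])
      (fun f v w => by
        rw [← integral_add (hgi f v) (hgi f w)]
        simp only [map_add])
      (fun c f v => by
        rw [← integral_smul]
        simp only [map_smul])
  obtain ⟨r, hr⟩ := exists_comp_eq_of_ker_le Φ D (fun f hf => by
    ext1 v
    have h0 := congrArg Prod.fst hf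
    have h1 := congrArg Prod.snd hf
    exact integral_fderiv_eq_zero_of_secondOrderUniversal hμ hS hp hpc hU f.2.1 f.2.2.1 f.2.2.2
      h0 h1 v)
  refine ⟨LinearMap.toContinuousLinearMap (LinearMap.toContinuousLinearMap.toLinearMap.comp r),
    fun f hf v => ?_⟩
  have h1 := LinearMap.congr_fun (hr ⟨f, hf⟩) v
  have h2 : ∫ x, fderiv ℝ f x v ∂μ = r (Φ ⟨f, hf⟩) v := h1.symm
  rw [h2]
  set rv : ℝ × EuclideanSpace ℝ (Fin n) × Matrix (Fin n) (Fin n) ℝ →L[ℝ] ℝ :=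
    LinearMap.toContinuousLinearMap (r.flip v)
  have h3 : Φ ⟨f, hf⟩ = ∫ x, f x • ((1 : ℝ), stat (mean μ) x) ∂μ := by
    simp only [Prod.smul_mk, smul_eq_mul, mul_one]
    exact (integral_pair (hfi ⟨f, hf⟩) (hfs ⟨f, hf⟩)).symm
  have h4 : Integrable (fun x => f x • ((1 : ℝ), stat (mean μ) x)) μ := by
    simp only [Prod.smul_mk, smul_eq_mul, mul_one]
    exact (hfi ⟨f, hf⟩).prodMk (hfs ⟨f, hf⟩)
  have h5 := rv.integral_comp_comm h4
  simp only [map_smul, smul_eq_mul] at h5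
  rw [h3]
  exact h5.symm

end Duality

section Mollification

open scoped Convolution

variable {n : ℕ}

/-- A continuous function whose distributional derivative in the direction `v` is `-R p` on `U`,
where `R` is the derivative of `C` in the direction `v`, is a multiple of `e^{-C}` on
the segments in `U` with direction `v`: the mollifications of `p e^C` are constant there. -/
theorem mul_exp_eq_of_weak_deriv {p R C : EuclideanSpace ℝ (Fin n) → ℝ}
    {U : Set (EuclideanSpace ℝ (Fin n))} (hU : IsOpen U) (hp : Continuous p) (hR : Continuous R)
    (hC : ContDiff ℝ ∞ C) {v : EuclideanSpace ℝ (Fin n)} (hCR : ∀ x, fderiv ℝ C x v = R x)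
    (hweak : ∀ f ∈ testFunctions U, ∫ x, fderiv ℝ f x v * p x = ∫ x, f x * R x * p x)
    {x : EuclideanSpace ℝ (Fin n)} (hx : ∀ s ∈ Set.Icc (0 : ℝ) 1, x + s • v ∈ U) :
    p (x + v) * Real.exp (C (x + v)) = p x * Real.exp (C x) := by
  obtain ⟨w, hw⟩ : ∃ w : EuclideanSpace ℝ (Fin n) → ℝ, w = fun y => p y * Real.exp (C y) :=
    ⟨_, rfl⟩
  have hwc : Continuous w := by
    rw [hw]; exact hp.mul (Real.continuous_exp.comp hC.continuous)
  set S := (fun s : ℝ => x + s • v) '' Set.Icc (0 : ℝ) 1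
  have hSc : IsCompact S := isCompact_Icc.image (by fun_prop)
  obtain ⟨δ, hδ, hδU⟩ := hSc.exists_cthickening_subset_open hU
    (by rintro _ ⟨s, hs, rfl⟩; exact hx s hs)
  let φ : ℕ → ContDiffBump (0 : EuclideanSpace ℝ (Fin n)) := fun k =>
    ⟨δ / (k + 2), δ / (k + 1), by positivity, by gcongr; norm_num⟩
  have hφ0 : Tendsto (fun k => (φ k).rOut) atTop (𝓝 0) :=
    tendsto_const_div_atTop_nhds_zero_nat δ |>.comp (tendsto_add_atTop_nat 1) |>.congr fun k => by
      simp [φ]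
  set ψ : ℕ → EuclideanSpace ℝ (Fin n) → ℝ := fun k => (φ k).normed volume
  have hψ : ∀ k, ContDiff ℝ ∞ (ψ k) := fun k => (φ k).contDiff_normed
  have hψc : ∀ k, HasCompactSupport (ψ k) := fun k => (φ k).hasCompactSupport_normed
  have hlim := fun z => ContDiffBump.convolution_tendsto_right_of_continuous (μ := volume) hφ0 hwc z
  -- the derivative of the mollified function vanishes along the segment
  have hzero : ∀ k, ∀ s ∈ Set.Icc (0 : ℝ) 1,
      ∫ y, fderiv ℝ (ψ k) (x + s • v - y) v * w y = 0 := by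
    intro k s hs
    set z := x + s • v with hz
    obtain ⟨f, hf⟩ : ∃ f : EuclideanSpace ℝ (Fin n) → ℝ,
      f = fun y => ψ k (z - y) * Real.exp (C y) := ⟨_, rfl⟩
    have hf1 : ContDiff ℝ ∞ f := by
      rw [hf]
      exact ((hψ k).comp (contDiff_const.sub contDiff_id)).mul hC.exp
    have hsub : tsupport f ⊆ Metric.closedBall z δ := by
      refine closure_minimal (fun y hy => ?_) Metric.isClosed_closedBall
      have h1 : ψ k (z - y) ≠ 0 := fun h => hy (by rw [hf]; simp only [h, zero_mul])
      have h2 : z - y ∈ Function.support ((φ k).normed volume) := h1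
      rw [ContDiffBump.support_normed_eq, mem_ball_zero_iff] at h2
      rw [Metric.mem_closedBall, dist_comm, dist_eq_norm]
      refine h2.le.trans ?_
      change δ / (k + 1) ≤ δ
      exact div_le_self hδ.le (by linarith [k.cast_nonneg (α := ℝ)])
    have hfm : f ∈ testFunctions U := by
      refine ⟨hf1, HasCompactSupport.of_support_subset_isCompact
        (isCompact_closedBall z δ) ((subset_tsupport f).trans hsub), hsub.trans ?_⟩
      exact (Metric.closedBall_subset_cthickening (show z ∈ S from ⟨s, hs, rfl⟩) δ).trans hδU
    have hfd : ∀ y, fderiv ℝ f y v = -fderiv ℝ (ψ k) (z - y) v * Real.exp (C y) + f y * R y := by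
      intro y
      have h1 : HasFDerivAt (fun y => ψ k (z - y)) _ y :=
        HasFDerivAt.comp y ((hψ k).differentiable (by simp) (z - y)).hasFDerivAt
          ((hasFDerivAt_id y).const_sub z)
      have h2 : HasFDerivAt (fun y => Real.exp (C y)) _ y :=
        (hC.differentiable (by simp) y).hasFDerivAt.exp
      have h3 := h1.fun_mul h2
      simp only [hf, h3.fderiv]
      simp only [add_apply, smul_apply, ContinuousLinearMap.comp_apply, neg_apply,
        ContinuousLinearMap.id_apply, map_neg, smul_eq_mul, hCR]
      ring
    have hfc : HasCompactSupport f := hfm.2.1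
    have h4 := hweak f hfm
    have hi1 : Integrable fun y => f y * R y * p y :=
      ((hf1.continuous.mul hR).mul hp).integrable_of_hasCompactSupport (hfc.mul_right.mul_right)
    have hi2 : Integrable fun y => fderiv ℝ f y v * p y :=
      (((hf1.continuous_fderiv (by simp)).clm_apply continuous_const).mul
        hp).integrable_of_hasCompactSupport ((hfc.fderiv_apply ℝ v).mul_right)
    have e : ∀ y, fderiv ℝ (ψ k) (z - y) v * w y = f y * R y * p y - fderiv ℝ f y v * p y := by
      intro y
      rw [hfd, hw]
      ring
    simp_rw [e]
    rw [integral_sub hi1 hi2, h4, sub_self]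
  have hconst : ∀ k, (ψ k ⋆[ContinuousLinearMap.lsmul ℝ ℝ, volume] w) (x + v)
      = (ψ k ⋆[ContinuousLinearMap.lsmul ℝ ℝ, volume] w) x := by
    intro k
    set Wk := ψ k ⋆[ContinuousLinearMap.lsmul ℝ ℝ, volume] w
    have hd : ∀ z, HasFDerivAt Wk ((fderiv ℝ (ψ k)
        ⋆[(ContinuousLinearMap.lsmul ℝ ℝ).precompL _, volume] w) z) z := fun z =>
      (hψc k).hasFDerivAt_convolution_left _ ((hψ k).of_le (by simp)) hwc.locallyIntegrable z
    have hdv : ∀ s ∈ Set.Icc (0 : ℝ) 1, HasDerivAt (fun s : ℝ => Wk (x + s • v)) 0 s := by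
      intro s hs
      have h1 : HasDerivAt (fun s : ℝ => x + s • v) v s := by
        simpa using ((hasDerivAt_id s).smul_const v).const_add x
      have h2 := (hd (x + s • v)).comp_hasDerivAt s h1
      have h3 : ((fderiv ℝ (ψ k) ⋆[(ContinuousLinearMap.lsmul ℝ ℝ).precompL _, volume] w)
          (x + s • v)) v = 0 := by
        have hex : ConvolutionExistsAt (fderiv ℝ (ψ k)) w (x + s • v)
            ((ContinuousLinearMap.lsmul ℝ ℝ).precompL (EuclideanSpace ℝ (Fin n))) volume :=
          ((hψc k).fderiv ℝ).convolutionExists_left _ ((hψ k).continuous_fderiv (by simp))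
            hwc.locallyIntegrable _
        rw [convolution_def, ContinuousLinearMap.integral_apply hex.integrable]
        rw [← hzero k s hs, ← integral_sub_left_eq_self _ volume (x + s • v)]
        refine integral_congr_ae (ae_of_all _ fun y => ?_)
        simp
      rw [h3] at h2
      exact h2
    have h4 := constant_of_has_deriv_right_zero (f := fun s : ℝ => Wk (x + s • v)) (a := 0) (b := 1)
      (fun s hs => (hdv s hs).continuousAt.continuousWithinAt)
      (fun s hs => (hdv s (Set.Ico_subset_Icc_self hs)).hasDerivWithinAt) 1 (by simp)
    simpa using h4
  have h5 := tendsto_nhds_unique ((hlim (x + v)).congr hconst) (hlim x)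
  rw [hw] at h5
  exact h5

end Mollification

/-! ### The density is the exponential of a polynomial of degree three -/

section LogDensity

open scoped Matrix.Norms.L2Operator

attribute [local instance] matrixMeasurableSpace matrixBorelSpace

variable {n : ℕ} {μ : Measure (EuclideanSpace ℝ (Fin n))} {p : EuclideanSpace ℝ (Fin n) → ℝ}

/-- A function that is quadratic in the direction `v` has a primitive in this direction. -/
theorem exists_directional_primitive {R : EuclideanSpace ℝ (Fin n) → ℝ} (hR : ContDiff ℝ ∞ R)
    {v : EuclideanSpace ℝ (Fin n)} (hv : v ≠ 0) {κ : ℝ}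
    (hq : ∀ y (t : ℝ), R (y + t • v) = R y + t * (R (y + v) - R y - κ) + t ^ 2 * κ) :
    ∃ C : EuclideanSpace ℝ (Fin n) → ℝ, ContDiff ℝ ∞ C ∧ (∀ y, fderiv ℝ C y v = R y) ∧
      ∀ y, C (y + v) - C y = 1 / 2 * (R y + R (y + v)) - κ / 6 := by
  set ξ : EuclideanSpace ℝ (Fin n) →L[ℝ] ℝ := (‖v‖ ^ 2)⁻¹ • innerSL ℝ v
  have hξ : ξ v = 1 := by
    have : ‖v‖ ≠ 0 := norm_ne_zero_iff.2 hv
    simp only [ξ, smul_apply, innerSL_apply_apply, real_inner_self_eq_norm_sq, smul_eq_mul]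
    field_simp
  -- the alternating Taylor sum `ξ R - ξ² R' / 2 + ξ³ R'' / 6`, where `R'' = 2 κ`
  obtain ⟨C, hC⟩ : ∃ C : EuclideanSpace ℝ (Fin n) → ℝ, C = fun y =>
    ξ y * R y - ξ y ^ 2 / 2 * (R (y + v) - R y - κ) + ξ y ^ 3 / 3 * κ := ⟨_, rfl⟩
  have hCd : ContDiff ℝ ∞ C := by
    have h1 : ContDiff ℝ ∞ fun y => R (y + v) := hR.comp (contDiff_id.add contDiff_const)
    have h2 : ContDiff ℝ ∞ ξ := ξ.contDiff
    rw [hC]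
    exact ((h2.mul hR).sub (((h2.pow 2).div_const 2).mul ((h1.sub hR).sub contDiff_const))).add
      (((h2.pow 3).div_const 3).mul contDiff_const)
  have hexp : ∀ y (t : ℝ), C (y + t • v) = C y + R y * t
      + (R (y + v) - R y - κ) / 2 * t ^ 2 + κ / 3 * t ^ 3 := fun y t => by
    have e : y + t • v + v = y + (t + 1) • v := by rw [add_smul, one_smul, add_assoc]
    simp only [hC, e, hq y t, hq y (t + 1), map_add, map_smul, smul_eq_mul, hξ]
    ring
  refine ⟨C, hCd, fun y => ?_, fun y => ?_⟩
  · have h1 : HasDerivAt (fun t : ℝ => y + t • v) v 0 := by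
      simpa using ((hasDerivAt_id (0 : ℝ)).smul_const v).const_add y
    have h2 : HasFDerivAt C (fderiv ℝ C y) (y + (0 : ℝ) • v) := by
      simpa using (hCd.differentiable (by simp) y).hasFDerivAt
    have h3 := h2.comp_hasDerivAt (0 : ℝ) h1
    have h4 : HasDerivAt (fun t : ℝ => C y + R y * t
        + (R (y + v) - R y - κ) / 2 * t ^ 2 + κ / 3 * t ^ 3) (R y) 0 := by
      have := (((hasDerivAt_id (0 : ℝ)).const_mul (R y)).const_add (C y)).fun_add
        ((hasDerivAt_pow 2 (0 : ℝ)).const_mul ((R (y + v) - R y - κ) / 2)) |>.fun_add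
        ((hasDerivAt_pow 3 (0 : ℝ)).const_mul (κ / 3))
      simpa using this
    refine h3.unique (h4.congr_of_eventuallyEq (Filter.Eventually.of_forall fun t => ?_))
    exact hexp y t
  · have := hexp y 1
    rw [one_smul] at this
    rw [this]
    ring

/-- The increment of minus the logarithm of the density from `x` to `x + v`, when `r` is minus the
logarithmic gradient as a function of the first and second order statistics. It is the integral of
a quadratic function over a segment, by the corrected trapezoidal rule. -/
def logIncrement (r : ℝ × EuclideanSpace ℝ (Fin n) × Matrix (Fin n) (Fin n) ℝ →L[ℝ]
      EuclideanSpace ℝ (Fin n) →L[ℝ] ℝ) (m x v : EuclideanSpace ℝ (Fin n)) : ℝ :=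
  1 / 2 * (r (1, stat m x) v + r (1, stat m (x + v)) v)
    - r (0, 0, Matrix.vecMulVec v.ofLp v.ofLp) v / 6

theorem continuous_vecMulVec_self :
    Continuous fun v : EuclideanSpace ℝ (Fin n) => Matrix.vecMulVec v.ofLp v.ofLp :=
  contDiff_vecMulVec_self.continuous

theorem continuous_logIncrement (r : ℝ × EuclideanSpace ℝ (Fin n) × Matrix (Fin n) (Fin n) ℝ →L[ℝ]
      EuclideanSpace ℝ (Fin n) →L[ℝ] ℝ) (m x : EuclideanSpace ℝ (Fin n)) :
    Continuous (logIncrement r m x) := by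
  unfold logIncrement
  have h1 : Continuous fun v : EuclideanSpace ℝ (Fin n) => r (1, stat m (x + v)) v :=
    (r.continuous.comp (continuous_const.prodMk ((continuous_stat m).comp
      (continuous_const.add continuous_id)))).clm_apply continuous_id
  have h2 : Continuous fun v : EuclideanSpace ℝ (Fin n) =>
      r (0, 0, Matrix.vecMulVec v.ofLp v.ofLp) v :=
    (r.continuous.comp (continuous_const.prodMk (continuous_const.prodMk
      continuous_vecMulVec_self))).clm_apply continuous_id
  exact (continuous_const.mul (((r (1, stat m x)).continuous).add h1)).sub (h2.div_const 6)

theorem stat_add_smul (m y v : EuclideanSpace ℝ (Fin n)) (t : ℝ) :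
    stat m (y + t • v) = stat m y + t • ((v, Matrix.vecMulVec (y - m).ofLp v.ofLp
        + Matrix.vecMulVec v.ofLp (y - m).ofLp) :
        EuclideanSpace ℝ (Fin n) × Matrix (Fin n) (Fin n) ℝ)
      + t ^ 2 • ((0, Matrix.vecMulVec v.ofLp v.ofLp) :
        EuclideanSpace ℝ (Fin n) × Matrix (Fin n) (Fin n) ℝ) := by
  have e : y + t • v - m = (y - m) + t • v := by abel
  rw [stat, stat, e]
  simp only [WithLp.ofLp_add, WithLp.ofLp_smul, Matrix.add_vecMulVec, Matrix.vecMulVec_add,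
    Matrix.vecMulVec_smul, Matrix.smul_vecMulVec, Prod.smul_mk, Prod.mk_add_mk, smul_zero,
    add_zero, smul_add, smul_smul, sq]
  congr 1
  abel

/-- The density along a segment on which it is positive. -/
theorem density_add_eq (hp : Continuous p)
    {r : ℝ × EuclideanSpace ℝ (Fin n) × Matrix (Fin n) (Fin n) ℝ →L[ℝ]
      EuclideanSpace ℝ (Fin n) →L[ℝ] ℝ} {m : EuclideanSpace ℝ (Fin n)}
    (hweak : ∀ f ∈ testFunctions (interior (tsupport p)), ∀ v,
      ∫ x, fderiv ℝ f x v * p x = ∫ x, f x * r (1, stat m x) v * p x)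
    {x v : EuclideanSpace ℝ (Fin n)} (hx : ∀ s ∈ Set.Icc (0 : ℝ) 1, 0 < p (x + s • v)) :
    p (x + v) = p x * Real.exp (-logIncrement r m x v) := by
  rcases eq_or_ne v 0 with rfl | hv
  · simp [logIncrement]
  set κ := r (0, 0, Matrix.vecMulVec v.ofLp v.ofLp) v with hκ
  obtain ⟨R, hR⟩ : ∃ R : EuclideanSpace ℝ (Fin n) → ℝ, R = fun y => r (1, stat m y) v := ⟨_, rfl⟩
  have hstat : ContDiff ℝ ∞ (stat m) := by
    have h1 : ContDiff ℝ ∞ fun y : EuclideanSpace ℝ (Fin n) => y - m :=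
      contDiff_id.sub contDiff_const
    exact h1.prodMk (contDiff_vecMulVec_self.comp h1)
  have hRd : ContDiff ℝ ∞ R := by
    rw [hR]
    exact (r.contDiff.comp (contDiff_const.prodMk hstat)).clm_apply contDiff_const
  have hexp : ∀ y (t : ℝ), R (y + t • v) = R y + t * r (0, v, Matrix.vecMulVec (y - m).ofLp v.ofLp
        + Matrix.vecMulVec v.ofLp (y - m).ofLp) v + t ^ 2 * κ := fun y t => by
    have e : ((1 : ℝ), stat m (y + t • v)) = (1, stat m y) + t • ((0 : ℝ), v,
        Matrix.vecMulVec (y - m).ofLp v.ofLp + Matrix.vecMulVec v.ofLp (y - m).ofLp)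
        + t ^ 2 • ((0 : ℝ), (0 : EuclideanSpace ℝ (Fin n)),
          Matrix.vecMulVec v.ofLp v.ofLp) := by
      rw [stat_add_smul]
      simp
    simp only [hR, e, map_add, map_smul, add_apply, smul_apply, smul_eq_mul, hκ]
  have hq : ∀ y (t : ℝ), R (y + t • v) = R y + t * (R (y + v) - R y - κ) + t ^ 2 * κ :=
    fun y t => by
      have h1 := hexp y 1
      rw [one_smul] at h1
      rw [hexp y t, h1]
      ring
  obtain ⟨C, hC, hCR, hCv⟩ := exists_directional_primitive hRd hv hq
  have hpos : ∀ y, 0 < p y → y ∈ interior (tsupport p) := fun y hy =>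
    interior_maximal (subset_tsupport p) (isOpen_ne_fun hp continuous_const) hy.ne'
  have key := mul_exp_eq_of_weak_deriv isOpen_interior hp hRd.continuous hC hCR
    (fun f hf => by rw [hR]; exact hweak f hf v) fun s hs => hpos _ (hx s hs)
  have h2 : logIncrement r m x v = C (x + v) - C x := by
    rw [hCv, logIncrement, hR]
  rw [h2, neg_sub, Real.exp_sub, mul_div_assoc', ← key]
  field_simp

/-- The density cannot vanish: at the first zero on a segment it would be a positive limit. -/
theorem density_pos (hp : Continuous p) (hp0 : ∀ x, 0 ≤ p x)
    {r : ℝ × EuclideanSpace ℝ (Fin n) × Matrix (Fin n) (Fin n) ℝ →L[ℝ]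
      EuclideanSpace ℝ (Fin n) →L[ℝ] ℝ} {m : EuclideanSpace ℝ (Fin n)}
    (hweak : ∀ f ∈ testFunctions (interior (tsupport p)), ∀ v,
      ∫ x, fderiv ℝ f x v * p x = ∫ x, f x * r (1, stat m x) v * p x)
    {x : EuclideanSpace ℝ (Fin n)} (hx : 0 < p x) (y : EuclideanSpace ℝ (Fin n)) : 0 < p y := by
  by_contra hy
  have hy0 : p y = 0 := le_antisymm (not_lt.1 hy) (hp0 y)
  set v := y - x
  have hline : Continuous fun s : ℝ => p (x + s • v) := by fun_prop
  -- the first zero of the density on the segment from `x` to `y`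
  set Z := {s : ℝ | s ∈ Set.Icc (0 : ℝ) 1 ∧ p (x + s • v) = 0}
  have hZc : IsCompact Z :=
    isCompact_Icc.inter_right (isClosed_eq hline continuous_const)
  have hZne : Z.Nonempty := ⟨1, by simp, by simp [v, hy0]⟩
  set t := sInf Z
  have htZ : t ∈ Z := hZc.sInf_mem hZne
  have ht0 : 0 < t := by
    refine lt_of_le_of_ne htZ.1.1 fun h => ?_
    have := htZ.2
    rw [← h, zero_smul, add_zero] at this
    exact hx.ne' this
  have hlt : ∀ s ∈ Set.Ico 0 t, 0 < p (x + s • v) := fun s hs =>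
    lt_of_le_of_ne (hp0 _) fun h =>
      not_le.2 hs.2 (csInf_le hZc.bddBelow ⟨⟨hs.1, hs.2.le.trans htZ.1.2⟩, h.symm⟩)
  have heq : ∀ s ∈ Set.Ico 0 t, p (x + s • v) = p x * Real.exp (-logIncrement r m x (s • v)) :=
    fun s hs => density_add_eq hp hweak fun s' hs' => by
      rw [smul_smul]
      exact hlt _ ⟨mul_nonneg hs'.1 hs.1,
        (mul_le_of_le_one_left hs.1 hs'.2).trans_lt hs.2⟩
  have hcl : IsClosed {s : ℝ | p (x + s • v) = p x * Real.exp (-logIncrement r m x (s • v))} := by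
    refine isClosed_eq hline (continuous_const.mul (Real.continuous_exp.comp ?_))
    exact ((continuous_logIncrement r m x).comp (by fun_prop)).neg
  have htm : t ∈ closure (Set.Ico 0 t) := by
    rw [closure_Ico ht0.ne]; exact ⟨ht0.le, le_rfl⟩
  have h1 : p (x + t • v) = _ := hcl.closure_subset_iff.2 heq htm
  have h2 : 0 < p x * Real.exp (-logIncrement r m x (t • v)) := by positivity
  rw [← h1, htZ.2] at h2
  exact h2.false

/-- The density of a law with the universal moment matching property is the exponential of a
polynomial of degree at most three. -/
theorem exists_density_eq_exp [IsProbabilityMeasure μ]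
    (hμ : MemLp id 2 μ) (hS : (covMatrix μ).PosDef) (hp : IsDensity μ p) (hpc : Continuous p)
    (hU : SecondOrderUniversal μ p) :
    ∃ r : ℝ × EuclideanSpace ℝ (Fin n) × Matrix (Fin n) (Fin n) ℝ →L[ℝ]
        EuclideanSpace ℝ (Fin n) →L[ℝ] ℝ,
      0 < p (mean μ) ∧ ∀ v, p (mean μ + v) = p (mean μ) * Real.exp (-(r (1, 0, 0) v
        + r (0, v, 0) v / 2 + r (0, 0, Matrix.vecMulVec v.ofLp v.ofLp) v / 3)) := by
  obtain ⟨r, hr⟩ := exists_weak_gradient hμ hS hp hpc hU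
  have hint : ∀ {G : EuclideanSpace ℝ (Fin n) → ℝ}, ∫ x, G x ∂μ = ∫ x, G x * p x := by
    intro G
    conv_lhs => rw [hp.eq_withDensity]
    rw [integral_withDensity_eq_integral_toReal_smul hp.measurable.ennreal_ofReal
      (ae_of_all _ fun x => by simp)]
    refine integral_congr_ae (ae_of_all _ fun x => ?_)
    simp only [ENNReal.toReal_ofReal (hp.nonneg x), smul_eq_mul, mul_comm]
  have hweak : ∀ f ∈ testFunctions (interior (tsupport p)), ∀ v,
      ∫ x, fderiv ℝ f x v * p x = ∫ x, f x * r (1, stat (mean μ) x) v * p x := fun f hf v => by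
    rw [← hint, hr f hf v, hint]
  obtain ⟨x₀, hx₀⟩ := exists_pos_of_isDensity hp
  have hpos := density_pos hpc hp.nonneg hweak hx₀
  refine ⟨r, hpos _, fun v => ?_⟩
  rw [density_add_eq hpc hweak fun s _ => hpos _]
  congr 3
  have e1 : ((1 : ℝ), stat (mean μ) (mean μ)) = (1, 0, 0) := by simp [stat]
  have e2 : ((1 : ℝ), stat (mean μ) (mean μ + v))
      = ((1 : ℝ), (0 : EuclideanSpace ℝ (Fin n)), (0 : Matrix (Fin n) (Fin n) ℝ)) + (0, v, 0)
        + (0, 0, Matrix.vecMulVec v.ofLp v.ofLp) := by simp [stat]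
  rw [logIncrement, e1, e2, map_add, map_add, add_apply, add_apply]
  ring

end LogDensity

/-! ### Integrability of the exponential of a cubic polynomial -/

section Escape

variable {n : ℕ} {p : EuclideanSpace ℝ (Fin n) → ℝ}

theorem setIntegral_ball_comp_neg (g : EuclideanSpace ℝ (Fin n) → ℝ) (r : ℝ) :
    ∫ u in Metric.ball 0 r, g (-u) = ∫ u in Metric.ball 0 r, g u := by
  rw [← integral_indicator Metric.isOpen_ball.measurableSet,
    ← integral_indicator Metric.isOpen_ball.measurableSet, ← integral_neg_eq_self]
  refine integral_congr_ae (ae_of_all _ fun u => ?_)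
  by_cases hu : u ∈ Metric.ball (0 : EuclideanSpace ℝ (Fin n)) r
  · have hu' : -u ∈ Metric.ball (0 : EuclideanSpace ℝ (Fin n)) r := by simpa using hu
    simp [Set.indicator_of_mem hu, Set.indicator_of_mem hu']
  · have hu' : -u ∉ Metric.ball (0 : EuclideanSpace ℝ (Fin n)) r := by simpa using hu
    simp [Set.indicator_of_notMem hu, Set.indicator_of_notMem hu']

/-- The mass of a ball escaping to infinity tends to zero. -/
theorem tendsto_setIntegral_ball_add_smul (hp : Integrable p) (m : EuclideanSpace ℝ (Fin n))
    {v : EuclideanSpace ℝ (Fin n)} (hv : v ≠ 0) :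
    Tendsto (fun t : ℝ => ∫ u in Metric.ball 0 1, p (m + t • v + u)) atTop (𝓝 0) := by
  have hv0 : 0 < ‖v‖ := norm_pos_iff.2 hv
  have e : ∀ t : ℝ, ∫ u in Metric.ball 0 1, p (m + t • v + u)
      = ∫ x, (Metric.ball (m + t • v) 1).indicator p x := fun t => by
    rw [← integral_indicator Metric.isOpen_ball.measurableSet,
      ← integral_add_left_eq_self (μ := volume) ((Metric.ball (m + t • v) 1).indicator p)
        (m + t • v)]
    refine integral_congr_ae (ae_of_all _ fun u => ?_)
    by_cases hu : u ∈ Metric.ball (0 : EuclideanSpace ℝ (Fin n)) 1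
    · have hu' : m + t • v + u ∈ Metric.ball (m + t • v) 1 := by simpa using hu
      simp only [Set.indicator_of_mem hu, Set.indicator_of_mem hu']
    · have hu' : m + t • v + u ∉ Metric.ball (m + t • v) 1 := by simpa using hu
      simp only [Set.indicator_of_notMem hu, Set.indicator_of_notMem hu']
  simp_rw [e]
  rw [← integral_zero (EuclideanSpace ℝ (Fin n)) ℝ (μ := volume)]
  refine tendsto_integral_filter_of_dominated_convergence (fun x => ‖p x‖)
    (Filter.Eventually.of_forall fun t =>
      (hp.indicator Metric.isOpen_ball.measurableSet).aestronglyMeasurable)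
    (Filter.Eventually.of_forall fun t => ae_of_all _ fun x => norm_indicator_le_norm_self _ _)
    hp.norm (ae_of_all _ fun x => ?_)
  refine tendsto_const_nhds.congr' ?_
  filter_upwards [eventually_ge_atTop ((1 + ‖x - m‖) / ‖v‖)] with t ht
  rw [Set.indicator_of_notMem]
  intro hx
  have h1 : ‖x - m - t • v‖ < 1 := by
    rw [sub_sub, ← dist_eq_norm]; exact hx
  have h2 : ‖t • v‖ ≤ ‖x - m‖ + ‖x - m - t • v‖ := by
    calc ‖t • v‖ = ‖(x - m) - (x - m - t • v)‖ := by congr 1; abel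
      _ ≤ _ := norm_sub_le _ _
  have h3 : 1 + ‖x - m‖ ≤ t * ‖v‖ := (div_le_iff₀ hv0).1 ht
  have h4 : t * ‖v‖ ≤ ‖t • v‖ := by
    rw [norm_smul]; exact mul_le_mul_of_nonneg_right (le_abs_self t) hv0.le
  linarith

/-- If `e^{-c}` is integrable, then every bound `P t` for the averages of `c (t v ± u)`, `‖u‖ ≤ 1`,
tends to infinity: otherwise the unit balls around `t v` would carry a mass bounded from below. -/
theorem eventually_lt_of_integrable_exp {c : EuclideanSpace ℝ (Fin n) → ℝ} (hc : Continuous c)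
    (hi : Integrable fun u => Real.exp (-c u)) {v : EuclideanSpace ℝ (Fin n)} (hv : v ≠ 0)
    {P : ℝ → ℝ} (hP : ∀ t, 0 ≤ t → ∀ u : EuclideanSpace ℝ (Fin n), ‖u‖ ≤ 1 →
      c (t • v + u) + c (t • v - u) ≤ 2 * P t) (K : ℝ) : ∀ᶠ t in atTop, K < P t := by
  set B : Set (EuclideanSpace ℝ (Fin n)) := Metric.ball 0 1
  have hB0 : 0 < volume.real B :=
    ENNReal.toReal_pos (Metric.measure_ball_pos _ _ one_pos).ne' measure_ball_lt_top.ne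
  have h1 := tendsto_setIntegral_ball_add_smul hi 0 hv
  have h2 : 0 < volume.real B * Real.exp (-K) := by positivity
  filter_upwards [h1.eventually_lt_const h2, eventually_ge_atTop 0] with t ht ht0
  simp only [zero_add] at ht
  have hgc : Continuous fun u => Real.exp (-c (t • v + u)) := by fun_prop
  have hgi : ∀ {g : EuclideanSpace ℝ (Fin n) → ℝ}, Continuous g → IntegrableOn g B := fun hg =>
    (hg.continuousOn.integrableOn_compact (isCompact_closedBall 0 1)).mono_set
      Metric.ball_subset_closedBall
  -- average over `u` and `-u`
  have hle : volume.real B * Real.exp (-P t) ≤ ∫ u in B, Real.exp (-c (t • v + u)) := by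
    have h3 : ∫ u in B, (2 : ℝ) * Real.exp (-P t)
        ≤ ∫ u in B, (Real.exp (-c (t • v + u)) + Real.exp (-c (t • v + -u))) := by
      refine setIntegral_mono_on (hgi continuous_const) (hgi (by fun_prop))
        Metric.isOpen_ball.measurableSet fun u hu => ?_
      have h4 := hP t ht0 u (by simpa [B] using (mem_ball_zero_iff.1 hu).le)
      rw [sub_eq_add_neg] at h4
      set a := c (t • v + u)
      set b := c (t • v + -u)
      have h5 : Real.exp (-P t) ≤ Real.exp (-a / 2) * Real.exp (-b / 2) := by
        rw [← Real.exp_add]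
        exact Real.exp_le_exp.2 (by linarith)
      have h6 : ∀ z, Real.exp (-z) = Real.exp (-z / 2) ^ 2 := fun z => by
        rw [← Real.exp_nat_mul]; congr 1; push_cast; ring
      rw [h6 a, h6 b]
      nlinarith [sq_nonneg (Real.exp (-a / 2) - Real.exp (-b / 2))]
    rw [integral_add (hgi hgc) (hgi (by fun_prop)),
      setIntegral_ball_comp_neg (fun u => Real.exp (-c (t • v + u))), setIntegral_const,
      smul_eq_mul] at h3
    linarith
  have h7 := hle.trans_lt ht
  have h8 := Real.exp_lt_exp.1 (lt_of_mul_lt_mul_left h7 hB0.le)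
  linarith

theorem nonneg_of_eventually_pos {a b c d : ℝ}
    (h : ∀ᶠ t in atTop, 0 < a * t + b * t ^ 2 + c * t ^ 3 + d) : 0 ≤ c := by
  by_contra! hc
  obtain ⟨t, h1, h2, h3⟩ := (h.and ((eventually_ge_atTop (1 : ℝ)).and
    (eventually_ge_atTop ((|a| + |b| + |d|) / -c)))).exists
  have hc' : 0 < -c := by linarith
  have h4 : |a| + |b| + |d| ≤ t * -c := (div_le_iff₀ hc').1 h3
  have h5 : a * t ≤ |a| * t ^ 2 := by
    nlinarith [le_abs_self a, abs_nonneg a, mul_nonneg (abs_nonneg a) (by linarith : 0 ≤ t),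
      mul_le_mul_of_nonneg_right (le_abs_self a) (by linarith : 0 ≤ t)]
  have h6 : b * t ^ 2 ≤ |b| * t ^ 2 := mul_le_mul_of_nonneg_right (le_abs_self b) (sq_nonneg t)
  have h7 : d ≤ |d| * t ^ 2 :=
    (le_abs_self d).trans (le_mul_of_one_le_right (abs_nonneg d) (by nlinarith))
  have h8 : (|a| + |b| + |d|) * t ^ 2 ≤ t * -c * t ^ 2 :=
    mul_le_mul_of_nonneg_right h4 (sq_nonneg t)
  nlinarith

theorem pos_of_eventually_lt {a b d : ℝ} (ha : a ≤ 0)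
    (h : ∀ᶠ t in atTop, d < a * t + b * t ^ 2 + d) : 0 < b := by
  by_contra! hb
  obtain ⟨t, h1, h2⟩ := (h.and (eventually_ge_atTop (0 : ℝ))).exists
  nlinarith [mul_nonneg (neg_nonneg.2 ha) h2, mul_nonneg (neg_nonneg.2 hb) (sq_nonneg t)]

/-- If `e^{-c}` is integrable for a polynomial `c` of degree at most three without constant term,
then the cubic part of `c` vanishes and its quadratic part is positive definite. -/
theorem cubic_eq_zero_and_quadratic_pos {c c₁ c₂ c₃ : EuclideanSpace ℝ (Fin n) → ℝ}
    (hc : ∀ v, c v = c₁ v + c₂ v + c₃ v) (hcc : Continuous c)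
    (hi : Integrable fun u => Real.exp (-c u))
    (h₁ : ∀ (t : ℝ) v, c₁ (t • v) = t * c₁ v) (h₂ : ∀ (t : ℝ) v, c₂ (t • v) = t ^ 2 * c₂ v)
    (h₃ : ∀ (t : ℝ) v, c₃ (t • v) = t ^ 3 * c₃ v) (h₁a : ∀ v u, c₁ (v + u) + c₁ (v - u) = 2 * c₁ v)
    (h₂a : ∀ v u, c₂ (v + u) + c₂ (v - u) = 2 * c₂ v + 2 * c₂ u)
    (h₂c : Continuous c₂)
    {η : EuclideanSpace ℝ (Fin n) → EuclideanSpace ℝ (Fin n) → ℝ} (hη : ∀ v, Continuous (η v))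
    (h₃a : ∀ v u (t : ℝ), c₃ (t • v + u) + c₃ (t • v - u) = 2 * (t ^ 3 * c₃ v) + t * η v u)
    (v : EuclideanSpace ℝ (Fin n)) : c₃ v = 0 ∧ (v ≠ 0 → 0 < c₂ v) := by
  obtain ⟨M, hM⟩ := (isCompact_closedBall (0 : EuclideanSpace ℝ (Fin n))
    1).exists_bound_of_continuousOn h₂c.continuousOn
  have hM' : ∀ u : EuclideanSpace ℝ (Fin n), ‖u‖ ≤ 1 → c₂ u ≤ M := fun u hu =>
    (le_abs_self _).trans (hM u (by simpa using hu))
  have hneg₃ : ∀ v, c₃ (-v) = -c₃ v := fun v => by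
    have := h₃ (-1) v
    rw [neg_one_smul] at this
    rw [this]; ring
  have hneg₁ : ∀ v, c₁ (-v) = -c₁ v := fun v => by
    have := h₁ (-1) v
    rw [neg_one_smul] at this
    rw [this]; ring
  have hneg₂ : ∀ v, c₂ (-v) = c₂ v := fun v => by
    have := h₂ (-1) v
    rw [neg_one_smul] at this
    rw [this]; ring
  have hsum : ∀ v u (t : ℝ), c (t • v + u) + c (t • v - u)
      = 2 * (t * c₁ v + t ^ 2 * c₂ v + t ^ 3 * c₃ v) + 2 * c₂ u + t * η v u := fun v u t => by
    have e1 := h₁a (t • v) u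
    have e2 := h₂a (t • v) u
    have e3 := h₃a v u t
    rw [h₁] at e1
    rw [h₂] at e2
    rw [hc, hc]
    linarith
  have hnonneg : ∀ v, v ≠ 0 → 0 ≤ c₃ v := fun v hv => by
    obtain ⟨L, hL⟩ := (isCompact_closedBall (0 : EuclideanSpace ℝ (Fin n))
      1).exists_bound_of_continuousOn (hη v).continuousOn
    have := eventually_lt_of_integrable_exp hcc hi hv
      (P := fun t => (c₁ v + L / 2) * t + c₂ v * t ^ 2 + c₃ v * t ^ 3 + M) (fun t ht u hu => by
        have h4 : η v u ≤ L := (le_abs_self _).trans (hL u (by simpa using hu))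
        rw [hsum]
        nlinarith [hM' u hu, mul_le_mul_of_nonneg_left h4 ht]) 0
    exact nonneg_of_eventually_pos this
  have hzero : ∀ v, c₃ v = 0 := fun v => by
    rcases eq_or_ne v 0 with rfl | hv
    · simpa using h₃ 0 0
    · have := hnonneg (-v) (neg_ne_zero.2 hv)
      rw [hneg₃] at this
      linarith [hnonneg v hv]
  refine ⟨hzero v, fun hv => ?_⟩
  have hη0 : ∀ v u, η v u = 0 := fun v u => by
    have := h₃a v u 1
    simp only [hzero] at this
    linarith
  have hpos : ∀ v, v ≠ 0 → c₁ v ≤ 0 → 0 < c₂ v := fun v hv h => by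
    refine pos_of_eventually_lt h (d := M) ?_
    exact eventually_lt_of_integrable_exp hcc hi hv
      (P := fun t => c₁ v * t + c₂ v * t ^ 2 + M) (fun t _ u hu => by
        rw [hsum, hη0, hzero]
        nlinarith [hM' u hu]) M
  rcases le_total (c₁ v) 0 with h | h
  · exact hpos v hv h
  · rw [← hneg₂]
    exact hpos (-v) (neg_ne_zero.2 hv) (by rw [hneg₁]; linarith)

end Escape

section IsGaussian

open scoped Matrix.Norms.L2Operator

variable {n : ℕ} {μ : Measure (EuclideanSpace ℝ (Fin n))} {p : EuclideanSpace ℝ (Fin n) → ℝ}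

/-- A probability measure whose density is the exponential of a quadratic polynomial with negative
definite quadratic part is Gaussian. -/
theorem isGaussian_of_density_eq [IsProbabilityMeasure μ] (hp : IsDensity μ p)
    {W : Matrix (Fin n) (Fin n) ℝ} (hW : W.PosDef) {m : EuclideanSpace ℝ (Fin n)} {C : ℝ}
    (h : ∀ x, p x = C * Real.exp (-(1 / 2) * ((x - m).ofLp ⬝ᵥ W *ᵥ (x - m).ofLp))) :
    IsGaussian μ := by
  obtain ⟨c, hc, hg⟩ := multivariateGaussian_eq_withDensity m hW.inv
  rw [Matrix.nonsing_inv_nonsing_inv W ((Matrix.isUnit_iff_isUnit_det W).1 hW.isUnit)] at hg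
  have hWt : Wᵀ = W := by
    rw [← Matrix.conjTranspose_eq_transpose_of_trivial]; exact hW.isHermitian.eq
  have hC : 0 ≤ C := by
    have := hp.nonneg m
    rw [h m] at this
    simpa using this
  have hμ : μ = ENNReal.ofReal (C / c) • multivariateGaussian m W⁻¹ := by
    rw [hg, hp.eq_withDensity, ← withDensity_smul _
      (continuous_gaussian c m hWt).measurable.ennreal_ofReal]
    congr 1
    ext1 x
    rw [Pi.smul_apply, smul_eq_mul, ← ENNReal.ofReal_mul (by positivity), h]
    congr 1
    field_simp
  have h1 : ENNReal.ofReal (C / c) = 1 := by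
    have h2 := congrArg (fun ν => ν Set.univ) hμ
    simpa using h2.symm
  rw [h1, one_smul] at hμ
  rw [hμ]
  infer_instance

/-- A law with a continuous density and the universal moment matching property is Gaussian: its
density is the exponential of a cubic polynomial, whose integrability removes the cubic part. -/
theorem isGaussian_of_secondOrderUniversal [IsProbabilityMeasure μ]
    (hμ : MemLp id 2 μ) (hS : (covMatrix μ).PosDef) (hp : IsDensity μ p) (hpc : Continuous p)
    (hU : SecondOrderUniversal μ p) : IsGaussian μ := by
  obtain ⟨r, hm0, hr⟩ := exists_density_eq_exp hμ hS hp hpc hU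
  set m := mean μ
  obtain ⟨c₁, hc₁⟩ : ∃ c₁ : EuclideanSpace ℝ (Fin n) →L[ℝ] ℝ, c₁ = r (1, 0, 0) := ⟨_, rfl⟩
  obtain ⟨b, hb⟩ : ∃ b : EuclideanSpace ℝ (Fin n) →L[ℝ] EuclideanSpace ℝ (Fin n) →L[ℝ] ℝ,
    b = (1 / 2 : ℝ) • r.comp ((ContinuousLinearMap.inr ℝ _ _).comp
      (ContinuousLinearMap.inl ℝ _ _)) := ⟨_, rfl⟩
  set V : EuclideanSpace ℝ (Fin n) → EuclideanSpace ℝ (Fin n) → Matrix (Fin n) (Fin n) ℝ :=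
    fun a b => Matrix.vecMulVec a.ofLp b.ofLp with hV
  obtain ⟨k, hk⟩ : ∃ k : Matrix (Fin n) (Fin n) ℝ →L[ℝ] EuclideanSpace ℝ (Fin n) →L[ℝ] ℝ,
    k = (1 / 3 : ℝ) • r.comp ((ContinuousLinearMap.inr ℝ _ _).comp
      (ContinuousLinearMap.inr ℝ _ _)) := ⟨_, rfl⟩
  obtain ⟨c, hc⟩ : ∃ c : EuclideanSpace ℝ (Fin n) → ℝ, c = fun v => c₁ v + b v v + k (V v v) v :=
    ⟨_, rfl⟩
  have hpe : ∀ v, p (m + v) = p m * Real.exp (-c v) := fun v => by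
    rw [hr, hc, hc₁, hb, hk]
    congr 3
    simp only [smul_apply, ContinuousLinearMap.comp_apply, ContinuousLinearMap.inr_apply,
      ContinuousLinearMap.inl_apply, smul_eq_mul, hV]
    ring
  have hpi : Integrable p := by
    have h1 := hp.eq_withDensity
    have h2 : ∫⁻ x, ENNReal.ofReal (p x) ≠ ⊤ := by
      rw [← setLIntegral_univ, ← withDensity_apply _ MeasurableSet.univ, ← h1]
      exact measure_ne_top _ _
    exact ⟨hp.measurable.aestronglyMeasurable,
      (hasFiniteIntegral_iff_ofReal (ae_of_all _ hp.nonneg)).2 h2.lt_top⟩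
  have hci : Integrable fun u => Real.exp (-c u) := by
    have h1 := (hpi.comp_add_left m).const_mul (p m)⁻¹
    refine h1.congr (ae_of_all _ fun u => ?_)
    simp only [hpe]
    field_simp
  have hkc : ∀ v : EuclideanSpace ℝ (Fin n), Continuous fun u : EuclideanSpace ℝ (Fin n) =>
      k (V v u + V u v) u := fun v => by
    have e : ∀ u, V v u + V u v = V (v + u) (v + u) - V v v - V u u := fun u => by
      simp only [hV, WithLp.ofLp_add, Matrix.add_vecMulVec, Matrix.vecMulVec_add]
      abel
    simp only [e]
    have h1 : Continuous fun u : EuclideanSpace ℝ (Fin n) => V (v + u) (v + u) :=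
      continuous_vecMulVec_self.comp (continuous_const.add continuous_id)
    exact (k.continuous.comp ((h1.sub continuous_const).sub
      continuous_vecMulVec_self)).clm_apply continuous_id
  have hbc : Continuous fun v => b v v := b.continuous.clm_apply continuous_id
  have hkk : Continuous fun u : EuclideanSpace ℝ (Fin n) => k (V u u) u :=
    (k.continuous.comp continuous_vecMulVec_self).clm_apply continuous_id
  have hkv : ∀ v : EuclideanSpace ℝ (Fin n), Continuous fun u : EuclideanSpace ℝ (Fin n) =>
      k (V u u) v := fun v =>
    (k.continuous.comp continuous_vecMulVec_self).clm_apply continuous_const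
  have hcubic := cubic_eq_zero_and_quadratic_pos (c := c) (c₁ := c₁) (c₂ := fun v => b v v)
    (c₃ := fun v => k (V v v) v) (η := fun v u => 2 * k (V v u + V u v) u + 2 * k (V u u) v)
    (fun v => by rw [hc]) (by rw [hc]; exact (c₁.continuous.add hbc).add hkk) hci
    (fun t v => by simp) (fun t v => by simp; ring)
    (fun t v => by
      simp only [hV, WithLp.ofLp_smul, Matrix.vecMulVec_smul, Matrix.smul_vecMulVec, map_smul,
        smul_apply, smul_eq_mul]
      ring)
    (fun v u => by rw [map_add, map_sub]; ring)
    (fun v u => by simp only [map_add, map_sub, add_apply, sub_apply]; ring)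
    hbc (fun v => (continuous_const.mul (hkc v)).add (continuous_const.mul (hkv v)))
    (fun v u t => by
      simp only [hV, sub_eq_add_neg, WithLp.ofLp_add, WithLp.ofLp_neg, WithLp.ofLp_smul,
        Matrix.add_vecMulVec, Matrix.vecMulVec_add, Matrix.vecMulVec_smul, Matrix.smul_vecMulVec,
        Matrix.vecMulVec_neg, Matrix.neg_vecMulVec, map_add, map_smul, map_neg, add_apply,
        smul_apply, neg_apply, smul_eq_mul]
      ring)
  have hk0 : ∀ v, k (V v v) v = 0 := fun v => (hcubic v).1
  have hbpos : ∀ v, v ≠ 0 → 0 < b v v := fun v hv => (hcubic v).2 hv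
  -- the symmetric matrix of the quadratic form `2 b`
  set e : Fin n → EuclideanSpace ℝ (Fin n) := fun i => EuclideanSpace.single i 1
  obtain ⟨W, hWdef⟩ : ∃ W : Matrix (Fin n) (Fin n) ℝ,
    W = Matrix.of fun i j => b (e i) (e j) + b (e j) (e i) := ⟨_, rfl⟩
  have hsum : ∀ y : EuclideanSpace ℝ (Fin n), y = ∑ i, y i • e i := fun y => by
    have := (EuclideanSpace.basisFun (Fin n) ℝ).sum_repr y
    simpa [e] using this.symm
  have hbW : ∀ y : EuclideanSpace ℝ (Fin n), y.ofLp ⬝ᵥ W *ᵥ y.ofLp = 2 * b y y := fun y => by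
    have h1 : b y y = ∑ i, ∑ j, y i * y j * b (e i) (e j) := by
      conv_lhs => rw [hsum y]
      simp only [map_sum, sum_apply, map_smul, smul_apply, smul_eq_mul, Finset.mul_sum]
      rw [Finset.sum_comm]
      exact Finset.sum_congr rfl fun i _ => Finset.sum_congr rfl fun j _ => by ring
    have h2 : b y y = ∑ i, ∑ j, y i * y j * b (e j) (e i) := by
      rw [h1, Finset.sum_comm]
      exact Finset.sum_congr rfl fun i _ => Finset.sum_congr rfl fun j _ => by ring
    rw [two_mul]
    nth_rewrite 1 [h1]
    rw [h2]
    simp only [dotProduct, Matrix.mulVec, hWdef, Matrix.of_apply, Finset.mul_sum,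
      ← Finset.sum_add_distrib]
    exact Finset.sum_congr rfl fun i _ => Finset.sum_congr rfl fun j _ => by ring
  have hWh : W.IsHermitian := by
    ext i j
    simp [hWdef, add_comm]
  have hWpos : W.PosDef := by
    refine Matrix.PosDef.of_dotProduct_mulVec_pos hWh fun x hx => ?_
    have h1 := hbW (WithLp.toLp 2 x)
    have h2 := hbpos (WithLp.toLp 2 x) (by simpa using hx)
    simp only [star_trivial]
    rw [h1]
    linarith
  have hWt : Wᵀ = W := by
    rw [← Matrix.conjTranspose_eq_transpose_of_trivial]; exact hWh.eq
  have hWu : IsUnit W.det := (Matrix.isUnit_iff_isUnit_det W).1 hWpos.isUnit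
  -- completing the square
  set a : Fin n → ℝ := fun i => c₁ (e i)
  set d : EuclideanSpace ℝ (Fin n) := WithLp.toLp 2 (-(W⁻¹ *ᵥ a)) with hd
  have ha : ∀ y : EuclideanSpace ℝ (Fin n), c₁ y = y.ofLp ⬝ᵥ a := fun y => by
    conv_lhs => rw [hsum y]
    simp [dotProduct, a]
  have hWd : W *ᵥ d.ofLp = -a := by
    rw [hd]
    simp only [Matrix.mulVec_neg, Matrix.mulVec_mulVec, Matrix.mul_nonsing_inv _ hWu,
      Matrix.one_mulVec]
  have hsq : ∀ y : EuclideanSpace ℝ (Fin n), c y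
      = 1 / 2 * ((y - d).ofLp ⬝ᵥ W *ᵥ (y - d).ofLp) - 1 / 2 * (d.ofLp ⬝ᵥ W *ᵥ d.ofLp) :=
    fun y => by
      have h1 : d.ofLp ⬝ᵥ W *ᵥ y.ofLp = y.ofLp ⬝ᵥ W *ᵥ d.ofLp := by
        rw [Matrix.dotProduct_mulVec, ← Matrix.mulVec_transpose, hWt, dotProduct_comm]
      have h2 : y.ofLp ⬝ᵥ W *ᵥ d.ofLp = -c₁ y := by rw [hWd, dotProduct_neg, ha]
      rw [WithLp.ofLp_sub, Matrix.mulVec_sub, dotProduct_sub, sub_dotProduct, sub_dotProduct, h1,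
        hbW y, h2, hc]
      simp only [hk0]
      ring
  refine isGaussian_of_density_eq hp hWpos (m := m + d)
    (C := p m * Real.exp (1 / 2 * (d.ofLp ⬝ᵥ W *ᵥ d.ofLp))) fun x => ?_
  have h1 := hpe (x - m)
  rw [add_sub_cancel] at h1
  rw [h1, hsq, mul_assoc, ← Real.exp_add, sub_sub]
  congr 2
  ring

end IsGaussian

end MomentMatching

end

theorem theorem2 (n : ℕ) (μ : Measure (EuclideanSpace ℝ (Fin n))) [IsProbabilityMeasure μ]
    (hμ : MemLp id 2 μ) (hcov : IsUnit (MomentMatching.covMatrix μ).det) :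
    (IsGaussian μ →
      (∃ p, MomentMatching.IsDensity μ p) ∧
      (∀ p, MomentMatching.IsDensity μ p → MomentMatching.SecondOrderUniversal μ p) ∧
      ∀ f : EuclideanSpace ℝ (Fin n) → ℝ, ContDiff ℝ ∞ f → HasCompactSupport f →
        ∃ A : ℕ → ℝ,
          ((fun N : ℕ => A N - 1) =O[atTop] fun N : ℕ => (N : ℝ) ^ (-(1 / 2) : ℝ)) ∧
          ∀ N : ℕ, n < N →
            Var[MomentMatching.matchedEstimator μ f; MomentMatching.sampleLaw μ N] =
              A N / N *
                (Var[f; μ]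
                  - MomentMatching.expGrad μ f ⬝ᵥ
                      (MomentMatching.covMatrix μ *ᵥ MomentMatching.expGrad μ f)
                  - 1 / 2 * ((MomentMatching.covMatrix μ * MomentMatching.expHess μ f) ^ 2).trace)) ∧
    (∀ p : EuclideanSpace ℝ (Fin n) → ℝ, MomentMatching.IsDensity μ p → Differentiable ℝ p →
      MomentMatching.SecondOrderUniversal μ p → IsGaussian μ) := by
  have hS := MomentMatching.posDef_covMatrix hμ hcov
  refine ⟨fun hG => ⟨MomentMatching.exists_isDensity hS,
    fun p _ => MomentMatching.secondOrderUniversal_of_isGaussian hS p, fun f hf hc => ?_⟩,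
    fun p hp hd hU =>
      MomentMatching.isGaussian_of_secondOrderUniversal hμ hS hp hd.continuous hU⟩
  obtain ⟨A, hA, h⟩ := MomentMatching.exists_variance_matchedEstimator_eq hS hf hc
  refine ⟨A, hA, fun N hN => ?_⟩
  rw [h N hN, MomentMatching.variance_sub_quadraticPart hS (hc.hasTemperateGrowth hf)]
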